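/- **Setting.** Let $(\xi_n)_{n\in\mathbb Z}$ be a stationary sequence on a probability space $(\Omega_0,\mathscr F,\mathbf P)$ with values in a measurable space $\mathcal Y$, let $\mathbb P$ be its law on $\Omega=\mathcal Y^{\mathbb Z}$, and let $\sigma$ be the left shift on $\Omega$. Let $\alpha_n=\sup_{k}\sup\{|\mathbf P(A\cap B)-\mathbf P(A)\mathbf P(B)|:\ A\in\sigma(\xi_j,\,j\le k),\ B\in\sigma(\xi_j,\,j\ge k+n)\}$. Let $(X,\mathcal B,m)$ be a probability space. All functions on $X$ below are measurable. Let $v$ be a variation, that is, a map from functions $f:X\to\mathbb C$ to $[0,\infty]$ with $v(cf)=|c|v(f)$ for $c\in\mathbb R$, $v(f+g)\le v(f)+v(g)$, $v(fg)\le\sup|f|\,v(g)+\sup|g|\,v(f)$, $v=0$ on constants, and $\sup|f|\le C_0\|f\|_{BV}$, where $\|f\|_{BV}=\|f\|_{L^1(m)}+v(f)$ and $C_0$ is a constant. Let $T_y:X\to X$ ($y\in\mathcal Y$) be maps such that $\tau(\omega,x)=(\sigma\omega,T_{\omega_0}x)$ is measurable on $\Omega\times X$; write $T_\omega=T_{\omega_0}$.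 Let $\mathcal L_y$ be a version of the transfer operator of $T_y$: it maps integrable functions to integrable functions, and $\int g\cdot(f\circ T_y)\,dm=\int(\mathcal L_yg)\,f\,dm$ for $g\in L^1(m)$, $f\in L^\infty(m)$. Write $\mathcal L_\omega=\mathcal L_{\omega_0}$ and $\mathcal L_\omega^n=\mathcal L_{\sigma^{n-1}\omega}\circ\cdots\circ\mathcal L_\omega$. **Assumptions.** There are a measurable $h:\Omega\times X\to[0,\infty)$, a constant $\lambda>0$, some $0<\varepsilon<\lambda/3$ and a measurable $K:\Omega\to[1,\infty)$ with the following properties (with $h_\omega=h(\omega,\cdot)$, for $\mathbb P$-a.e. $\omega$ where $\omega$ occurs). 1. $d\mu=h(\omega,x)\,dm(x)\,d\mathbb P(\omega)$ is a $\tau$-invariant probability measure on $\Omega\times X$. Moreover $\|h_\omega\|_{BV}<\infty$, $\int h_\omega\,dm=1$, and $h_\omega>0$ and $\mathcal L_\omega h_\omega=h_{\sigma\omega}$ hold $m$-a.e. 2. $K$ is tempered: $\frac1n\ln K(\sigma^n\omega)\to0$ as $n\to\infty$. Also $K(\omega)e^{-\varepsilon|n|}\le K(\sigma^n\omega)\le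 K(\omega)e^{\varepsilon|n|}$ for all $n\in\mathbb Z$. 3. $\|\mathcal L^n_\omega\mathbf 1-h_{\sigma^n\omega}\|_{BV}\le K(\omega)e^{-\lambda n}$ for all $n\ge1$, and $v(g\circ T_\omega)\le K(\omega)v(g)$ for all $g:X\to\mathbb C$. 4. With $L_\omega g=\mathcal L_\omega(gh_\omega)/h_{\sigma\omega}$, $L_\omega^n=L_{\sigma^{n-1}\omega}\circ\cdots\circ L_\omega$ and $\mu_\omega=h_\omega\,dm$: $\|L^n_\omega g-\mu_\omega(g)\mathbf 1\|_{BV}\le K(\omega)\|g\|_{BV}e^{-\lambda n}$ for all $n\ge1$ and all $g:X\to\mathbb C$. 5. There are $c_1,c_2,\eta>0$ with $\alpha_n\le c_1e^{-c_2n^\eta}$ for all $n\ge1$. Let $\varphi(\omega,x)=\varphi_{\omega_0}(x)$ be a real measurable observable that depends on $\omega$ only through $\omega_0$, with $\int\varphi\,d\mu=0$ and $\|\varphi\|_K:=\operatorname{ess\,sup}_{\omega}K(\omega)\|\varphi_{\omega_0}\|_{BV}<\infty$. Let $S_n=\sum_{j=0}^{n-1}\varphi\circ\tau^j$, a random variable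 on $(\Omega\times X,\mu)$, let $\gamma=1/\eta$, and let $Z$ be standard normal. **Theorem (Rosenthal-type moment estimates).** There is a constant $c_0>0$, which depends only on $c_1,c_2,\eta,C_0,\lambda$ and (an upper bound for) $\|\varphi\|_K$, such that for all integers $p\ge1$ and $n\ge0$ the variable $S_n^p$ is $\mu$-integrable and $$\Big|\mathbb E[S_n^p]-(\mathrm{Var}\,S_n)^{p/2}\,\mathbb E[Z^p]\Big|\le c_0^p\,(p!)^{1+\gamma}\sum_{1\le u\le(p-1)/2}n^u\frac{p^u}{(u!)^2},$$ where, for each fixed $p$, the right-hand side is $O(n^{[(p-1)/2]})$ as $n\to\infty$. In particular, for every real $p>0$, $S_n\in L^p(\mu)$ for all $n$ and $\|S_n\|_{L^p(\mu)}=O(\sqrt n)$ as $n\to\infty$. -/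

import Mathlib

open MeasureTheory ProbabilityTheory Filter Topology Asymptotics
open scoped ENNReal

noncomputable section

namespace RandomSkew

/-! ### Mixing of the driving process -/

/-- `α(𝒢, ℋ) = sup {|P(A ∩ B) - P(A) P(B)| : A ∈ 𝒢, B ∈ ℋ}`. -/
def alphaCoeff {Ω₀ : Type*} [MeasurableSpace Ω₀] (P : Measure Ω₀)
    (𝒢 ℋ : MeasurableSpace Ω₀) : ℝ :=
  sSup {r : ℝ | ∃ A B : Set Ω₀, MeasurableSet[𝒢] A ∧ MeasurableSet[ℋ] B ∧
    r = |P.real (A ∩ B) - P.real A * P.real B|}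

/-- The `σ`-algebra generated by `ξ j`, `j ≤ k`. -/
@[reducible] def sigmaPast {Ω₀ 𝒴 : Type*} [MeasurableSpace 𝒴] (ξ : ℤ → Ω₀ → 𝒴) (k : ℤ) :
    MeasurableSpace Ω₀ :=
  ⨆ j : Set.Iic k, MeasurableSpace.comap (ξ j) inferInstance

/-- The `σ`-algebra generated by `ξ j`, `j ≥ k`. -/
@[reducible] def sigmaFuture {Ω₀ 𝒴 : Type*} [MeasurableSpace 𝒴] (ξ : ℤ → Ω₀ → 𝒴) (k : ℤ) :
    MeasurableSpace Ω₀ :=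
  ⨆ j : Set.Ici k, MeasurableSpace.comap (ξ j) inferInstance

/-- The `n`-th `α`-mixing coefficient of the process `ξ`. -/
def alphaMixing {Ω₀ 𝒴 : Type*} [MeasurableSpace Ω₀] [MeasurableSpace 𝒴] (P : Measure Ω₀)
    (ξ : ℤ → Ω₀ → 𝒴) (n : ℕ) : ℝ :=
  ⨆ k : ℤ, alphaCoeff P (sigmaPast ξ k) (sigmaFuture ξ (k + n))

/-! ### The shift system and the skew product -/

/-- The `n`-th power `σ^n` of the left shift on `𝒴^ℤ`. -/
def shift {𝒴 : Type*} (n : ℤ) (ω : ℤ → 𝒴) : ℤ → 𝒴 := fun k => ω (k + n)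

/-- The law of a two-sided process on the path space `𝒴^ℤ`. -/
def pathLaw {Ω₀ 𝒴 : Type*} [MeasurableSpace Ω₀] [MeasurableSpace 𝒴] (P : Measure Ω₀)
    (ξ : ℤ → Ω₀ → 𝒴) : Measure (ℤ → 𝒴) :=
  P.map (fun w k => ξ k w)

/-- A two-sided stationary sequence of random elements of `𝒴`. -/
structure IsStationaryProcess {Ω₀ 𝒴 : Type*} [MeasurableSpace Ω₀] [MeasurableSpace 𝒴]
    (P : Measure Ω₀) (ξ : ℤ → Ω₀ → 𝒴) : Prop where
  measurable : ∀ k, Measurable (ξ k)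
  stationary : pathLaw P (fun k => ξ (k + 1)) = pathLaw P ξ

/-- The skew product `τ(ω, x) = (σ ω, T_{ω₀} x)`. -/
def skew {𝒴 X : Type*} (T : 𝒴 → X → X) (z : (ℤ → 𝒴) × X) : (ℤ → 𝒴) × X :=
  (shift 1 z.1, T (z.1 0) z.2)

/-- Random compositions `A_ω^n = A_{σ^{n-1} ω} ∘ ⋯ ∘ A_{σ ω} ∘ A_ω`. -/
def iter {𝒴 β : Type*} (A : (ℤ → 𝒴) → β → β) : ℕ → (ℤ → 𝒴) → β → β
  | 0, _ => id
  | n + 1, ω => iter A n (shift 1 ω) ∘ A ω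

/-- `S_n = ∑_{j < n} φ ∘ τ^j` for the observable `(ω, x) ↦ φ_{ω₀}(x)`. -/
def birkhoff {𝒴 X : Type*} (T : 𝒴 → X → X) (φ : 𝒴 → X → ℝ) (n : ℕ)
    (z : (ℤ → 𝒴) × X) : ℝ :=
  ∑ j ∈ Finset.range n, φ (((skew T)^[j] z).1 0) ((skew T)^[j] z).2

/-! ### Variation and the transfer operator -/

/-- `sup |f|`, a genuine supremum. -/
def supNorm {X : Type*} (f : X → ℂ) : ℝ≥0∞ := ⨆ x, ‖f x‖ₑ

/-- `‖f‖_BV = ‖f‖_{L¹(m)} + v(f)`. -/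
def bvNorm {X : Type*} [MeasurableSpace X] (m : Measure X) (v : (X → ℂ) → ℝ≥0∞)
    (f : X → ℂ) : ℝ≥0∞ :=
  eLpNorm f 1 m + v f

/-- A notion of variation of (measurable) functions on `X`; its values on non-measurable
functions are irrelevant. -/
structure IsVariation {X : Type*} [MeasurableSpace X] (m : Measure X)
    (v : (X → ℂ) → ℝ≥0∞) (C₀ : ℝ) : Prop where
  smul : ∀ (c : ℝ) (f : X → ℂ), Measurable f → v (fun x => (c : ℂ) * f x) = ‖c‖ₑ * v f
  add_le : ∀ f g : X → ℂ, Measurable f → Measurable g → v (fun x => f x + g x) ≤ v f + v g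
  mul_le : ∀ f g : X → ℂ, Measurable f → Measurable g →
    v (fun x => f x * g x) ≤ supNorm f * v g + supNorm g * v f
  const : ∀ c : ℂ, v (fun _ => c) = 0
  sup_le : ∀ f : X → ℂ, Measurable f → supNorm f ≤ ENNReal.ofReal C₀ * bvNorm m v f

/-- `L` is (a version, on functions, of) the transfer operator of `T` with respect to `m`:
`∫ g · (f ∘ T) dm = ∫ (L g) · f dm` for all `g ∈ L¹(m)` and `f ∈ L^∞(m)`. This duality
determines each `L g` up to an `m`-null set. -/
def IsTransferOperator {X : Type*} [MeasurableSpace X] (m : Measure X) (T : X → X)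
    (L : (X → ℂ) → (X → ℂ)) : Prop :=
  ∀ g : X → ℂ, Measurable g → Integrable g m →
    Measurable (L g) ∧ Integrable (L g) m ∧
      ∀ f : X → ℂ, MemLp f ∞ m → ∫ x, g x * f (T x) ∂m = ∫ x, L g x * f x ∂m

/-- The normalized operator `g ↦ ℒ_ω(g h_ω) / h_{σ ω}`. -/
def normalizedOp {𝒴 X : Type*} (L : 𝒴 → (X → ℂ) → (X → ℂ)) (h : (ℤ → 𝒴) → X → ℝ)
    (ω : ℤ → 𝒴) (g : X → ℂ) : X → ℂ :=
  fun x => L (ω 0) (fun y => g y * (h ω y : ℂ)) x / (h (shift 1 ω) x : ℂ)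

/-- The measure `dμ = h(ω, x) dm(x) dQ(ω)` on `𝒴^ℤ × X`. -/
def skewMeasure {𝒴 X : Type*} [MeasurableSpace 𝒴] [MeasurableSpace X]
    (Q : Measure (ℤ → 𝒴)) (m : Measure X) (h : (ℤ → 𝒴) → X → ℝ) :
    Measure ((ℤ → 𝒴) × X) :=
  (Q.prod m).withDensity (fun z => ENNReal.ofReal (h z.1 z.2))

/-- A tempered random variable with `K(σ^n ω)` between `K(ω) e^{-ε|n|}` and `K(ω) e^{ε|n|}`. -/
structure IsTempered {𝒴 : Type*} [MeasurableSpace 𝒴] (Q : Measure (ℤ → 𝒴))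
    (K : (ℤ → 𝒴) → ℝ) (ε : ℝ) : Prop where
  measurable : Measurable K
  one_le : ∀ ω, 1 ≤ K ω
  tempered : ∀ᵐ ω ∂Q, Tendsto (fun n : ℕ => Real.log (K (shift n ω)) / n) atTop (𝓝 0)
  slow : ∀ᵐ ω ∂Q, ∀ n : ℤ,
    K ω * Real.exp (-ε * |(n : ℝ)|) ≤ K (shift n ω) ∧
      K (shift n ω) ≤ K ω * Real.exp (ε * |(n : ℝ)|)

/-- The standing assumptions on the random operators. -/
structure StandingAssumption {𝒴 X : Type*} [MeasurableSpace 𝒴] [MeasurableSpace X]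
    (Q : Measure (ℤ → 𝒴)) (m : Measure X) (v : (X → ℂ) → ℝ≥0∞) (T : 𝒴 → X → X)
    (L : 𝒴 → (X → ℂ) → (X → ℂ)) (h : (ℤ → 𝒴) → X → ℝ) (K : (ℤ → 𝒴) → ℝ)
    (lam : ℝ) : Prop where
  h_measurable : Measurable (Function.uncurry h)
  h_nonneg : ∀ ω x, 0 ≤ h ω x
  isProb : IsProbabilityMeasure (skewMeasure Q m h)
  invariant : MeasurePreserving (skew T) (skewMeasure Q m h) (skewMeasure Q m h)
  h_bv : ∀ᵐ ω ∂Q, bvNorm m v (fun x => (h ω x : ℂ)) < ∞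
  h_integral : ∀ᵐ ω ∂Q, ∫ x, h ω x ∂m = 1
  h_pos : ∀ᵐ ω ∂Q, ∀ᵐ x ∂m, 0 < h ω x
  h_equivariant : ∀ᵐ ω ∂Q,
    L (ω 0) (fun x => (h ω x : ℂ)) =ᵐ[m] fun x => (h (shift 1 ω) x : ℂ)
  K_tempered : ∃ ε : ℝ, 0 < ε ∧ ε < lam / 3 ∧ IsTempered Q K ε
  decay_one : ∀ᵐ ω ∂Q, ∀ n : ℕ, 1 ≤ n →
    bvNorm m v (fun x => iter (fun ω' => L (ω' 0)) n ω (fun _ => 1) x - (h (shift n ω) x : ℂ))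
      ≤ ENNReal.ofReal (K ω * Real.exp (-lam * n))
  comp_le : ∀ᵐ ω ∂Q, ∀ g : X → ℂ, Measurable g →
    v (g ∘ T (ω 0)) ≤ ENNReal.ofReal (K ω) * v g
  decay : ∀ᵐ ω ∂Q, ∀ n : ℕ, 1 ≤ n → ∀ g : X → ℂ, Measurable g →
    bvNorm m v (fun x => iter (normalizedOp L h) n ω g x - ∫ y, g y * (h ω y : ℂ) ∂m)
      ≤ ENNReal.ofReal (K ω * Real.exp (-lam * n)) * bvNorm m v g

/-- `‖φ‖_K = ess sup_ω K(ω) ‖φ_ω‖_BV` with `φ_ω = φ_{ω₀}`. -/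
def scaledNorm {𝒴 X : Type*} [MeasurableSpace 𝒴] [MeasurableSpace X]
    (Q : Measure (ℤ → 𝒴)) (m : Measure X) (v : (X → ℂ) → ℝ≥0∞) (K : (ℤ → 𝒴) → ℝ)
    (φ : 𝒴 → X → ℝ) : ℝ≥0∞ :=
  essSup (fun ω => ENNReal.ofReal (K ω) * bvNorm m v (fun x => (φ (ω 0) x : ℂ))) Q

/-- `c₀^p (p!)^{1+γ} ∑_{1 ≤ u ≤ (p-1)/2} n^u p^u / (u!)²`. -/
def rosenthalBound (c₀ γ : ℝ) (p n : ℕ) : ℝ :=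
  c₀ ^ p * (p.factorial : ℝ) ^ (1 + γ) *
    ∑ u ∈ Finset.Icc 1 ((p - 1) / 2), (n : ℝ) ^ u * ((p : ℝ) ^ u / (u.factorial : ℝ) ^ 2)

end RandomSkew

end

noncomputable section

namespace RandomSkew


/-! Two regimes are treated separately. They are divided by a threshold `n = A p^E`, where `A` and
`E` come from the given constants alone. In both only the top summand `u = [(p-1)/2]` of the
right-hand side is used (`le_rosenthalBound`).

Decoupling. On a fibre, a product of observables is carried forward by the normalized operators.
Each application of the decay estimate costs a factor `K` at the current time, and the observable at
that same time pays for it because `K ‖φ‖_BV` is bounded. So fibre moments factor over a time gap up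
to an exponentially small error (`abs_fiberMoment_union_sub_le`). As a function of `ω` such a moment
may depend on the whole path through `h_ω`. Replacing `μ_ω` by `m` some steps before the first
observable makes it depend on finitely many coordinates at an exponentially small cost
(`abs_fiberMoment_sub_started_le`), and then the mixing coefficients apply. The outcome is
`MixingSystem.momentMixing`: joint moments of the process `φ ∘ τ^t` factor over gaps at a stretched
exponential rate.

Large `n`. Near-factorization over gaps makes joint cumulants small when their times are spread out,
so every cumulant of `S_n` is `O(n)`, with an explicit dependence on the order
(`abs_momentCumulant_le`). Moments and cumulants are tied by a linear recursion, which the Gaussian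
moments satisfy with the second cumulant alone. After scaling by `s = √(p/n)` the cumulants of order
at least three sum to some `θ` of size `n^{-1/2}`. The moment differs from the Gaussian one by
`O(θ)`, and by `O(θ²)` for even `p` because odd Gaussian moments vanish (`abs_sub_gaussian_le`).
Undoing the scaling gives `n^{[(p-1)/2]}` for both parities.

Small `n`. Nothing is compared here: the moment and its Gaussian counterpart are bounded separately,
and powers of `n` may be traded for powers of `p`. The sum is split into its part centred on the
fibres, a bounded reverse martingale up to a bounded coboundary (`integral_fiber_pow_le`), and the
sum of the fibre means, a functional of the mixing path (`integral_sum_fiberMean_pow_le`). The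
latter is cut into residue classes modulo `2N` with `N` about `p^{2/η}`, long enough for the mixing
error to beat all powers of `n` that occur. The loss of a factor `N` in the variance is the source
of the exponent `γ = 1/η` on the factorial. -/

/-! ### Cumulants relative to a distinguished element -/

section Cumulants

variable {ι : Type*} [DecidableEq ι]

/-- The solution `κ` of `f A = ∑_{B ⊆ A} κ B * g (A \ B)`. When `f A` and `g A` are the moments
over `A` with and without a distinguished variable, `κ A` is a joint cumulant. -/
def relCumulant (f g : Finset ι → ℝ) (A : Finset ι) : ℝ :=
  f A - ∑ B ∈ A.ssubsets.attach, relCumulant f g B.1 * g (A \ B.1)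
termination_by A.card
decreasing_by exact Finset.card_lt_card (Finset.mem_ssubsets.1 B.2)

theorem relCumulant_eq (f g : Finset ι → ℝ) (A : Finset ι) :
    relCumulant f g A = f A - ∑ B ∈ A.ssubsets, relCumulant f g B * g (A \ B) := by
  rw [relCumulant, Finset.sum_attach A.ssubsets (fun B => relCumulant f g B * g (A \ B))]

theorem sum_powerset_eq_add_ssubsets (A : Finset ι) (F : Finset ι → ℝ) :
    ∑ B ∈ A.powerset, F B = F A + ∑ B ∈ A.ssubsets, F B := by
  rw [Finset.ssubsets, Finset.add_sum_erase _ _ (Finset.mem_powerset_self A)]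

theorem sum_relCumulant (f g : Finset ι → ℝ) (hg : g ∅ = 1) (A : Finset ι) :
    ∑ B ∈ A.powerset, relCumulant f g B * g (A \ B) = f A := by
  rw [sum_powerset_eq_add_ssubsets, relCumulant_eq f g A]
  simp [hg]

/-- The recursion is linear in `f`. This lets the time of the distinguished variable be summed
separately from the other times. -/
theorem relCumulant_sum {κ : Type*} (s : Finset κ) (f : κ → Finset ι → ℝ) (g : Finset ι → ℝ)
    (A : Finset ι) :
    relCumulant (fun B => ∑ k ∈ s, f k B) g A = ∑ k ∈ s, relCumulant (f k) g A := by
  induction A using Finset.strongInduction with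
  | H A ih =>
    rw [relCumulant_eq]
    simp_rw [relCumulant_eq _ g A]
    rw [Finset.sum_sub_distrib, Finset.sum_comm]
    congr 1
    refine Finset.sum_congr rfl fun B hB => ?_
    rw [ih B (Finset.mem_ssubsets.1 hB), Finset.sum_mul]

/-- For a proper subset `B.card + 1 ≤ A.card`, which turns the sum into a binomial expansion of `|A|
(|A|+1)^|A|` without its top term. The extra `1` fits because `(|A|+1)^|A| ≥ 1`. This inequality
closes both inductions for cumulants below. -/
theorem one_add_sum_ssubsets_le (A : Finset ι) :
    1 + ∑ B ∈ A.ssubsets, ((B.card : ℝ) + 1) ^ (B.card + 1) ≤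
      ((A.card : ℝ) + 1) ^ (A.card + 1) := by
  have h1 : ∑ B ∈ A.ssubsets, ((B.card : ℝ) + 1) ^ (B.card + 1) ≤
      ∑ B ∈ A.ssubsets, (A.card : ℝ) ^ (B.card + 1) := by
    refine Finset.sum_le_sum fun B hB => ?_
    have : B.card + 1 ≤ A.card := Finset.card_lt_card (Finset.mem_ssubsets.1 hB)
    have h' : ((B.card : ℝ) + 1) ≤ A.card := by exact_mod_cast this
    gcongr
  have h2 := sum_powerset_eq_add_ssubsets A (fun B => (A.card : ℝ) ^ (B.card + 1))
  have h3 : ∑ B ∈ A.powerset, (A.card : ℝ) ^ (B.card + 1) =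
      A.card * ((A.card : ℝ) + 1) ^ A.card := by
    have := Finset.sum_pow_mul_eq_add_pow (A.card : ℝ) 1 A
    simp only [one_pow, mul_one] at this
    rw [← this, Finset.mul_sum]
    exact Finset.sum_congr rfl fun B _ => by ring
  have h4 : (1 : ℝ) ≤ ((A.card : ℝ) + 1) ^ A.card := one_le_pow₀ (by linarith [Nat.cast_nonneg (α := ℝ) A.card])
  have h5 : (0 : ℝ) ≤ (A.card : ℝ) ^ (A.card + 1) := by positivity
  rw [h3] at h2
  rw [pow_succ ((A.card : ℝ) + 1)]
  nlinarith

/-- The a priori bound, from sizes of moments only. It serves when the times are too close for a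
gap, and for the index sets inside `U` in the split estimate. -/
theorem abs_relCumulant_le {f g : Finset ι → ℝ} {D : ℝ} (hD : 0 ≤ D)
    (hf : ∀ A, |f A| ≤ D ^ (A.card + 1)) (hg : ∀ A, |g A| ≤ D ^ A.card) (A : Finset ι) :
    |relCumulant f g A| ≤ D ^ (A.card + 1) * ((A.card : ℝ) + 1) ^ (A.card + 1) := by
  induction A using Finset.strongInduction with
  | H A ih =>
    rw [relCumulant_eq]
    calc _ ≤ |f A| + |∑ B ∈ A.ssubsets, relCumulant f g B * g (A \ B)| := abs_sub _ _
      _ ≤ D ^ (A.card + 1) + ∑ B ∈ A.ssubsets, D ^ (A.card + 1) * ((B.card : ℝ) + 1) ^ (B.card + 1) := by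
        refine add_le_add (hf A) ((Finset.abs_sum_le_sum_abs _ _).trans ?_)
        refine Finset.sum_le_sum fun B hB => ?_
        have hBA := (Finset.mem_ssubsets.1 hB)
        have hc : A.card = B.card + (A \ B).card := by
          rw [Finset.card_sdiff_of_subset hBA.1]; have := Finset.card_lt_card hBA; omega
        rw [abs_mul]
        calc _ ≤ (D ^ (B.card + 1) * ((B.card : ℝ) + 1) ^ (B.card + 1)) * D ^ (A \ B).card :=
              mul_le_mul (ih B hBA) (hg _) (abs_nonneg _) (by positivity)
          _ = _ := by rw [hc]; ring
      _ = D ^ (A.card + 1) * (1 + ∑ B ∈ A.ssubsets, ((B.card : ℝ) + 1) ^ (B.card + 1)) := by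
        rw [← Finset.mul_sum]; ring
      _ ≤ _ := by gcongr; exact one_add_sum_ssubsets_le A

/-- If the moments nearly factor over `U` and its complement, the cumulants of sets which meet the
complement of `U` are small. -/
theorem abs_relCumulant_le_of_split {f g : Finset ι → ℝ} {D δ : ℝ} (hD : 0 ≤ D) (hδ : 0 ≤ δ)
    (hg1 : g ∅ = 1)
    (hf : ∀ A, |f A| ≤ D ^ (A.card + 1)) (hg : ∀ A, |g A| ≤ D ^ A.card) (U : Finset ι)
    (hfU : ∀ A, |f A - f (A ∩ U) * g (A \ U)| ≤ δ * D ^ (A.card + 1))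
    (hgU : ∀ A, |g A - g (A ∩ U) * g (A \ U)| ≤ δ * D ^ A.card) (A : Finset ι) (hA : ¬ A ⊆ U) :
    |relCumulant f g A| ≤ δ * D ^ (A.card + 1) * ((A.card : ℝ) + 1) ^ (A.card + 1) := by
  induction A using Finset.strongInduction with
  | H A ih =>
    -- From the recursion for `A` subtract `g (A \ U)` times the defining identity of `f (A ∩ U)`.
    -- The sets `B` of that identity lie in `U`, hence are proper subsets of `A` since `A` is not
    -- contained in `U`. Those `B` are left with a factorization defect of `g`; every other `B`
    -- meets the complement of `U` and is covered by induction.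
    have hsplit : relCumulant f g A = (f A - f (A ∩ U) * g (A \ U))
        - ∑ B ∈ A.ssubsets, (if B ⊆ U then
          relCumulant f g B * (g (A \ B) - g ((A ∩ U) \ B) * g (A \ U)) else
          relCumulant f g B * g (A \ B)) := by
      have h1 : ∑ B ∈ A.ssubsets, (if B ⊆ U then
          relCumulant f g B * (g ((A ∩ U) \ B) * g (A \ U)) else 0) = f (A ∩ U) * g (A \ U) := by
        rw [← sum_relCumulant f g hg1 (A ∩ U), Finset.sum_mul, ← Finset.sum_filter]
        refine Finset.sum_congr ?_ fun B _ => by ring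
        ext B
        simp only [Finset.mem_filter, Finset.mem_ssubsets, Finset.mem_powerset,
          Finset.subset_inter_iff]
        constructor
        · rintro ⟨h, h'⟩; exact ⟨h.1, h'⟩
        · rintro ⟨h, h'⟩
          exact ⟨⟨h, fun h2 => hA (h2.trans h')⟩, h'⟩
      rw [relCumulant_eq, ← h1, sub_sub, ← Finset.sum_add_distrib]
      congr 1
      refine Finset.sum_congr rfl fun B _ => ?_
      split_ifs <;> ring
    rw [hsplit]
    calc _ ≤ |f A - f (A ∩ U) * g (A \ U)| + |∑ B ∈ A.ssubsets, (if B ⊆ U then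
          relCumulant f g B * (g (A \ B) - g ((A ∩ U) \ B) * g (A \ U)) else
          relCumulant f g B * g (A \ B))| := abs_sub _ _
      _ ≤ δ * D ^ (A.card + 1) +
          ∑ B ∈ A.ssubsets, δ * D ^ (A.card + 1) * ((B.card : ℝ) + 1) ^ (B.card + 1) := by
        refine add_le_add (hfU A) ((Finset.abs_sum_le_sum_abs _ _).trans ?_)
        refine Finset.sum_le_sum fun B hB => ?_
        have hBA := (Finset.mem_ssubsets.1 hB)
        have hc : A.card = B.card + (A \ B).card := by
          rw [Finset.card_sdiff_of_subset hBA.1]; have := Finset.card_lt_card hBA; omega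
        split_ifs with hBU
        · have e1 : (A \ B) ∩ U = (A ∩ U) \ B := by
            ext i; simp only [Finset.mem_inter, Finset.mem_sdiff]; tauto
          have e2 : (A \ B) \ U = A \ U := by
            ext i; simp only [Finset.mem_sdiff]
            constructor
            · tauto
            · exact fun h => ⟨⟨h.1, fun h3 => h.2 (hBU h3)⟩, h.2⟩
          have h3 := hgU (A \ B)
          rw [e1, e2] at h3
          rw [abs_mul]
          calc _ ≤ (D ^ (B.card + 1) * ((B.card : ℝ) + 1) ^ (B.card + 1)) * (δ * D ^ (A \ B).card) :=
                mul_le_mul (abs_relCumulant_le hD hf hg B) h3 (abs_nonneg _) (by positivity)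
            _ = _ := by rw [hc]; ring
        · rw [abs_mul]
          calc _ ≤ (δ * D ^ (B.card + 1) * ((B.card : ℝ) + 1) ^ (B.card + 1)) * D ^ (A \ B).card :=
                mul_le_mul (ih B hBA hBU) (hg _) (abs_nonneg _) (by positivity)
            _ = _ := by rw [hc]; ring
      _ = δ * D ^ (A.card + 1) * (1 + ∑ B ∈ A.ssubsets, ((B.card : ℝ) + 1) ^ (B.card + 1)) := by
        rw [← Finset.mul_sum]; ring
      _ ≤ _ := by gcongr; exact one_add_sum_ssubsets_le A

/-- `momentCumulant m n` is the cumulant of order `n + 1` of a sequence of moments `m`. -/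
def momentCumulant (m : ℕ → ℝ) (n : ℕ) : ℝ :=
  m (n + 1) - ∑ j : Fin n, (n.choose j) * (momentCumulant m j * m (n - j))
termination_by n
decreasing_by exact j.2

theorem momentCumulant_eq (m : ℕ → ℝ) (n : ℕ) : momentCumulant m n =
    m (n + 1) - ∑ j ∈ Finset.range n, (n.choose j) * (momentCumulant m j * m (n - j)) := by
  rw [momentCumulant, Finset.sum_range]

theorem moment_succ_eq (m : ℕ → ℝ) (hm : m 0 = 1) (n : ℕ) : m (n + 1) =
    ∑ j ∈ Finset.range (n + 1), (n.choose j) * (momentCumulant m j * m (n - j)) := by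
  rw [Finset.sum_range_succ, momentCumulant_eq m n]
  simp [hm]

/-- Exchanging the coordinates outside `B` between two tuples is an involution on pairs. It leaves
`f` of the first tuple unchanged and turns `g` of the second into `g` of the new first tuple; the
free second tuple then gives the power of the cardinality. Working with full tuples and such powers
avoids tuples indexed by subsets. -/
theorem sum_mul_eq_of_disjoint [Fintype ι] {α : Type*} [Fintype α] (B C : Finset ι)
    (hBC : Disjoint B C) (f g : (ι → α) → ℝ)
    (hf : ∀ t t', (∀ i ∈ B, t i = t' i) → f t = f t')
    (hg : ∀ t t', (∀ i ∈ C, t i = t' i) → g t = g t') :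
    (Fintype.card α : ℝ) ^ (Fintype.card ι) * ∑ t, f t * g t = (∑ t, f t) * ∑ t, g t := by
  let σ : ((ι → α) × (ι → α)) ≃ ((ι → α) × (ι → α)) :=
    { toFun := fun p => (B.piecewise p.1 p.2, B.piecewise p.2 p.1)
      invFun := fun p => (B.piecewise p.1 p.2, B.piecewise p.2 p.1)
      left_inv := fun p => by
        ext i <;> by_cases h : i ∈ B <;> simp [h]
      right_inv := fun p => by
        ext i <;> by_cases h : i ∈ B <;> simp [h] }
  have h1 : (∑ t, f t) * ∑ t, g t = ∑ p : (ι → α) × (ι → α), f p.1 * g p.2 := by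
    rw [Finset.sum_mul_sum, Fintype.sum_prod_type]
  have h2 : ∑ p : (ι → α) × (ι → α), f p.1 * g p.2 =
      ∑ p : (ι → α) × (ι → α), f (σ p).1 * g (σ p).1 := by
    refine Finset.sum_congr rfl fun p _ => ?_
    congr 1
    · exact hf _ _ fun i hi => by simp [σ, hi]
    · exact hg _ _ fun i hi => by simp [σ, Finset.disjoint_right.1 hBC hi]
  rw [h1, h2, Equiv.sum_comp σ (fun p => f p.1 * g p.1), Fintype.sum_prod_type]
  simp [Finset.mul_sum]

theorem relCumulant_congr {f f' g g' : Finset ι → ℝ} {A : Finset ι}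
    (hf : ∀ B ⊆ A, f B = f' B) (hg : ∀ B ⊆ A, g B = g' B) :
    relCumulant f g A = relCumulant f' g' A := by
  induction A using Finset.strongInduction with
  | H A ih =>
    rw [relCumulant_eq, relCumulant_eq, hf A subset_rfl]
    congr 1
    refine Finset.sum_congr rfl fun B hB => ?_
    have hBA := Finset.mem_ssubsets.1 hB
    rw [ih B hBA (fun C hC => hf C (hC.trans hBA.1)) (fun C hC => hg C (hC.trans hBA.1)),
      hg _ Finset.sdiff_subset]

/-- Multilinearity of cumulants: summing joint cumulants over all index tuples gives the cumulant
of the sum. -/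
theorem sum_relCumulant_eq_momentCumulant [Fintype ι] {α : Type*} [Fintype α] [Nonempty α]
    (m : ℕ → ℝ) (F G : (ι → α) → Finset ι → ℝ)
    (hF : ∀ B t t', (∀ i ∈ B, t i = t' i) → F t B = F t' B)
    (hG : ∀ B t t', (∀ i ∈ B, t i = t' i) → G t B = G t' B)
    (hFm : ∀ B, (∑ t, F t B) * (Fintype.card α : ℝ) ^ B.card =
      (Fintype.card α : ℝ) ^ Fintype.card ι * m (B.card + 1))
    (hGm : ∀ B, (∑ t, G t B) * (Fintype.card α : ℝ) ^ B.card =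
      (Fintype.card α : ℝ) ^ Fintype.card ι * m B.card) (A : Finset ι) :
    (∑ t, relCumulant (F t) (G t) A) * (Fintype.card α : ℝ) ^ A.card =
      (Fintype.card α : ℝ) ^ Fintype.card ι * momentCumulant m A.card := by
  set N : ℝ := (Fintype.card α : ℝ)
  have hN : N ≠ 0 := by simp [N]
  induction A using Finset.strongInduction with
  | H A ih =>
    -- In each term of the recursion the two factors depend on disjoint sets of coordinates, so the
    -- sum over tuples factors.
    have key : ∀ B ∈ A.ssubsets, (∑ t, relCumulant (F t) (G t) B * G t (A \ B)) * N ^ A.card =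
        N ^ Fintype.card ι * (momentCumulant m B.card * m (A.card - B.card)) := by
      intro B hB
      have hBA := Finset.mem_ssubsets.1 hB
      have hc : A.card = B.card + (A \ B).card := by
        rw [Finset.card_sdiff_of_subset hBA.1]; have := Finset.card_lt_card hBA; omega
      have h1 := sum_mul_eq_of_disjoint B (A \ B) Finset.disjoint_sdiff
        (fun t => relCumulant (F t) (G t) B) (fun t => G t (A \ B))
        (fun t t' h => relCumulant_congr (fun C hC => hF C t t' fun i hi => h i (hC hi))
          (fun C hC => hG C t t' fun i hi => h i (hC hi))) (hG _)
      have h2 := ih B hBA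
      have h3 := hGm (A \ B)
      have h4 : A.card - B.card = (A \ B).card := by omega
      rw [h4]
      refine mul_left_cancel₀ (pow_ne_zero (Fintype.card ι) hN) ?_
      calc _ = (N ^ Fintype.card ι * ∑ t, relCumulant (F t) (G t) B * G t (A \ B)) *
            (N ^ B.card * N ^ (A \ B).card) := by rw [hc]; ring
        _ = ((∑ t, relCumulant (F t) (G t) B) * N ^ B.card) *
            ((∑ t, G t (A \ B)) * N ^ (A \ B).card) := by rw [h1]; ring
        _ = _ := by rw [h2, h3]; ring
    simp_rw [relCumulant_eq _ _ A]
    rw [Finset.sum_sub_distrib, sub_mul, hFm, Finset.sum_comm, Finset.sum_mul,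
      Finset.sum_congr rfl key, ← Finset.mul_sum, ← mul_sub, momentCumulant_eq]
    congr 2
    have h5 := Finset.sum_powerset_apply_card (fun j => momentCumulant m j * m (A.card - j)) (x := A)
    rw [sum_powerset_eq_add_ssubsets A
      (fun B => momentCumulant m B.card * m (A.card - B.card)), Finset.sum_range_succ] at h5
    simp only [nsmul_eq_mul, Nat.choose_self, Nat.cast_one, one_mul] at h5
    linarith

end Cumulants


/-! ### Summing cumulants over time tuples -/

/-- Pigeonhole: if each of the `card κ` disjoint open intervals of length `g` to the right of `p i`
contained a point, then choosing one point per interval would exhaust `κ`. But `p i` itself lies in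
none of them. -/
theorem exists_gap {κ : Type*} [Fintype κ] (p : κ → ℕ) (g : ℕ) (i j : κ)
    (hij : p i + Fintype.card κ * g ≤ p j) :
    ∃ a, p i ≤ a ∧ a + g ≤ p j ∧ ∀ l, p l ≤ a ∨ a + g ≤ p l := by
  by_contra! hcon
  have h1 : ∀ m : Fin (Fintype.card κ), ∃ l, p i + m * g < p l ∧ p l < p i + m * g + g := by
    intro m
    have hm : (m + 1) * g ≤ Fintype.card κ * g := Nat.mul_le_mul_right _ m.2
    exact hcon (p i + m * g) (by omega) (by rw [add_mul] at hm; omega)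
  choose l hl using h1
  have hinj : Function.Injective l := by
    intro m m' hmm
    have ha := hl m
    have hb := hl m'
    rw [← hmm] at hb
    by_contra hne
    rcases lt_or_gt_of_ne (fun h => hne (Fin.ext h)) with h | h
    · have := Nat.mul_le_mul_right g (Nat.succ_le_of_lt h)
      rw [Nat.succ_mul] at this; omega
    · have := Nat.mul_le_mul_right g (Nat.succ_le_of_lt h)
      rw [Nat.succ_mul] at this; omega
  have hbij : Function.Bijective l :=
    (Fintype.bijective_iff_injective_and_card l).2 ⟨hinj, by simp⟩
  obtain ⟨m, hm⟩ := hbij.2 i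
  have := (hl m).1
  rw [hm] at this
  omega

theorem sum_inv_sq_le (n : ℕ) : ∑ d ∈ Finset.range n, ((1 + (d : ℝ)) ^ 2)⁻¹ ≤ 2 := by
  have : ∀ n : ℕ, ∑ d ∈ Finset.range (n + 1), ((1 + (d : ℝ)) ^ 2)⁻¹ ≤ 2 - ((n : ℝ) + 1)⁻¹ := by
    intro n
    induction n with
    | zero => norm_num
    | succ n ih =>
      rw [Finset.sum_range_succ]
      have h : ((1 + ((n + 1 : ℕ) : ℝ)) ^ 2)⁻¹ ≤ ((n : ℝ) + 1)⁻¹ - (((n + 1 : ℕ) : ℝ) + 1)⁻¹ := by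
        push_cast
        have h1 : (0 : ℝ) < n + 1 := by positivity
        have e : ((n : ℝ) + 1)⁻¹ - ((n : ℝ) + 1 + 1)⁻¹ = (((n : ℝ) + 1) * (n + 1 + 1))⁻¹ := by
          field_simp; ring
        rw [e]
        apply inv_anti₀ (by positivity)
        nlinarith
      linarith
  cases n with
  | zero => norm_num
  | succ n => exact (this n).trans (by linarith [show (0 : ℝ) ≤ ((n : ℝ) + 1)⁻¹ by positivity])

/-- The times before and after `t₀` contribute at most `2` each, uniformly in `n` and `t₀`. -/
theorem sum_inv_sq_dist_le (n t₀ : ℕ) :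
    ∑ s ∈ Finset.range n, ((1 + (Nat.dist s t₀ : ℝ)) ^ 2)⁻¹ ≤ 4 := by
  have hpos : ∀ d : ℕ, (0 : ℝ) ≤ ((1 + (d : ℝ)) ^ 2)⁻¹ := fun d => by positivity
  rw [← Finset.sum_filter_add_sum_filter_not (Finset.range n) (fun s => t₀ ≤ s)]
  have h1 : ∑ s ∈ (Finset.range n).filter (fun s => t₀ ≤ s), ((1 + (Nat.dist s t₀ : ℝ)) ^ 2)⁻¹ ≤ 2 := by
    refine le_trans ?_ (sum_inv_sq_le n)
    rw [show ∑ s ∈ (Finset.range n).filter (fun s => t₀ ≤ s), ((1 + (Nat.dist s t₀ : ℝ)) ^ 2)⁻¹ =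
      ∑ d ∈ ((Finset.range n).filter (fun s => t₀ ≤ s)).image (fun s => s - t₀), ((1 + (d : ℝ)) ^ 2)⁻¹ from ?_]
    · refine Finset.sum_le_sum_of_subset_of_nonneg ?_ fun d _ _ => hpos d
      intro d hd
      simp only [Finset.mem_image, Finset.mem_filter, Finset.mem_range] at hd ⊢
      omega
    · rw [Finset.sum_image]
      · refine Finset.sum_congr rfl fun s hs => ?_
        rw [Nat.dist_eq_sub_of_le_right (Finset.mem_filter.1 hs).2]
      · intro x hx y hy hxy
        have := (Finset.mem_filter.1 hx).2
        have := (Finset.mem_filter.1 hy).2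
        simp only at hxy
        omega
  have h2 : ∑ s ∈ (Finset.range n).filter (fun s => ¬ t₀ ≤ s), ((1 + (Nat.dist s t₀ : ℝ)) ^ 2)⁻¹ ≤ 2 := by
    refine le_trans ?_ (sum_inv_sq_le (t₀ + 1))
    rw [show ∑ s ∈ (Finset.range n).filter (fun s => ¬ t₀ ≤ s), ((1 + (Nat.dist s t₀ : ℝ)) ^ 2)⁻¹ =
      ∑ d ∈ ((Finset.range n).filter (fun s => ¬ t₀ ≤ s)).image (fun s => t₀ - s), ((1 + (d : ℝ)) ^ 2)⁻¹ from ?_]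
    · refine Finset.sum_le_sum_of_subset_of_nonneg ?_ fun d _ _ => hpos d
      intro d hd
      simp only [Finset.mem_image, Finset.mem_filter, Finset.mem_range] at hd ⊢
      omega
    · rw [Finset.sum_image]
      · refine Finset.sum_congr rfl fun s hs => ?_
        rw [Nat.dist_eq_sub_of_le (not_le.1 (Finset.mem_filter.1 hs).2).le]
      · intro x hx y hy hxy
        have := (Finset.mem_filter.1 hx).2
        have := (Finset.mem_filter.1 hy).2
        simp only at hxy
        omega
  linarith

/-- The moment of the variables `X (τ i)`, `i ∈ A`, of a process `X`. -/
def jointMoment {Ω : Type*} [MeasurableSpace Ω] (μ : Measure Ω) (X : ℕ → Ω → ℝ) {ι : Type*}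
    (τ : ι → ℕ) (A : Finset ι) : ℝ := ∫ ω, ∏ i ∈ A, X (τ i) ω ∂μ

/-- Joint moments factor over time gaps of length `g` up to a relative error `ρ g`. -/
def MomentMixing {Ω : Type*} [MeasurableSpace Ω] (μ : Measure Ω) (X : ℕ → Ω → ℝ) (D : ℝ)
    (ρ : ℕ → ℝ) : Prop :=
  ∀ (ι : Type) [DecidableEq ι] (τ : ι → ℕ) (A B : Finset ι) (a g : ℕ), Disjoint A B →
    (∀ i ∈ A, τ i ≤ a) → (∀ i ∈ B, a + g ≤ τ i) →
    |jointMoment μ X τ (A ∪ B) - jointMoment μ X τ A * jointMoment μ X τ B| ≤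
      D ^ (A.card + B.card) * ρ g

section

variable {Ω : Type*} [MeasurableSpace Ω] {μ : Measure Ω}
  {X : ℕ → Ω → ℝ} {D : ℝ}

theorem integrable_of_bdd [IsProbabilityMeasure μ] {f : Ω → ℝ} (hf : AEStronglyMeasurable f μ) (C : ℝ)
    (h : ∀ᵐ ω ∂μ, |f ω| ≤ C) : Integrable f μ :=
  Integrable.of_bound hf C (by simpa only [Real.norm_eq_abs] using h)

theorem abs_integral_le_of_bdd [IsProbabilityMeasure μ] {f : Ω → ℝ} (C : ℝ)
    (h : ∀ᵐ ω ∂μ, |f ω| ≤ C) : |∫ ω, f ω ∂μ| ≤ C := by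
  have := norm_integral_le_of_norm_le_const (μ := μ) (f := f) (C := C)
    (by simpa only [Real.norm_eq_abs] using h)
  simpa using this

theorem ae_abs_prod_le (hb : ∀ t, ∀ᵐ ω ∂μ, |X t ω| ≤ D) {ι : Type*} (τ : ι → ℕ) (A : Finset ι) :
    ∀ᵐ ω ∂μ, |∏ i ∈ A, X (τ i) ω| ≤ D ^ A.card := by
  have : ∀ᵐ ω ∂μ, ∀ t, |X t ω| ≤ D := ae_all_iff.2 hb
  filter_upwards [this] with ω hω
  rw [Finset.abs_prod, ← Finset.prod_const]
  exact Finset.prod_le_prod (fun _ _ => abs_nonneg _) fun i _ => hω _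

theorem abs_jointMoment_le [IsProbabilityMeasure μ] (hb : ∀ t, ∀ᵐ ω ∂μ, |X t ω| ≤ D) {ι : Type*} (τ : ι → ℕ)
    (A : Finset ι) : |jointMoment μ X τ A| ≤ D ^ A.card :=
  abs_integral_le_of_bdd _ (ae_abs_prod_le hb τ A)

theorem integrable_prod [IsProbabilityMeasure μ] (hX : ∀ t, Measurable (X t)) (hb : ∀ t, ∀ᵐ ω ∂μ, |X t ω| ≤ D) {ι : Type*}
    (τ : ι → ℕ) (A : Finset ι) : Integrable (fun ω => ∏ i ∈ A, X (τ i) ω) μ :=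
  integrable_of_bdd (Finset.measurable_fun_prod _ fun _ _ => hX _).aestronglyMeasurable _
    (ae_abs_prod_le hb τ A)

theorem jointMoment_congr {ι : Type*} {τ τ' : ι → ℕ} {A : Finset ι} (h : ∀ i ∈ A, τ i = τ' i) :
    jointMoment μ X τ A = jointMoment μ X τ' A := by
  unfold jointMoment
  congr 1
  ext ω
  exact Finset.prod_congr rfl fun i hi => by rw [h i hi]

/-- The moments of `X t₀` together with `X (τ i)`, `i ∈ A`. -/
def jointMomentAt (μ : Measure Ω) (X : ℕ → Ω → ℝ) {ι : Type*} (t₀ : ℕ) (τ : ι → ℕ)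
    (A : Finset ι) : ℝ := jointMoment μ X (fun o : Option ι => o.elim t₀ τ) (Finset.insertNone A)

/-- Let `d` be the largest distance of a time from `t₀`. Among `j + 1` times some gap of length `d /
(j + 1)` separates `t₀` from the farthest one, and factorization over it makes the cumulant small.
The polynomial decay of order `2 (j + 1)` in `d` is distributed as one factor `(1 + dist)⁻²` per
time, so that the times can later be summed independently. -/
theorem abs_relCumulant_jointMoment_le [IsProbabilityMeasure μ] {ρ : ℕ → ℝ} {R : ℝ} (hD : 0 ≤ D)
    (hb : ∀ t, ∀ᵐ ω ∂μ, |X t ω| ≤ D) (hmix : MomentMixing μ X D ρ) {j : ℕ}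
    (hR : 1 ≤ R) (hρ : ∀ g, ρ g * (1 + (g : ℝ)) ^ (2 * (j + 1)) ≤ R) (t₀ : ℕ) (τ : Fin j → ℕ) :
    |relCumulant (jointMomentAt μ X t₀ τ) (jointMoment μ X τ) Finset.univ| ≤
      R * (D ^ (j + 1) * ((j : ℝ) + 1) ^ (j + 1)) * ((j : ℝ) + 1) ^ (2 * (j + 1)) *
        ∏ i, ((1 + (Nat.dist (τ i) t₀ : ℝ)) ^ 2)⁻¹ := by
  set d := Finset.univ.sup fun i => Nat.dist (τ i) t₀ with hd
  have hf : ∀ A, |jointMomentAt μ X t₀ τ A| ≤ D ^ (A.card + 1) := fun A => by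
    have := abs_jointMoment_le hb (fun o : Option (Fin j) => o.elim t₀ τ) (Finset.insertNone A)
    rwa [Finset.card_insertNone] at this
  have hg : ∀ A, |jointMoment μ X τ A| ≤ D ^ A.card := abs_jointMoment_le hb τ
  set Q : ℝ := D ^ (j + 1) * ((j : ℝ) + 1) ^ (j + 1) with hQ
  have hQ0 : 0 ≤ Q := by positivity
  -- the bound in terms of the largest distance
  have main : |relCumulant (jointMomentAt μ X t₀ τ) (jointMoment μ X τ) Finset.univ| *
      (1 + ((d / (j + 1) : ℕ) : ℝ)) ^ (2 * (j + 1)) ≤ R * Q := by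
    -- If `d ≤ j` no gap of positive length is guaranteed, and the a priori bound together with `1 ≤
    -- R` is enough.
    rcases Nat.eq_zero_or_pos (d / (j + 1)) with h0 | hpos
    · have := abs_relCumulant_le hD hf hg Finset.univ
      rw [Finset.card_univ, Fintype.card_fin] at this
      rw [h0]
      simp only [Nat.cast_zero, add_zero, one_pow, mul_one]
      exact this.trans (le_mul_of_one_le_left hQ0 hR)
    · set g := d / (j + 1) with hgdef
      have hρ0 : ρ g * (1 + (g : ℝ)) ^ (2 * (j + 1)) ≤ R := hρ g
      suffices hs : |relCumulant (jointMomentAt μ X t₀ τ) (jointMoment μ X τ) Finset.univ| ≤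
          max (ρ g) 0 * Q by
        calc _ ≤ max (ρ g) 0 * Q * (1 + (g : ℝ)) ^ (2 * (j + 1)) := by gcongr
          _ = (max (ρ g) 0 * (1 + (g : ℝ)) ^ (2 * (j + 1))) * Q := by ring
          _ ≤ R * Q := by
            gcongr
            rcases le_total (ρ g) 0 with h | h
            · rw [max_eq_right h]; linarith
            · rwa [max_eq_left h]
      have hdpos : 0 < d := by
        by_contra h
        have : d = 0 := by omega
        rw [hgdef, this] at hpos; simp at hpos
      have hne : (Finset.univ : Finset (Fin j)).Nonempty := by
        by_contra h
        rw [Finset.not_nonempty_iff_eq_empty] at h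
        rw [hd, h] at hdpos; simp at hdpos
      obtain ⟨i, -, hi⟩ := Finset.exists_mem_eq_sup _ hne fun i => Nat.dist (τ i) t₀
      have hgd : (j + 1) * g ≤ d := Nat.mul_div_le d (j + 1)
      -- a gap
      have hgap : ∃ a, (∀ l : Option (Fin j), l.elim t₀ τ ≤ a ∨ a + g ≤ l.elim t₀ τ) ∧
          ((t₀ ≤ a ∧ a + g ≤ τ i) ∨ (τ i ≤ a ∧ a + g ≤ t₀)) := by
        have hcard : Fintype.card (Option (Fin j)) = j + 1 := by simp
        have hdi : Nat.dist (τ i) t₀ = d := hi.symm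
        rcases le_total t₀ (τ i) with h | h
        · rw [Nat.dist_eq_sub_of_le_right h] at hdi
          obtain ⟨a, h1, h2, h3⟩ := exists_gap (fun l : Option (Fin j) => l.elim t₀ τ) g none (some i)
            (by rw [hcard]; simp only [Option.elim]; omega)
          exact ⟨a, h3, Or.inl ⟨h1, h2⟩⟩
        · rw [Nat.dist_eq_sub_of_le h] at hdi
          obtain ⟨a, h1, h2, h3⟩ := exists_gap (fun l : Option (Fin j) => l.elim t₀ τ) g (some i) none
            (by rw [hcard]; simp only [Option.elim]; omega)
          exact ⟨a, h3, Or.inr ⟨h1, h2⟩⟩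
      obtain ⟨a, hall, hsep⟩ := hgap
      have hmix' : ∀ (κ : Type) [DecidableEq κ] (σ : κ → ℕ) (A B : Finset κ), Disjoint A B →
          (∀ i ∈ A, σ i ≤ a) → (∀ i ∈ B, a + g ≤ σ i) →
          |jointMoment μ X σ (A ∪ B) - jointMoment μ X σ A * jointMoment μ X σ B| ≤
            max (ρ g) 0 * D ^ (A.card + B.card) := by
        intro κ _ σ A B h1 h2 h3
        refine (hmix κ σ A B a g h1 h2 h3).trans ?_
        rw [mul_comm]
        gcongr
        exact le_max_left _ _
      -- `U` will consist of the indices on the same side of the gap as `t₀`. The farthest index `i`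
      -- lies on the other side, which is what the split estimate needs. As `ρ g` may be negative,
      -- its positive part takes the role of `δ`.
      have hres : ∀ U : Finset (Fin j),
          (∀ A, |jointMomentAt μ X t₀ τ A -
            jointMomentAt μ X t₀ τ (A ∩ U) * jointMoment μ X τ (A \ U)| ≤
            max (ρ g) 0 * D ^ (A.card + 1)) →
          (∀ A, |jointMoment μ X τ A - jointMoment μ X τ (A ∩ U) * jointMoment μ X τ (A \ U)| ≤
            max (ρ g) 0 * D ^ A.card) → i ∉ U →
          |relCumulant (jointMomentAt μ X t₀ τ) (jointMoment μ X τ) Finset.univ| ≤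
            max (ρ g) 0 * Q := by
        intro U h1 h2 h3
        have := abs_relCumulant_le_of_split hD (le_max_right (ρ g) 0) (by simp [jointMoment])
          hf hg U h1 h2 Finset.univ (fun h => h3 (h (Finset.mem_univ i)))
        rw [Finset.card_univ, Fintype.card_fin] at this
        linarith
      have hsdiff : ∀ (U A : Finset (Fin j)), A.card = (A ∩ U).card + (A \ U).card := fun U A =>
        (Finset.card_inter_add_card_sdiff A U).symm
      have hsome : ∀ A : Finset (Fin j), jointMoment μ X τ A =
          jointMoment μ X (fun o : Option (Fin j) => o.elim t₀ τ) (A.map Function.Embedding.some) := by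
        intro A; simp [jointMoment]
      have hins : ∀ U A : Finset (Fin j), Finset.insertNone A =
          Finset.insertNone (A ∩ U) ∪ (A \ U).map Function.Embedding.some := by
        intro U A
        ext o
        cases o with
        | none => simp
        | some x => simp; tauto
      have hdisj : ∀ U A : Finset (Fin j), Disjoint (Finset.insertNone (A ∩ U))
          ((A \ U).map Function.Embedding.some) := by
        intro U A
        rw [Finset.disjoint_left]
        intro o
        cases o with
        | none => simp
        | some x => simp; tauto
      rcases hsep with ⟨h1, h2⟩ | ⟨h1, h2⟩
      · refine hres (Finset.univ.filter fun l => τ l ≤ a) ?_ ?_ ?_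
        · intro A
          set U := Finset.univ.filter fun l => τ l ≤ a
          have := hmix' (Option (Fin j)) (fun o => o.elim t₀ τ) (Finset.insertNone (A ∩ U))
            ((A \ U).map Function.Embedding.some) (hdisj U A) ?_ ?_
          · rw [← hins U A, ← hsome, Finset.card_insertNone, Finset.card_map] at this
            rw [hsdiff U A, add_right_comm]
            exact this
          · intro o ho
            cases o with
            | none => exact h1
            | some x => simp [U] at ho; exact ho.2
          · intro o ho
            cases o with
            | none => simp at ho
            | some x =>
              simp [U] at ho
              exact (hall (some x)).resolve_left (not_le.2 ho.2)
        · intro A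
          set U := Finset.univ.filter fun l => τ l ≤ a
          have := hmix' (Fin j) τ (A ∩ U) (A \ U) (Finset.disjoint_left.2 fun x => by simp; tauto)
            (fun x hx => by simp [U] at hx; exact hx.2)
            (fun x hx => by simp [U] at hx; exact (hall (some x)).resolve_left (not_le.2 hx.2))
          rwa [← hsdiff U A, Finset.union_comm, Finset.sdiff_union_inter] at this
        · simp; omega
      · refine hres (Finset.univ.filter fun l => a + g ≤ τ l) ?_ ?_ ?_
        · intro A
          set U := Finset.univ.filter fun l => a + g ≤ τ l
          have := hmix' (Option (Fin j)) (fun o => o.elim t₀ τ) 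
            ((A \ U).map Function.Embedding.some) (Finset.insertNone (A ∩ U)) (hdisj U A).symm ?_ ?_
          · rw [Finset.union_comm, ← hins U A, ← hsome, Finset.card_insertNone, Finset.card_map] at this
            rw [hsdiff U A, mul_comm (jointMomentAt μ X t₀ τ _), add_right_comm, add_comm]
            exact this
          · intro o ho
            cases o with
            | none => simp at ho
            | some x =>
              simp [U] at ho
              exact (hall (some x)).resolve_right (not_le.2 ho.2)
          · intro o ho
            cases o with
            | none => exact h2
            | some x => simp [U] at ho; exact ho.2
        · intro A
          set U := Finset.univ.filter fun l => a + g ≤ τ l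
          have := hmix' (Fin j) τ (A \ U) (A ∩ U) (Finset.disjoint_left.2 fun x => by simp; tauto)
            (fun x hx => by simp [U] at hx; exact (hall (some x)).resolve_right (not_le.2 hx.2))
            (fun x hx => by simp [U] at hx; exact hx.2)
          rw [add_comm, ← hsdiff U A, Finset.sdiff_union_inter] at this
          rwa [mul_comm (jointMoment μ X τ (A ∩ U))]
        · simp; omega
  have hprod : (∏ i, (1 + (Nat.dist (τ i) t₀ : ℝ)) ^ 2) ≤
      ((j : ℝ) + 1) ^ (2 * (j + 1)) * (1 + ((d / (j + 1) : ℕ) : ℝ)) ^ (2 * (j + 1)) := by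
    rw [← mul_pow]
    have hd1 : (d : ℝ) + 1 ≤ ((j : ℝ) + 1) * (1 + ((d / (j + 1) : ℕ) : ℝ)) := by
      have : d < (j + 1) * (d / (j + 1) + 1) := Nat.lt_mul_div_succ d (Nat.succ_pos j)
      have h2 : d + 1 ≤ (j + 1) * (1 + d / (j + 1)) := by rw [add_comm 1]; exact this
      exact_mod_cast h2
    calc (∏ i, (1 + (Nat.dist (τ i) t₀ : ℝ)) ^ 2) ≤ ∏ _i : Fin j, ((d : ℝ) + 1) ^ 2 := by
          refine Finset.prod_le_prod (fun _ _ => by positivity) fun i _ => ?_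
          have : Nat.dist (τ i) t₀ ≤ d := Finset.le_sup (f := fun i => Nat.dist (τ i) t₀) (Finset.mem_univ i)
          have h' : (Nat.dist (τ i) t₀ : ℝ) ≤ d := by exact_mod_cast this
          rw [add_comm (d : ℝ)]
          gcongr
      _ = ((d : ℝ) + 1) ^ (2 * j) := by simp [pow_mul]
      _ ≤ ((d : ℝ) + 1) ^ (2 * (j + 1)) := pow_le_pow_right₀ (by linarith [Nat.cast_nonneg (α := ℝ) d]) (by omega)
      _ ≤ _ := by gcongr
  rw [Finset.prod_inv_distrib, ← div_eq_mul_inv, le_div_iff₀ (Finset.prod_pos fun i _ => by positivity)]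
  calc _ ≤ |relCumulant (jointMomentAt μ X t₀ τ) (jointMoment μ X τ) Finset.univ| *
      (((j : ℝ) + 1) ^ (2 * (j + 1)) * (1 + ((d / (j + 1) : ℕ) : ℝ)) ^ (2 * (j + 1))) := by gcongr
    _ = ((j : ℝ) + 1) ^ (2 * (j + 1)) * (|relCumulant (jointMomentAt μ X t₀ τ) (jointMoment μ X τ) Finset.univ| *
       (1 + ((d / (j + 1) : ℕ) : ℝ)) ^ (2 * (j + 1))) := by ring
    _ ≤ ((j : ℝ) + 1) ^ (2 * (j + 1)) * (R * Q) := by gcongr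
    _ = _ := by ring

/-- Coordinates outside `B` are free and contribute one factor `card α` each. This converts sums of
joint moments over time tuples into moments of the sum, in the normalization of
`sum_relCumulant_eq_momentCumulant`. -/
theorem sum_prod_mul_card_pow {ι α : Type*} [Fintype ι] [DecidableEq ι] [Fintype α]
    (x : α → ℝ) (B : Finset ι) :
    (∑ t : ι → α, ∏ i ∈ B, x (t i)) * (Fintype.card α : ℝ) ^ B.card =
      (Fintype.card α : ℝ) ^ Fintype.card ι * (∑ a, x a) ^ B.card := by
  have h1 : ∀ t : ι → α, ∏ i ∈ B, x (t i) = ∏ i, if i ∈ B then x (t i) else 1 := fun t => by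
    rw [Finset.prod_ite_mem, Finset.univ_inter]
  have h2 : ∑ t : ι → α, ∏ i, (if i ∈ B then x (t i) else 1) =
      ∏ i, ∑ a, if i ∈ B then x a else 1 := by
    rw [Finset.prod_univ_sum, Fintype.piFinset_univ]
  have h3 : ∀ i, (∑ a, if i ∈ B then x a else 1) =
      if i ∈ B then ∑ a, x a else (Fintype.card α : ℝ) := fun i => by
    split_ifs <;> simp
  simp_rw [h1]
  rw [h2]
  simp_rw [h3]
  rw [Finset.prod_ite]
  simp only [Finset.prod_const, Finset.filter_mem_eq_inter, Finset.univ_inter]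
  have h4 : (Finset.univ.filter fun i => i ∉ B).card + B.card = Fintype.card ι := by
    have := Finset.card_filter_add_card_filter_not (s := (Finset.univ : Finset ι)) (fun i => i ∈ B)
    rw [Finset.filter_mem_eq_inter, Finset.univ_inter, Finset.card_univ] at this
    omega
  rw [← h4, pow_add]
  ring

/-- By multilinearity the cumulant of the sum is the sum of joint cumulants over all time tuples.
For fixed `t₀` the other `j` times sum to at most `4 ^ j`, and `t₀` itself gives the factor `n`. The
linear growth in `n`, for every order, is what makes the Gaussian term dominate. -/
theorem abs_momentCumulant_le [IsProbabilityMeasure μ] {ρ : ℕ → ℝ} {R : ℝ} (hD : 0 ≤ D) (hX : ∀ t, Measurable (X t))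
    (hb : ∀ t, ∀ᵐ ω ∂μ, |X t ω| ≤ D) (hmix : MomentMixing μ X D ρ) {j : ℕ}
    (hR : 1 ≤ R) (hρ : ∀ g, ρ g * (1 + (g : ℝ)) ^ (2 * (j + 1)) ≤ R) (n : ℕ) (hn : 1 ≤ n) :
    |momentCumulant (fun p => ∫ ω, (∑ t ∈ Finset.range n, X t ω) ^ p ∂μ) j| ≤
      n * (R * (D ^ (j + 1) * ((j : ℝ) + 1) ^ (j + 1)) * ((j : ℝ) + 1) ^ (2 * (j + 1)) * 4 ^ j) := by
  have : Nonempty (Fin n) := ⟨⟨0, hn⟩⟩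
  set m : ℕ → ℝ := fun p => ∫ ω, (∑ t ∈ Finset.range n, X t ω) ^ p ∂μ with hm
  set W : ℝ := R * (D ^ (j + 1) * ((j : ℝ) + 1) ^ (j + 1)) * ((j : ℝ) + 1) ^ (2 * (j + 1)) with hW
  have hW0 : 0 ≤ W := by positivity
  have hG : ∀ B : Finset (Fin j), (∑ t : Fin j → Fin n, jointMoment μ X (fun i => (t i : ℕ)) B) *
      (Fintype.card (Fin n) : ℝ) ^ B.card =
      (Fintype.card (Fin n) : ℝ) ^ Fintype.card (Fin j) * m B.card := by
    intro B
    unfold jointMoment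
    rw [← integral_finsetSum _ fun t _ => integrable_prod hX hb (fun i => ((t i : Fin n) : ℕ)) B,
      ← integral_mul_const, hm, ← integral_const_mul]
    congr 1
    ext ω
    rw [sum_prod_mul_card_pow (fun a : Fin n => X a ω) B, Finset.sum_range]
  have hF : ∀ B : Finset (Fin j), (∑ t : Fin j → Fin n, ∑ t₀ : Fin n,
      jointMomentAt μ X t₀ (fun i => (t i : ℕ)) B) *
      (Fintype.card (Fin n) : ℝ) ^ B.card =
      (Fintype.card (Fin n) : ℝ) ^ Fintype.card (Fin j) * m (B.card + 1) := by
    intro B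
    have hint : ∀ (t : Fin j → Fin n) (t₀ : Fin n), Integrable (fun ω => ∏ o ∈ Finset.insertNone B,
        X (o.elim (t₀ : ℕ) fun i => (t i : ℕ)) ω) μ := fun t t₀ =>
      integrable_prod hX hb (fun o : Option (Fin j) => o.elim (t₀ : ℕ) fun i => (t i : ℕ)) _
    have hsum : ∑ t : Fin j → Fin n, ∑ t₀ : Fin n, jointMomentAt μ X t₀ (fun i => (t i : ℕ)) B =
        ∫ ω, ∑ t : Fin j → Fin n, ∑ t₀ : Fin n, ∏ o ∈ Finset.insertNone B,
          X (o.elim (t₀ : ℕ) fun i => (t i : ℕ)) ω ∂μ := by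
      rw [integral_finsetSum _ fun t _ => integrable_finsetSum _ fun t₀ _ => hint t t₀]
      exact Finset.sum_congr rfl fun t _ => (integral_finsetSum _ fun t₀ _ => hint t t₀).symm
    rw [hsum,
      ← integral_mul_const, hm, ← integral_const_mul]
    congr 1
    ext ω
    have := sum_prod_mul_card_pow (fun a : Fin n => X a ω) B
    rw [Finset.sum_range, pow_succ, ← mul_assoc, ← this]
    simp only [Finset.prod_insertNone, Option.elim]
    simp_rw [← Finset.sum_mul, ← Finset.mul_sum]
    ring
  have key := sum_relCumulant_eq_momentCumulant m
    (fun (t : Fin j → Fin n) B => ∑ t₀ : Fin n, jointMomentAt μ X t₀ (fun i => (t i : ℕ)) B)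
    (fun t B => jointMoment μ X (fun i => (t i : ℕ)) B)
    (fun B t t' h => Finset.sum_congr rfl fun t₀ _ => by
      unfold jointMomentAt
      refine jointMoment_congr fun o ho => ?_
      cases o with
      | none => rfl
      | some x => simp only [Option.elim]; rw [h x (by simpa using ho)])
    (fun B t t' h => jointMoment_congr fun i hi => by rw [h i hi]) hF hG Finset.univ
  rw [Finset.card_univ, mul_comm] at key
  have hN : (Fintype.card (Fin n) : ℝ) ^ Fintype.card (Fin j) ≠ 0 := by
    simp; omega
  have key2 := mul_left_cancel₀ hN key
  rw [Fintype.card_fin] at key2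
  rw [← key2]
  calc _ ≤ ∑ t : Fin j → Fin n, ∑ t₀ : Fin n, W * ∏ i, ((1 + (Nat.dist (t i : ℕ) t₀ : ℝ)) ^ 2)⁻¹ := by
        refine (Finset.abs_sum_le_sum_abs _ _).trans (Finset.sum_le_sum fun t _ => ?_)
        rw [relCumulant_sum]
        refine (Finset.abs_sum_le_sum_abs _ _).trans (Finset.sum_le_sum fun t₀ _ => ?_)
        exact abs_relCumulant_jointMoment_le hD hb hmix hR hρ t₀ fun i => (t i : ℕ)
    _ = ∑ t₀ : Fin n, W * ∏ _i : Fin j, ∑ s : Fin n, ((1 + (Nat.dist (s : ℕ) t₀ : ℝ)) ^ 2)⁻¹ := by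
        rw [Finset.sum_comm]
        refine Finset.sum_congr rfl fun t₀ _ => ?_
        rw [← Finset.mul_sum, Finset.prod_univ_sum, Fintype.piFinset_univ]
    _ ≤ ∑ t₀ : Fin n, W * ∏ _i : Fin j, 4 := by
        refine Finset.sum_le_sum fun t₀ _ => ?_
        gcongr with i
        have := sum_inv_sq_dist_le n t₀
        rwa [Finset.sum_range] at this
    _ = _ := by simp

end


/-! ### Covariance inequality for strongly mixing processes -/

section AlphaCovariance

theorem measurable_two_mul_indicator_sub_one {Ω₀ : Type*} {m : MeasurableSpace Ω₀} {A : Set Ω₀}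
    (hA : MeasurableSet[m] A) : Measurable[m] fun w => 2 * A.indicator (1 : Ω₀ → ℝ) w - 1 :=
  ((measurable_one.indicator hA).const_mul _).sub_const _

variable {Ω₀ : Type*} {𝒢 ℋ m₀ : MeasurableSpace Ω₀} {P : Measure Ω₀} [IsProbabilityMeasure P]

/-- The covariance equals the integral of `f` against `Y = E[g | 𝒢] - E g`. Its modulus is at most
`a ∫ |Y|`, and `|Y|` is `Y` times the `±1`-valued function of the `𝒢`-measurable set where `Y ≥ 0`.
-/
theorem exists_sign_cov_le (h𝒢 : 𝒢 ≤ m₀) {f g : Ω₀ → ℝ} {a b : ℝ}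
    (hf : Measurable[𝒢] f) (hfa : ∀ w, |f w| ≤ a) (hg : Measurable g) (hgb : ∀ w, |g w| ≤ b) :
    ∃ A, MeasurableSet[𝒢] A ∧ |∫ w, f w * g w ∂P - (∫ w, f w ∂P) * ∫ w, g w ∂P| ≤
      a * (∫ w, (2 * A.indicator 1 w - 1) * g w ∂P -
        (∫ w, (2 * A.indicator 1 w - 1) ∂P) * ∫ w, g w ∂P) := by
  have hgi : Integrable g P := integrable_of_bdd hg.aestronglyMeasurable b (ae_of_all _ hgb)
  set c := ∫ w, g w ∂P
  set Y : Ω₀ → ℝ := fun w => (P[g|𝒢]) w - c with hY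
  have hYm : Measurable[𝒢] Y := stronglyMeasurable_condExp.measurable.sub_const _
  have hYi : Integrable Y P := integrable_condExp.sub (integrable_const _)
  have hcov : ∀ u : Ω₀ → ℝ, Measurable[𝒢] u → (∃ C, ∀ w, |u w| ≤ C) →
      ∫ w, u w * g w ∂P - (∫ w, u w ∂P) * c = ∫ w, u w * Y w ∂P := by
    rintro u hu ⟨C, hC⟩
    have hu0 : AEStronglyMeasurable u P := (hu.mono h𝒢 le_rfl).aestronglyMeasurable
    have hui : Integrable u P := integrable_of_bdd hu0 C (ae_of_all _ hC)
    have hug : Integrable (u * g) P := hgi.bdd_mul (c := C) hu0 (ae_of_all _ hC)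
    have h1 := condExp_mul_of_stronglyMeasurable_left (m := 𝒢) (μ := P) hu.stronglyMeasurable hug hgi
    have h2 : ∫ w, u w * g w ∂P = ∫ w, u w * (P[g|𝒢]) w ∂P := by
      rw [← integral_condExp h𝒢 (f := fun w => u w * g w)]
      exact integral_congr_ae h1
    have h3 : Integrable (fun w => u w * (P[g|𝒢]) w) P :=
      integrable_condExp.bdd_mul (c := C) hu0 (ae_of_all _ hC)
    rw [h2, ← integral_mul_const, ← integral_sub h3 (hui.mul_const _)]
    congr 1
    ext w
    simp only [hY]; ring
  have ha : 0 ≤ a := by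
    obtain ⟨w⟩ := nonempty_of_isProbabilityMeasure P
    exact (abs_nonneg _).trans (hfa w)
  refine ⟨{w | 0 ≤ Y w}, measurableSet_le measurable_const hYm, ?_⟩
  set A := {w | 0 ≤ Y w}
  have hAm : MeasurableSet[𝒢] A := measurableSet_le measurable_const hYm
  have hs : ∀ w, (2 * A.indicator (1 : Ω₀ → ℝ) w - 1) * Y w = |Y w| := by
    intro w
    by_cases hw : 0 ≤ Y w
    · rw [Set.indicator_of_mem (show w ∈ A from hw), abs_of_nonneg hw]; simp; ring
    · rw [Set.indicator_of_notMem (show w ∉ A from hw), abs_of_neg (not_le.1 hw)]; simp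
  rw [hcov f hf ⟨a, hfa⟩, hcov (fun w => 2 * A.indicator 1 w - 1) ?_ ⟨1, ?_⟩]
  · simp_rw [hs]
    rw [← integral_const_mul, ← Real.norm_eq_abs]
    refine norm_integral_le_of_norm_le (hYi.abs.const_mul a) (ae_of_all _ fun w => ?_)
    rw [Real.norm_eq_abs, abs_mul]
    exact mul_le_mul_of_nonneg_right (hfa w) (abs_nonneg _)
  · exact measurable_two_mul_indicator_sub_one hAm
  · intro w
    by_cases hw : w ∈ A <;> (simp [hw]; try norm_num)

/-- The reduction to signs is applied first to `f` and then to `g`. The covariance of two sign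
functions is `4 (P (A ∩ B) - P A * P B)`. -/
theorem abs_cov_le_alphaCoeff (h𝒢 : 𝒢 ≤ m₀) (hℋ : ℋ ≤ m₀)
    {f g : Ω₀ → ℝ} {a b : ℝ}
    (hf : Measurable[𝒢] f) (hfa : ∀ w, |f w| ≤ a) (hg : Measurable[ℋ] g) (hgb : ∀ w, |g w| ≤ b) :
    |∫ w, f w * g w ∂P - (∫ w, f w ∂P) * ∫ w, g w ∂P| ≤ 4 * a * b * alphaCoeff P 𝒢 ℋ := by
  obtain ⟨w₀⟩ := nonempty_of_isProbabilityMeasure P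
  have ha : 0 ≤ a := (abs_nonneg _).trans (hfa w₀)
  have hb : 0 ≤ b := (abs_nonneg _).trans (hgb w₀)
  obtain ⟨A, hA, h1⟩ := exists_sign_cov_le (P := P) h𝒢 hf hfa (hg.mono hℋ le_rfl) hgb
  have hsm : Measurable[𝒢] fun w => 2 * A.indicator (1 : Ω₀ → ℝ) w - 1 :=
    measurable_two_mul_indicator_sub_one hA
  have hs1 : ∀ w, |2 * A.indicator (1 : Ω₀ → ℝ) w - 1| ≤ 1 := by
    intro w
    by_cases hw : w ∈ A <;> (simp [hw]; try norm_num)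
  obtain ⟨B, hB, h2⟩ := exists_sign_cov_le (P := P) hℋ hg hgb (hsm.mono h𝒢 le_rfl) hs1
  have hA' := h𝒢 _ hA
  have hB' := hℋ _ hB
  have hAi : Integrable (A.indicator (1 : Ω₀ → ℝ)) P := (integrable_const (1 : ℝ)).indicator hA'
  have hBi : Integrable (B.indicator (1 : Ω₀ → ℝ)) P := (integrable_const (1 : ℝ)).indicator hB'
  have hABi : Integrable ((A ∩ B).indicator (1 : Ω₀ → ℝ)) P :=
    (integrable_const (1 : ℝ)).indicator (hA'.inter hB')
  have e1 : ∫ w, (2 * A.indicator (1 : Ω₀ → ℝ) w - 1) ∂P = 2 * P.real A - 1 := by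
    rw [integral_sub (hAi.const_mul 2) (integrable_const _), integral_const_mul,
      integral_indicator_one hA']; simp
  have e2 : ∫ w, (2 * B.indicator (1 : Ω₀ → ℝ) w - 1) ∂P = 2 * P.real B - 1 := by
    rw [integral_sub (hBi.const_mul 2) (integrable_const _), integral_const_mul,
      integral_indicator_one hB']; simp
  have e3 : ∫ w, (2 * B.indicator (1 : Ω₀ → ℝ) w - 1) * (2 * A.indicator (1 : Ω₀ → ℝ) w - 1) ∂P =
      4 * P.real (A ∩ B) - 2 * P.real A - 2 * P.real B + 1 := by
    have : ∀ w, (2 * B.indicator (1 : Ω₀ → ℝ) w - 1) * (2 * A.indicator (1 : Ω₀ → ℝ) w - 1) =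
        4 * (A ∩ B).indicator (1 : Ω₀ → ℝ) w - 2 * A.indicator (1 : Ω₀ → ℝ) w
          - 2 * B.indicator (1 : Ω₀ → ℝ) w + 1 := by
      intro w
      by_cases h : w ∈ A <;> by_cases h' : w ∈ B <;> simp [h, h'] <;> norm_num
    simp_rw [this]
    have hi1 : Integrable (fun w => 4 * (A ∩ B).indicator (1 : Ω₀ → ℝ) w
        - 2 * A.indicator (1 : Ω₀ → ℝ) w) P := (hABi.const_mul 4).sub (hAi.const_mul 2)
    have hi2 : Integrable (fun w => 4 * (A ∩ B).indicator (1 : Ω₀ → ℝ) w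
        - 2 * A.indicator (1 : Ω₀ → ℝ) w - 2 * B.indicator (1 : Ω₀ → ℝ) w) P :=
      hi1.sub (hBi.const_mul 2)
    rw [integral_add hi2 (integrable_const _), integral_sub hi1 (hBi.const_mul 2),
      integral_sub (hABi.const_mul 4) (hAi.const_mul 2), integral_const_mul, integral_const_mul,
      integral_const_mul, integral_indicator_one hA', integral_indicator_one hB',
      integral_indicator_one (hA'.inter hB')]
    simp
  have hbdd : BddAbove {r : ℝ | ∃ A B : Set Ω₀, MeasurableSet[𝒢] A ∧ MeasurableSet[ℋ] B ∧
      r = |P.real (A ∩ B) - P.real A * P.real B|} := by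
    refine ⟨1, ?_⟩
    rintro r ⟨A, B, -, -, rfl⟩
    have i1 : P.real A ≤ 1 := measureReal_le_one
    have i2 : P.real B ≤ 1 := measureReal_le_one
    have i3 : P.real (A ∩ B) ≤ 1 := measureReal_le_one
    have j1 : 0 ≤ P.real A := measureReal_nonneg
    have j2 : 0 ≤ P.real B := measureReal_nonneg
    have j3 : 0 ≤ P.real (A ∩ B) := measureReal_nonneg
    rw [abs_le]; constructor <;> nlinarith
  have hle : |P.real (A ∩ B) - P.real A * P.real B| ≤ alphaCoeff P 𝒢 ℋ :=
    le_csSup hbdd ⟨A, B, hA, hB, rfl⟩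
  rw [e1, e2, e3] at h2
  have h3 := (le_abs_self _).trans hle
  calc _ ≤ a * (∫ w, (2 * A.indicator 1 w - 1) * g w ∂P -
        (∫ w, (2 * A.indicator 1 w - 1) ∂P) * ∫ w, g w ∂P) := h1
    _ ≤ a * (b * (4 * alphaCoeff P 𝒢 ℋ)) := by
      refine mul_le_mul_of_nonneg_left ?_ ha
      rw [e1]
      have h4 := (le_abs_self _).trans h2
      have e5 : ∫ w, (2 * A.indicator (1 : Ω₀ → ℝ) w - 1) * g w ∂P =
        ∫ w, g w * (2 * A.indicator (1 : Ω₀ → ℝ) w - 1) ∂P := by simp_rw [mul_comm]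
      rw [e5]
      calc _ ≤ b * (4 * P.real (A ∩ B) - 2 * P.real A - 2 * P.real B + 1 -
            (2 * P.real B - 1) * (2 * P.real A - 1)) := by linarith
        _ ≤ _ := mul_le_mul_of_nonneg_left (by linarith) hb
    _ = _ := by ring

end AlphaCovariance

/-! ### Covariances of past and future functionals on the path space. -/

section PathSpace

variable {Ω₀ 𝒴 : Type*} [MeasurableSpace Ω₀] [MeasurableSpace 𝒴] {P : Measure Ω₀}
  [IsProbabilityMeasure P] {ξ : ℤ → Ω₀ → 𝒴}

theorem measurable_comp_pi {Ω₀ 𝒴 : Type*} [MeasurableSpace Ω₀] [MeasurableSpace 𝒴]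
    {F : (ℤ → 𝒴) → ℝ} (hF : Measurable F) (ζ : ℤ → Ω₀ → 𝒴) (hζ : ∀ k, Measurable (ζ k)) :
    Measurable (F ∘ fun w k => ζ k w) :=
  hF.comp (measurable_pi_iff.2 hζ)

-- That `F` depends only on coordinates in `s` is encoded as invariance under `ω ↦ ω ∘ r` with `r`
-- valued in `s`. Then `F` of the path is literally a function of the variables `ξ (r j)`, which
-- gives measurability for the smaller `σ`-algebra.
omit [MeasurableSpace Ω₀] in
theorem measurable_comp_sigma {s : Set ℤ} {F : (ℤ → 𝒴) → ℝ} (hF : Measurable F) (r : ℤ → ℤ)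
    (hr : ∀ j, r j ∈ s) (hFr : ∀ ω, F (fun j => ω (r j)) = F ω) :
    Measurable[⨆ j : s, MeasurableSpace.comap (ξ j) inferInstance] fun w => F fun k => ξ k w := by
  have h1 : (fun w => F fun k => ξ k w) = F ∘ fun w => fun k => ξ (r k) w := by
    ext w
    exact (hFr (fun k => ξ k w)).symm
  rw [h1]
  refine @measurable_comp_pi Ω₀ 𝒴 (⨆ j : s, MeasurableSpace.comap (ξ j) inferInstance) _ F hF
    (fun k => ξ (r k)) fun j => ?_
  exact measurable_iff_comap_le.2
    (le_iSup (fun j : s => MeasurableSpace.comap (ξ j) inferInstance) ⟨r j, hr j⟩)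

theorem alphaCoeff_le_alphaMixing (k : ℤ) (n : ℕ) :
    alphaCoeff P (sigmaPast ξ k) (sigmaFuture ξ (k + n)) ≤ alphaMixing P ξ n := by
  refine le_ciSup (f := fun k : ℤ => alphaCoeff P (sigmaPast ξ k) (sigmaFuture ξ (k + n))) ?_ k
  refine ⟨1, ?_⟩
  rintro r ⟨k, rfl⟩
  refine Real.sSup_le ?_ zero_le_one
  rintro r ⟨A, B, -, -, rfl⟩
  have i1 : P.real A ≤ 1 := measureReal_le_one
  have i2 : P.real B ≤ 1 := measureReal_le_one
  have i3 : P.real (A ∩ B) ≤ 1 := measureReal_le_one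
  have j1 : 0 ≤ P.real A := measureReal_nonneg
  have j2 : 0 ≤ P.real B := measureReal_nonneg
  have j3 : 0 ≤ P.real (A ∩ B) := measureReal_nonneg
  rw [abs_le]; constructor <;> nlinarith

/-- The covariance of bounded functionals of the past and of the future of a process. -/
theorem abs_cov_pathLaw_le (hξ : ∀ k, Measurable (ξ k)) {F G : (ℤ → 𝒴) → ℝ} {a b : ℝ}
    (hF : Measurable F) (hFa : ∀ ω, |F ω| ≤ a) (hG : Measurable G) (hGb : ∀ ω, |G ω| ≤ b)
    (k : ℤ) (n : ℕ) (hFk : ∀ ω, F (fun j => ω (min j k)) = F ω)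
    (hGk : ∀ ω, G (fun j => ω (max j (k + n))) = G ω) :
    |∫ ω, F ω * G ω ∂(pathLaw P ξ) - (∫ ω, F ω ∂(pathLaw P ξ)) * ∫ ω, G ω ∂(pathLaw P ξ)| ≤
      4 * a * b * alphaMixing P ξ n := by
  obtain ⟨w₀⟩ := nonempty_of_isProbabilityMeasure P
  have ha : 0 ≤ a := (abs_nonneg _).trans (hFa fun k => ξ k w₀)
  have hb : 0 ≤ b := (abs_nonneg _).trans (hGb fun k => ξ k w₀)
  have hm : Measurable fun w k => ξ k w := measurable_pi_iff.2 hξ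
  unfold pathLaw
  rw [integral_map hm.aemeasurable (f := fun ω => F ω * G ω) (hF.mul hG).aestronglyMeasurable,
    integral_map hm.aemeasurable hF.aestronglyMeasurable,
    integral_map hm.aemeasurable hG.aestronglyMeasurable]
  refine (abs_cov_le_alphaCoeff (𝒢 := sigmaPast ξ k) (ℋ := sigmaFuture ξ (k + n))
    (iSup_le fun j => (hξ j).comap_le) (iSup_le fun j => (hξ j).comap_le)
    (measurable_comp_sigma hF (fun j => min j k) (fun j => Set.mem_Iic.2 (min_le_right _ _)) hFk)
    (fun w => hFa _)
    (measurable_comp_sigma hG (fun j => max j (k + n)) (fun j => Set.mem_Ici.2 (le_max_right _ _)) hGk)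
    (fun w => hGb _)).trans ?_
  exact mul_le_mul_of_nonneg_left (alphaCoeff_le_alphaMixing k n) (by positivity)

end PathSpace


/-! ### Moments of sequential martingales -/

/-- By convexity the exponential lies below its chord over `[-b, b]`. The linear term is kept
because it will integrate to zero against functions of the next state. -/
theorem exp_mul_le_cosh_add {b s x : ℝ} (hb : 0 < b) (hx : |x| ≤ b) :
    Real.exp (s * x) ≤ Real.cosh (s * b) + x * (Real.sinh (s * b) / b) := by
  obtain ⟨h1, h2⟩ := abs_le.1 hx
  have := convexOn_exp.2 (Set.mem_univ (s * b)) (Set.mem_univ (-(s * b)))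
    (show 0 ≤ (b + x) / (2 * b) from div_nonneg (by linarith) (by linarith))
    (show 0 ≤ (b - x) / (2 * b) from div_nonneg (by linarith) (by linarith))
    (by field_simp; ring)
  simp only [smul_eq_mul] at this
  rw [show (b + x) / (2 * b) * (s * b) + (b - x) / (2 * b) * -(s * b) = s * x by
    field_simp; ring] at this
  refine this.trans (le_of_eq ?_)
  rw [Real.cosh_eq, Real.sinh_eq]
  field_simp
  ring

/-- The composition `T (j - 1) ∘ ⋯ ∘ T 0`. -/
def seqComp {X : Type*} : (ℕ → X → X) → ℕ → X → X
  | _, 0 => id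
  | T, j + 1 => fun x => seqComp (fun i => T (i + 1)) j (T 0 x)

theorem measurable_seqComp {X : Type*} [MeasurableSpace X] {T : ℕ → X → X}
    (hT : ∀ i, Measurable (T i)) (j : ℕ) : Measurable (seqComp T j) := by
  induction j generalizing T with
  | zero => exact measurable_id
  | succ j ih => exact (ih fun i => hT (i + 1)).comp (hT 0)

/-- Azuma's inequality for reverse martingale differences. Everything after the first summand is a
function of `T 0 x`, to which `M 0` is orthogonal. So the linear term of the chord bound disappears,
and `cosh (s b) ≤ exp ((s b)² / 2)` gives the factor of one step; the rest is the same statement for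
the shifted sequences. -/
theorem integral_exp_martingale_le {X : Type*} [MeasurableSpace X] {b : ℝ} (hb : 0 < b) (s : ℝ)
    (n : ℕ) (ν : ℕ → Measure X) [∀ i, IsProbabilityMeasure (ν i)] (T : ℕ → X → X) (M : ℕ → X → ℝ)
    (hT : ∀ i, MeasurePreserving (T i) (ν i) (ν (i + 1))) (hM : ∀ i, Measurable (M i))
    (hMb : ∀ i x, |M i x| ≤ b)
    (horth : ∀ i, ∀ F : X → ℝ, Measurable F → (∃ C, ∀ x, |F x| ≤ C) →
      ∫ x, M i x * F (T i x) ∂(ν i) = 0) :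
    ∫ x, Real.exp (s * ∑ j ∈ Finset.range n, M j (seqComp T j x)) ∂(ν 0) ≤
      Real.exp (n * (s * b) ^ 2 / 2) := by
  induction n generalizing ν T M with
  | zero => simp
  | succ n ih =>
    set F : X → ℝ := fun x => Real.exp (s * ∑ j ∈ Finset.range n,
      M (j + 1) (seqComp (fun i => T (i + 1)) j x)) with hF
    have ih' := ih (fun i => ν (i + 1)) (fun i => T (i + 1)) (fun i => M (i + 1))
      (fun i => hT (i + 1)) (fun i => hM (i + 1)) (fun i => hMb (i + 1)) (fun i => horth (i + 1))
    have hFm : Measurable F := by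
      refine Real.measurable_exp.comp (Measurable.const_mul ?_ s)
      exact Finset.measurable_fun_sum _ fun j _ => (hM (j + 1)).comp
        (measurable_seqComp (fun i => (hT (i + 1)).measurable) j)
    have hF0 : ∀ x, 0 ≤ F x := fun x => (Real.exp_pos _).le
    have hFb : ∃ C, ∀ x, |F x| ≤ C := by
      refine ⟨Real.exp (|s| * (n * b)), fun x => ?_⟩
      rw [abs_of_nonneg (hF0 x)]
      refine Real.exp_le_exp.2 ((le_abs_self _).trans ?_)
      rw [abs_mul]
      refine mul_le_mul_of_nonneg_left ((Finset.abs_sum_le_sum_abs _ _).trans ?_) (abs_nonneg _)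
      refine (Finset.sum_le_sum fun j _ => hMb (j + 1) _).trans (by simp)
    obtain ⟨C, hC⟩ := hFb
    have hFi : Integrable (fun x => F (T 0 x)) (ν 0) :=
      integrable_of_bdd (hFm.comp (hT 0).measurable).aestronglyMeasurable C (ae_of_all _ fun x => hC _)
    have hMF : Integrable (fun x => M 0 x * F (T 0 x)) (ν 0) :=
      hFi.bdd_mul (c := b) (hM 0).aestronglyMeasurable (ae_of_all _ fun x => hMb 0 x)
    have hpt : ∀ x, Real.exp (s * ∑ j ∈ Finset.range (n + 1), M j (seqComp T j x)) ≤
        Real.cosh (s * b) * F (T 0 x) + (Real.sinh (s * b) / b) * (M 0 x * F (T 0 x)) := by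
      intro x
      rw [Finset.sum_range_succ', mul_add, Real.exp_add, mul_comm]
      have h1 := mul_le_mul_of_nonneg_right (exp_mul_le_cosh_add (s := s) hb (hMb 0 x)) (hF0 (T 0 x))
      refine le_trans h1 (le_of_eq (by ring))
    have hmeas : Measurable fun x => Real.exp (s * ∑ j ∈ Finset.range (n + 1), M j (seqComp T j x)) := by
      refine Real.measurable_exp.comp (Measurable.const_mul ?_ s)
      exact Finset.measurable_fun_sum _ fun j _ => (hM j).comp
        (measurable_seqComp (fun i => (hT i).measurable) j)
    have hTF : ∫ x, F (T 0 x) ∂(ν 0) = ∫ x, F x ∂(ν 1) := by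
      have h := (hT 0).map_eq
      rw [zero_add] at h
      rw [← h, integral_map (hT 0).measurable.aemeasurable hFm.aestronglyMeasurable]
    calc _ ≤ ∫ x, (Real.cosh (s * b) * F (T 0 x) +
          (Real.sinh (s * b) / b) * (M 0 x * F (T 0 x))) ∂(ν 0) :=
          integral_mono_of_nonneg (ae_of_all _ fun x => (Real.exp_pos _).le)
            ((hFi.const_mul _).add (hMF.const_mul _)) (ae_of_all _ hpt)
      _ = Real.cosh (s * b) * ∫ x, F x ∂(ν 1) := by
        rw [integral_add (hFi.const_mul _) (hMF.const_mul _), integral_const_mul,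
          integral_const_mul, horth 0 F hFm ⟨C, hC⟩, hTF]
        ring
      _ ≤ Real.exp ((s * b) ^ 2 / 2) * Real.exp (n * (s * b) ^ 2 / 2) := by
        exact mul_le_mul (Real.cosh_le_exp_half_sq _) ih'
          (integral_nonneg hF0) (Real.exp_pos _).le
      _ = _ := by rw [← Real.exp_add]; congr 1; push_cast; ring

theorem pow_le_factorial_mul_exp {s x : ℝ} (hs : 0 < s) (q : ℕ) :
    |x| ^ q ≤ q.factorial / s ^ q * (Real.exp (s * x) + Real.exp (-s * x)) := by
  have h1 := Real.pow_div_factorial_le_exp (s * |x|) (by positivity) q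
  have h2 : Real.exp (s * |x|) ≤ Real.exp (s * x) + Real.exp (-s * x) := by
    rcases abs_cases x with ⟨h, _⟩ | ⟨h, _⟩ <;> rw [h]
    · linarith [Real.exp_pos (-s * x)]
    · rw [mul_neg, ← neg_mul]; linarith [Real.exp_pos (s * x)]
  have h3 := h1.trans h2
  rw [div_mul_eq_mul_div, le_div_iff₀ (by positivity)]
  rw [mul_pow, div_le_iff₀ (by positivity)] at h3
  linarith

theorem integral_martingale_pow_le {X : Type*} [MeasurableSpace X] {b : ℝ} (hb : 0 < b)
    (n p : ℕ) (hn : 1 ≤ n) (hp : 1 ≤ p)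
    (ν : ℕ → Measure X) [∀ i, IsProbabilityMeasure (ν i)] (T : ℕ → X → X) (M : ℕ → X → ℝ)
    (hT : ∀ i, MeasurePreserving (T i) (ν i) (ν (i + 1))) (hM : ∀ i, Measurable (M i))
    (hMb : ∀ i x, |M i x| ≤ b)
    (horth : ∀ i, ∀ F : X → ℝ, Measurable F → (∃ C, ∀ x, |F x| ≤ C) →
      ∫ x, M i x * F (T i x) ∂(ν i) = 0) :
    ∫ x, (∑ j ∈ Finset.range n, M j (seqComp T j x)) ^ (2 * p) ∂(ν 0) ≤
      2 * (6 * b ^ 2 * n * p) ^ p := by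
  have hn' : (0 : ℝ) < n := by exact_mod_cast hn
  have hp' : (0 : ℝ) < p := by exact_mod_cast hp
  -- With this `s` the exponent `n (s b)² / 2` equals `p`, so the exponential moments at `± s` are
  -- at most `e ^ p ≤ 3 ^ p`.
  set s := Real.sqrt (2 * p / (n * b ^ 2)) with hs
  have hs2 : s ^ 2 = 2 * p / (n * b ^ 2) := Real.sq_sqrt (by positivity)
  have hs0 : 0 < s := Real.sqrt_pos.2 (by positivity)
  set W : X → ℝ := fun x => ∑ j ∈ Finset.range n, M j (seqComp T j x) with hW
  have hWm : Measurable W := Finset.measurable_fun_sum _ fun j _ => (hM j).comp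
    (measurable_seqComp (fun i => (hT i).measurable) j)
  have hWb : ∀ x, |W x| ≤ n * b := fun x =>
    (Finset.abs_sum_le_sum_abs _ _).trans ((Finset.sum_le_sum fun j _ => hMb j _).trans (by simp))
  have hexp : ∀ u : ℝ, Integrable (fun x => Real.exp (u * W x)) (ν 0) := fun u =>
    integrable_of_bdd (Real.measurable_exp.comp (hWm.const_mul u)).aestronglyMeasurable
      (Real.exp (|u| * (n * b))) (ae_of_all _ fun x => by
        rw [abs_of_pos (Real.exp_pos _)]
        refine Real.exp_le_exp.2 ((le_abs_self _).trans ?_)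
        rw [abs_mul]
        exact mul_le_mul_of_nonneg_left (hWb x) (abs_nonneg _))
  have h1 := integral_exp_martingale_le hb s n ν T M hT hM hMb horth
  have h2 := integral_exp_martingale_le hb (-s) n ν T M hT hM hMb horth
  rw [neg_mul, neg_sq] at h2
  have hexpo : (n : ℝ) * (s * b) ^ 2 / 2 = p := by
    rw [mul_pow, hs2]; field_simp
  rw [hexpo] at h1 h2
  have hfac : ((2 * p).factorial : ℝ) ≤ (2 * p : ℝ) ^ (2 * p) := by
    exact_mod_cast Nat.factorial_le_pow (2 * p)
  have he : Real.exp p ≤ 3 ^ p := by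
    rw [← mul_one (p : ℝ), Real.exp_nat_mul]
    exact pow_le_pow_left₀ (Real.exp_pos _).le (Real.exp_one_lt_d9.le.trans (by norm_num)) _
  calc ∫ x, W x ^ (2 * p) ∂(ν 0) ≤ ∫ x, ((2 * p).factorial / s ^ (2 * p)) *
        (Real.exp (s * W x) + Real.exp (-s * W x)) ∂(ν 0) := by
        refine integral_mono_of_nonneg (ae_of_all _ fun x => by
          simp only [Pi.zero_apply]; rw [pow_mul]; positivity)
          (((hexp s).add (hexp (-s))).const_mul _) (ae_of_all _ fun x => ?_)
        have := pow_le_factorial_mul_exp (x := W x) hs0 (2 * p)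
        rwa [pow_mul |W x|, sq_abs, ← pow_mul] at this
    _ = ((2 * p).factorial / s ^ (2 * p)) *
        (∫ x, Real.exp (s * W x) ∂(ν 0) + ∫ x, Real.exp (-s * W x) ∂(ν 0)) := by
        rw [integral_const_mul, integral_add (hexp s) (hexp (-s))]
    _ ≤ ((2 * p : ℝ) ^ (2 * p) / s ^ (2 * p)) * (3 ^ p + 3 ^ p) := by
        gcongr
        · exact h1.trans he
        · exact h2.trans he
    _ = 2 * (6 * b ^ 2 * n * p) ^ p := by
        rw [← two_mul, pow_mul s, hs2, pow_mul (2 * p : ℝ), ← div_pow, mul_comm, mul_assoc, ← mul_pow]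
        congr 2
        field_simp
        ring

/-! ### Moments under a near-independence condition -/

theorem exp_sub_le_exp_sq {x : ℝ} (hx : 0 ≤ x) : Real.exp x - x ≤ Real.exp (x ^ 2) := by
  rcases le_or_gt x 1 with h | h
  · have h1 := Real.exp_bound' hx h (n := 2) (by norm_num)
    norm_num [Finset.sum_range_succ, Nat.factorial] at h1
    have h2 := Real.add_one_le_exp (x ^ 2)
    nlinarith
  · have h1 : Real.exp x ≤ Real.exp (x ^ 2) := Real.exp_le_exp.2 (by nlinarith)
    linarith

/-- Cutting a product of two nonnegative sums at total degree `q` only discards nonnegative terms.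
-/
theorem sum_range_convolution_le {u v : ℕ → ℝ} (hu : ∀ j, 0 ≤ u j) (hv : ∀ j, 0 ≤ v j) (q : ℕ) :
    ∑ a ∈ Finset.range (q + 1), ∑ j ∈ Finset.range (a + 1), u j * v (a - j) ≤
      (∑ j ∈ Finset.range (q + 1), u j) * ∑ j ∈ Finset.range (q + 1), v j := by
  have h1 : ∑ a ∈ Finset.range (q + 1), ∑ j ∈ Finset.range (a + 1), u j * v (a - j) =
      ∑ j ∈ Finset.range (q + 1), ∑ a ∈ Finset.Ico j (q + 1), u j * v (a - j) := by
    refine Finset.sum_comm' fun a j => ?_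
    simp only [Finset.mem_range, Finset.mem_Ico]
    omega
  rw [h1, Finset.sum_mul]
  refine Finset.sum_le_sum fun j _ => ?_
  rw [← Finset.mul_sum, Finset.sum_Ico_eq_sum_range]
  refine mul_le_mul_of_nonneg_left ?_ (hu j)
  simp only [add_tsub_cancel_left]
  refine Finset.sum_le_sum_of_subset_of_nonneg (fun a => ?_) fun a _ _ => hv a
  simp only [Finset.mem_range]; omega

/-- The quantity `A i`, a generating function of absolute values of moments of the partial sum
truncated at degree `q`, behaves almost multiplicatively: adding a summand multiplies it by at most
`exp ((s b)²)`, with an additive error `δ exp (2 s)`. The truncation is needed because decoupling is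
available only up to total degree `q`. -/
theorem abs_integral_sum_pow_le {Ω : Type*} [MeasurableSpace Ω] {μ : Measure Ω}
    [IsProbabilityMeasure μ] {Y : ℕ → Ω → ℝ} {b δ s : ℝ} (hb : 0 ≤ b) (hδ : 0 ≤ δ) (hs : 0 < s)
    {q n : ℕ} (hq : 1 ≤ q)
    (hY : ∀ i, Measurable (Y i)) (hYb : ∀ i ω, |Y i ω| ≤ b) (hY0 : ∀ i, ∫ ω, Y i ω ∂μ = 0)
    (hdec : ∀ i < n, ∀ a j, a + j ≤ q →
      |∫ ω, (∑ l ∈ Finset.range i, Y l ω) ^ a * Y i ω ^ j ∂μ -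
        (∫ ω, (∑ l ∈ Finset.range i, Y l ω) ^ a ∂μ) * ∫ ω, Y i ω ^ j ∂μ| ≤ δ) :
    |∫ ω, (∑ l ∈ Finset.range n, Y l ω) ^ q ∂μ| ≤
      q.factorial / s ^ q * (Real.exp (n * (s * b) ^ 2) * (1 + n * (δ * Real.exp (2 * s)))) := by
  set S : ℕ → Ω → ℝ := fun i ω => ∑ l ∈ Finset.range i, Y l ω with hS
  have hSm : ∀ i, Measurable (S i) := fun i => Finset.measurable_fun_sum _ fun j _ => hY j
  have hSb : ∀ i ω, |S i ω| ≤ i * b := fun i ω =>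
    (Finset.abs_sum_le_sum_abs _ _).trans ((Finset.sum_le_sum fun j _ => hYb j _).trans (by simp))
  have hYk : ∀ i k ω, |Y i ω ^ k| ≤ b ^ k := fun i k ω => by
    rw [abs_pow]; exact pow_le_pow_left₀ (abs_nonneg _) (hYb i ω) k
  have hint : ∀ i a j, Integrable (fun ω => S i ω ^ a * Y i ω ^ j) μ := fun i a j =>
    integrable_of_bdd (((hSm i).pow_const a).mul ((hY i).pow_const j)).aestronglyMeasurable
      ((i * b) ^ a * b ^ j) (ae_of_all _ fun ω => by
        rw [abs_mul]
        refine mul_le_mul ?_ (hYk i j ω) (abs_nonneg _) (by positivity)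
        rw [abs_pow]; exact pow_le_pow_left₀ (abs_nonneg _) (hSb i ω) a)
  set A : ℕ → ℝ := fun i => ∑ a ∈ Finset.range (q + 1), s ^ a / a.factorial * |∫ ω, S i ω ^ a ∂μ|
    with hA
  have hfac : ∀ a : ℕ, (0 : ℝ) < a.factorial := fun a => by exact_mod_cast a.factorial_pos
  have hstep : ∀ i < n, A (i + 1) ≤ Real.exp ((s * b) ^ 2) * A i + δ * Real.exp (2 * s) := by
    intro i hi
    set u : ℕ → ℝ := fun a => s ^ a / a.factorial * |∫ ω, S i ω ^ a ∂μ| with hu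
    set v : ℕ → ℝ := fun a => s ^ a / a.factorial * |∫ ω, Y i ω ^ a ∂μ| with hv
    set e : ℕ → ℝ := fun a => s ^ a / a.factorial with he
    have hu0 : ∀ j, 0 ≤ u j := fun j => by have := hfac j; positivity
    have hv0 : ∀ j, 0 ≤ v j := fun j => by have := hfac j; positivity
    have he0 : ∀ j, 0 ≤ e j := fun j => by have := hfac j; positivity
    have hterm : ∀ a ∈ Finset.range (q + 1), s ^ a / a.factorial * |∫ ω, S (i + 1) ω ^ a ∂μ| ≤
        ∑ j ∈ Finset.range (a + 1), u j * v (a - j) +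
          δ * ∑ j ∈ Finset.range (a + 1), e j * e (a - j) := by
      intro a ha
      have h1 : ∫ ω, S (i + 1) ω ^ a ∂μ =
          ∑ j ∈ Finset.range (a + 1), (∫ ω, S i ω ^ j * Y i ω ^ (a - j) ∂μ) * a.choose j := by
        simp_rw [← integral_mul_const]
        rw [← integral_finsetSum _ fun j _ => (hint i j (a - j)).mul_const _]
        congr 1
        ext ω
        simp only [hS]
        rw [Finset.sum_range_succ, add_pow]
      rw [h1, Finset.mul_sum, ← Finset.sum_add_distrib]
      refine (mul_le_mul_of_nonneg_left (Finset.abs_sum_le_sum_abs _ _) (he0 a)).trans ?_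
      rw [Finset.mul_sum]
      refine Finset.sum_le_sum fun j hj => ?_
      have hja : j ≤ a := by simp at hj; omega
      have haq : a ≤ q := by simp at ha; omega
      have hd := hdec i hi j (a - j) (by omega)
      have hd2 : |∫ ω, S i ω ^ j * Y i ω ^ (a - j) ∂μ| ≤
          |∫ ω, S i ω ^ j ∂μ| * |∫ ω, Y i ω ^ (a - j) ∂μ| + δ := by
        rw [← abs_mul]
        have := abs_sub_abs_le_abs_sub (∫ ω, S i ω ^ j * Y i ω ^ (a - j) ∂μ)
          ((∫ ω, S i ω ^ j ∂μ) * ∫ ω, Y i ω ^ (a - j) ∂μ)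
        linarith
      have hch : s ^ a / a.factorial * (a.choose j : ℝ) = e j * e (a - j) := by
        simp only [he]
        rw [Nat.cast_choose ℝ hja]
        have hsa : s ^ a = s ^ j * s ^ (a - j) := by rw [← pow_add]; congr 1; omega
        have := hfac a; have := hfac j; have := hfac (a - j)
        rw [hsa]; field_simp
      rw [abs_mul, Nat.abs_cast]
      calc _ = (s ^ a / a.factorial * (a.choose j : ℝ)) * |∫ ω, S i ω ^ j * Y i ω ^ (a - j) ∂μ| := by ring
        _ ≤ (e j * e (a - j)) * (|∫ ω, S i ω ^ j ∂μ| * |∫ ω, Y i ω ^ (a - j) ∂μ| + δ) := by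
          rw [hch]; exact mul_le_mul_of_nonneg_left hd2 (mul_nonneg (he0 _) (he0 _))
        _ = _ := by simp only [hu, hv, he]; ring
    have hesum : ∑ j ∈ Finset.range (q + 1), e j ≤ Real.exp s := Real.sum_le_exp_of_nonneg hs.le _
    -- Centring kills the term `j = 1`, which is in range because `1 ≤ q`. The sum is then at most
    -- `exp (s b) - s b`, and so its logarithm is quadratic in `s b`.
    have hvsum : ∑ j ∈ Finset.range (q + 1), v j ≤ Real.exp ((s * b) ^ 2) := by
      have h1 : ∀ j ∈ Finset.range (q + 1), v j ≤
          (s * b) ^ j / j.factorial - if j = 1 then s * b else 0 := by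
        intro j _
        split_ifs with h
        · subst h; simp [hv, hY0]
        · rw [sub_zero, mul_pow, mul_div_right_comm]
          exact mul_le_mul_of_nonneg_left
            (abs_integral_le_of_bdd _ (ae_of_all _ (hYk i j))) (he0 j)
      refine (Finset.sum_le_sum h1).trans ?_
      rw [Finset.sum_sub_distrib, Finset.sum_ite_eq' (Finset.range (q + 1)) 1,
        if_pos (Finset.mem_range.2 (by omega))]
      have h2 : ∑ j ∈ Finset.range (q + 1), (s * b) ^ j / j.factorial ≤ Real.exp (s * b) :=
        Real.sum_le_exp_of_nonneg (by positivity) _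
      linarith [exp_sub_le_exp_sq (show 0 ≤ s * b by positivity)]
    calc A (i + 1) ≤ ∑ a ∈ Finset.range (q + 1), (∑ j ∈ Finset.range (a + 1), u j * v (a - j) +
          δ * ∑ j ∈ Finset.range (a + 1), e j * e (a - j)) := Finset.sum_le_sum hterm
      _ = (∑ a ∈ Finset.range (q + 1), ∑ j ∈ Finset.range (a + 1), u j * v (a - j)) +
          δ * ∑ a ∈ Finset.range (q + 1), ∑ j ∈ Finset.range (a + 1), e j * e (a - j) := by
        rw [Finset.sum_add_distrib, Finset.mul_sum]
      _ ≤ A i * Real.exp ((s * b) ^ 2) + δ * (Real.exp s * Real.exp s) := by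
        have hA0 : 0 ≤ A i := Finset.sum_nonneg fun j _ => hu0 j
        have hes0 : 0 ≤ ∑ j ∈ Finset.range (q + 1), e j := Finset.sum_nonneg fun j _ => he0 j
        refine add_le_add ((sum_range_convolution_le hu0 hv0 q).trans ?_)
          (mul_le_mul_of_nonneg_left ((sum_range_convolution_le he0 he0 q).trans ?_) hδ)
        · exact mul_le_mul_of_nonneg_left hvsum hA0
        · exact mul_le_mul hesum hesum hes0 (Real.exp_pos _).le
      _ = _ := by rw [← Real.exp_add, two_mul]; ring
  have hAn : ∀ i ≤ n, A i ≤ Real.exp (i * (s * b) ^ 2) * (1 + i * (δ * Real.exp (2 * s))) := by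
    intro i
    induction i with
    | zero =>
      intro _
      have h0 : ∀ a ∈ Finset.range (q + 1), s ^ a / a.factorial * |∫ ω, S 0 ω ^ a ∂μ| =
          if a = 0 then 1 else 0 := by
        intro a _
        split_ifs with h
        · subst h; simp
        · simp [hS, h]
      simp only [hA]
      rw [Finset.sum_congr rfl h0]
      simp
    | succ i ih =>
      intro hi
      refine (hstep i (by omega)).trans ?_
      have h1 := ih (by omega)
      have h2 : 1 ≤ Real.exp (((i + 1 : ℕ) : ℝ) * (s * b) ^ 2) := Real.one_le_exp (by positivity)
      calc _ ≤ Real.exp ((s * b) ^ 2) * (Real.exp (i * (s * b) ^ 2) *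
            (1 + i * (δ * Real.exp (2 * s)))) + 1 * (δ * Real.exp (2 * s)) := by
            rw [one_mul]; gcongr
        _ ≤ Real.exp ((s * b) ^ 2) * (Real.exp (i * (s * b) ^ 2) *
            (1 + i * (δ * Real.exp (2 * s)))) +
            Real.exp (((i + 1 : ℕ) : ℝ) * (s * b) ^ 2) * (δ * Real.exp (2 * s)) := by gcongr
        _ = _ := by
          rw [← mul_assoc, ← Real.exp_add]
          have : (s * b) ^ 2 + i * (s * b) ^ 2 = ((i + 1 : ℕ) : ℝ) * (s * b) ^ 2 := by push_cast; ring
          rw [this]; push_cast; ring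
  have h1 := hAn n le_rfl
  have h2 : s ^ q / q.factorial * |∫ ω, S n ω ^ q ∂μ| ≤ A n :=
    Finset.single_le_sum (f := fun a : ℕ => s ^ a / a.factorial * |∫ ω, S n ω ^ a ∂μ|)
      (fun a _ => by have := hfac a; positivity) (Finset.mem_range.2 (Nat.lt_succ_self q))
  have h3 := h2.trans h1
  have h4 : 0 < s ^ q := by positivity
  have h5 := hfac q
  calc _ = q.factorial / s ^ q * (s ^ q / q.factorial * |∫ ω, S n ω ^ q ∂μ|) := by
        field_simp; rfl
    _ ≤ _ := mul_le_mul_of_nonneg_left h3 (by positivity)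


/-! ### From cumulants to a Gaussian approximation of moments -/

/-- Integration by parts against the density, whose derivative is `-x` times itself. With the
moments of order `0` and `1`, this recursion is all that the comparison with cumulants uses about
the Gaussian law. -/
theorem gaussian_moment_add_two (p : ℕ) :
    ∫ x, x ^ (p + 2) ∂(gaussianReal 0 1) = (p + 1) * ∫ x, x ^ p ∂(gaussianReal 0 1) := by
  have hpdf : ∀ f : ℝ → ℝ, ∫ x, f x ∂(gaussianReal 0 1) = ∫ x, gaussianPDFReal 0 1 x * f x := by
    intro f
    rw [integral_gaussianReal_eq_integral_smul one_ne_zero]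
    rfl
  have hint : ∀ k : ℕ, Integrable fun x : ℝ => gaussianPDFReal 0 1 x * x ^ k := by
    intro k
    have h1 : Integrable (fun x : ℝ => x ^ k) (gaussianReal 0 1) := by
      have := (memLp_id_gaussianReal (μ := 0) (v := 1) k).integrable_norm_pow' 
      exact (integrable_norm_iff (by fun_prop)).1 (by simpa using this)
    rw [gaussianReal_of_var_ne_zero _ one_ne_zero] at h1
    have h2 := (integrable_withDensity_iff_integrable_smul' (measurable_gaussianPDF 0 1)
      (ae_of_all _ fun _ => gaussianPDF_lt_top)).1 h1
    simpa [gaussianPDF, ENNReal.toReal_ofReal (gaussianPDFReal_nonneg _ _ _)] using h2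
  have hderiv : ∀ x : ℝ, HasDerivAt (gaussianPDFReal 0 1) (-x * gaussianPDFReal 0 1 x) x := by
    intro x
    simp only [gaussianPDFReal_def]
    have h1 : HasDerivAt (fun x : ℝ => -(x - 0) ^ 2 / (2 * ((1 : NNReal) : ℝ))) (-x) x := by
      have := (((hasDerivAt_id x).sub_const 0).pow 2).neg.div_const (2 * ((1 : NNReal) : ℝ))
      refine this.congr_deriv ?_
      simp
      ring
    refine (h1.exp.const_mul _).congr_deriv ?_
    ring
  rw [hpdf, hpdf]
  have h := integral_mul_deriv_eq_deriv_mul_of_integrable (u := fun x : ℝ => x ^ (p + 1))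
    (u' := fun x => ((p + 1 : ℕ) : ℝ) * x ^ p) (v := gaussianPDFReal 0 1)
    (v' := fun x => -x * gaussianPDFReal 0 1 x) (fun x _ => by simpa using hasDerivAt_pow (p + 1) x)
    (fun x _ => hderiv x)
    ((hint (p + 2)).neg.congr (ae_of_all _ fun x => by simp; ring))
    (((hint p).const_mul (p + 1)).congr (ae_of_all _ fun x => by simp; ring))
    ((hint (p + 1)).congr (ae_of_all _ fun x => by simp; ring))
  have e1 : ∫ x : ℝ, x ^ (p + 1) * (-x * gaussianPDFReal 0 1 x) =
      -∫ x : ℝ, gaussianPDFReal 0 1 x * x ^ (p + 2) := by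
    rw [← integral_neg]; congr 1; ext x; ring
  have e2 : ∫ x : ℝ, ((p + 1 : ℕ) : ℝ) * x ^ p * gaussianPDFReal 0 1 x =
      (p + 1) * ∫ x : ℝ, gaussianPDFReal 0 1 x * x ^ p := by
    rw [← integral_const_mul]; congr 1; ext x; push_cast; ring
  rw [e1, e2] at h
  linarith

theorem gaussian_moment_zero : ∫ x, x ^ 0 ∂(gaussianReal 0 1) = 1 := by simp

theorem gaussian_moment_one : ∫ x, x ^ 1 ∂(gaussianReal 0 1) = 0 := by
  simp

theorem gaussian_moment_nonneg (p : ℕ) : 0 ≤ ∫ x, x ^ p ∂(gaussianReal 0 1) := by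
  induction p using Nat.twoStepInduction with
  | zero => rw [gaussian_moment_zero]; exact zero_le_one
  | one => rw [gaussian_moment_one]
  | more p h _ => rw [gaussian_moment_add_two]; positivity

theorem gaussian_moment_odd (p : ℕ) : ∫ x, x ^ (2 * p + 1) ∂(gaussianReal 0 1) = 0 := by
  induction p with
  | zero => exact gaussian_moment_one
  | succ p ih => rw [show 2 * (p + 1) + 1 = 2 * p + 1 + 2 by ring, gaussian_moment_add_two, ih, mul_zero]

theorem gaussian_moment_even_le (p : ℕ) : ∫ x, x ^ (2 * p) ∂(gaussianReal 0 1) ≤ (2 * p : ℝ) ^ p := by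
  induction p with
  | zero => simp
  | succ p ih =>
    rw [show 2 * (p + 1) = 2 * p + 2 by ring, gaussian_moment_add_two, pow_succ']
    have : (2 * p : ℝ) ^ p ≤ (2 * (p + 1 : ℕ)) ^ p := by push_cast; gcongr; linarith
    refine mul_le_mul (by push_cast; linarith) (ih.trans this) (gaussian_moment_nonneg _) (by positivity)

/-! ### The scaled moment-cumulant recursion as a perturbation of the Gaussian one. -/

section Recursion

variable {M g G : ℕ → ℝ} {x θ : ℝ} {P : ℕ}

theorem pow_div_factorial_le_succ {q : ℕ} (hq : (q : ℝ) + 1 ≤ x) :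
    x ^ q / q.factorial ≤ x ^ (q + 1) / (q + 1).factorial := by
  have hx : 0 ≤ x := by linarith [Nat.cast_nonneg (α := ℝ) q]
  rw [Nat.factorial_succ, pow_succ, Nat.cast_mul, mul_comm (x ^ q), mul_div_mul_comm]
  refine le_mul_of_one_le_left (by positivity) ?_
  rw [one_le_div (by positivity)]
  push_cast; linarith

theorem pow_div_factorial_mono {q r : ℕ} (hqr : q ≤ r) (hr : (r : ℝ) ≤ x) :
    x ^ q / q.factorial ≤ x ^ r / r.factorial := by
  induction r, hqr using Nat.le_induction with
  | base => exact le_rfl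
  | succ r _ ih =>
    push_cast at hr
    exact (ih (by linarith)).trans (pow_div_factorial_le_succ hr)

theorem one_le_pow_div_factorial {r : ℕ} (hr : (r : ℝ) ≤ x) : 1 ≤ x ^ r / r.factorial := by
  have := pow_div_factorial_mono (Nat.zero_le r) hr
  simpa using this

theorem sum_range_succ_eq_of_zero (hg0 : g 0 = 0) {q : ℕ} (hq : 1 ≤ q) (f : ℕ → ℝ) :
    ∑ j ∈ Finset.range (q + 1), g j * f j = g 1 * f 1 + ∑ j ∈ Finset.Ico 2 (q + 1), g j * f j := by
  rw [Finset.range_eq_Ico, Finset.sum_eq_sum_Ico_succ_bot (by omega), hg0,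
    Finset.sum_eq_sum_Ico_succ_bot (by omega)]
  simp

/-- Here `M` and `g` play the roles of moments and cumulants divided by factorials, in a scaling
where the higher cumulants sum to `θ ≤ 1`. Since `P ≤ x`, the weights `x ^ q / q!` increase up to
`P`, so every earlier moment may be bounded by the latest weight. The total mass of `g` is at most
`(x - 1) + θ ≤ x`, which produces the next weight. -/
theorem abs_le_pow_div_factorial (hM0 : M 0 = 1)
    (hM : ∀ q < P, ((q : ℝ) + 1) * M (q + 1) = ∑ j ∈ Finset.range (q + 1), g j * M (q - j))
    (hg0 : g 0 = 0) (hg1 : |g 1| ≤ x - 1) (hθ : θ ≤ 1)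
    (h3 : ∀ q < P, ∑ j ∈ Finset.Ico 2 (q + 1), |g j| ≤ θ) (hP : (P : ℝ) ≤ x) (q : ℕ) (hq : q ≤ P) :
    |M q| ≤ x ^ q / q.factorial := by
  induction q using Nat.strong_induction_on with
  | _ q ih =>
    rcases q with _ | q
    · simp [hM0]
    have hx0 : 0 ≤ x := (Nat.cast_nonneg _).trans hP
    have hqx : (q : ℝ) ≤ x := le_trans (by exact_mod_cast (by omega : q ≤ P)) hP
    have hbound : ((q : ℝ) + 1) * |M (q + 1)| ≤ x * (x ^ q / q.factorial) := by
      rw [← abs_of_nonneg (show (0 : ℝ) ≤ q + 1 by positivity), ← abs_mul, hM q (by omega)]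
      rcases Nat.eq_zero_or_pos q with h0 | hpos
      · subst h0; simp [hg0, hx0]
      rw [sum_range_succ_eq_of_zero hg0 hpos (fun j => M (q - j))]
      have hmono : ∀ j ≤ q, |M (q - j)| ≤ x ^ q / q.factorial := fun j _ =>
        (ih (q - j) (by omega) (by omega)).trans (pow_div_factorial_mono (Nat.sub_le _ _) hqx)
      have hw : 0 ≤ x ^ q / q.factorial := by positivity
      calc _ ≤ |g 1| * |M (q - 1)| + ∑ j ∈ Finset.Ico 2 (q + 1), |g j| * |M (q - j)| := by
            refine (abs_add_le _ _).trans (add_le_add (abs_mul _ _).le ?_)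
            refine (Finset.abs_sum_le_sum_abs _ _).trans (Finset.sum_le_sum fun j _ => (abs_mul _ _).le)
        _ ≤ |g 1| * (x ^ q / q.factorial) +
            ∑ j ∈ Finset.Ico 2 (q + 1), |g j| * (x ^ q / q.factorial) := by
            refine add_le_add (mul_le_mul_of_nonneg_left (hmono 1 hpos) (abs_nonneg _))
              (Finset.sum_le_sum fun j hj => mul_le_mul_of_nonneg_left (hmono j ?_) (abs_nonneg _))
            have := (Finset.mem_Ico.1 hj).2; omega
        _ = (|g 1| + ∑ j ∈ Finset.Ico 2 (q + 1), |g j|) * (x ^ q / q.factorial) := by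
            rw [← Finset.sum_mul]; ring
        _ ≤ x * (x ^ q / q.factorial) := by
            refine mul_le_mul_of_nonneg_right ?_ hw
            have := h3 q (by omega); linarith
    rw [pow_succ, Nat.factorial_succ]
    push_cast
    rw [mul_comm (x ^ q), mul_div_mul_comm, div_mul_eq_mul_div, le_div_iff₀ (by positivity)]
    linarith

/-- The recursion links orders `q` and `q + 2` only, so it can be run on one parity class. The
predicate `Q` selects it and is used with `True` and with `Even`. The slack between `|g 1|` and `x`
absorbs the source term `E`. -/
theorem abs_sub_le_of_recursion {E : ℝ} (hE : 0 ≤ E) {d : ℕ → ℝ} (hd0 : d 0 = 0) (hd1 : d 1 = 0)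
    (hg1 : |g 1| ≤ x - 1) (hP : (P : ℝ) ≤ x) (Q : ℕ → Prop) (hQ : ∀ q, Q (q + 2) → Q q)
    (hd : ∀ q, q + 2 ≤ P → Q (q + 2) → |((q : ℝ) + 2) * d (q + 2) - g 1 * d q| ≤ E) (q : ℕ)
    (hq : q ≤ P) (hQq : Q q) : |d q| ≤ E * (x ^ q / q.factorial) := by
  induction q using Nat.twoStepInduction with
  | zero => simpa [hd0] using hE
  | one => rw [hd1, abs_zero]; have : 0 ≤ x := (Nat.cast_nonneg _).trans hP; positivity
  | more q ih _ =>
    have hx0 : 0 ≤ x := (Nat.cast_nonneg _).trans hP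
    have h1 := ih (by omega) (hQ q hQq)
    have h2 := hd q hq hQq
    have hqx : ((q + 1 : ℕ) : ℝ) ≤ x := le_trans (by exact_mod_cast (by omega : q + 1 ≤ P)) hP
    have h3 : x ^ q / q.factorial ≤ x ^ (q + 1) / (q + 1).factorial :=
      pow_div_factorial_mono (Nat.le_succ _) hqx
    have h4 : 1 ≤ x ^ (q + 1) / (q + 1).factorial := one_le_pow_div_factorial hqx
    have h5 : ((q : ℝ) + 2) * |d (q + 2)| ≤ E * (x * (x ^ (q + 1) / (q + 1).factorial)) := by
      rw [← abs_of_nonneg (show (0 : ℝ) ≤ q + 2 by positivity), ← abs_mul]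
      have : |((q : ℝ) + 2) * d (q + 2)| ≤ |g 1| * |d q| + E := by
        rw [← abs_mul]
        have := abs_sub_abs_le_abs_sub (((q : ℝ) + 2) * d (q + 2)) (g 1 * d q)
        linarith
      calc _ ≤ |g 1| * |d q| + E := this
        _ ≤ (x - 1) * (E * (x ^ (q + 1) / (q + 1).factorial)) +
            E * (x ^ (q + 1) / (q + 1).factorial) := by
          refine add_le_add (mul_le_mul hg1 (h1.trans (mul_le_mul_of_nonneg_left h3 hE))
            (abs_nonneg _) ((abs_nonneg _).trans hg1)) (le_mul_of_one_le_right hE h4)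
        _ = _ := by ring
    rw [pow_succ, Nat.factorial_succ]
    push_cast
    have h6 : (0 : ℝ) < (q + 1).factorial := by positivity
    rw [← mul_div_assoc, le_div_iff₀ (by positivity)]
    rw [← mul_div_assoc, ← mul_div_assoc, le_div_iff₀ h6] at h5
    linarith

/-- `M - G` solves the Gaussian recursion with the source `∑_{j ≥ 2} g j * M (q - j)`, which is
`O(θ)`. For even orders the term `j = 2`, that is the third cumulant, multiplies a moment of odd
order. Its Gaussian value vanishes, so it is itself `O(θ)` by the first part and the product is
`O(θ²)`, like the terms `j ≥ 3`. -/
theorem abs_sub_gaussian_le (hM0 : M 0 = 1)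
    (hM : ∀ q < P, ((q : ℝ) + 1) * M (q + 1) = ∑ j ∈ Finset.range (q + 1), g j * M (q - j))
    (hg0 : g 0 = 0) (hg1 : |g 1| ≤ x - 1) (hθ0 : 0 ≤ θ) (hθ : θ ≤ 1)
    (h3 : ∀ q < P, ∑ j ∈ Finset.Ico 2 (q + 1), |g j| ≤ θ)
    (h4 : ∀ q < P, ∑ j ∈ Finset.Ico 3 (q + 1), |g j| ≤ θ ^ 2) (hP : (P : ℝ) ≤ x)
    (hG0 : G 0 = 1) (hG1 : G 1 = 0) (hG : ∀ q : ℕ, ((q : ℝ) + 2) * G (q + 2) = g 1 * G q)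
    (hP1 : 1 ≤ P) :
    |M P - G P| ≤ θ * Real.exp (2 * x) ∧ (Even P → |M P - G P| ≤ 2 * θ ^ 2 * Real.exp (3 * x)) := by
  have hx0 : 0 ≤ x := (Nat.cast_nonneg _).trans hP
  have hW : ∀ q : ℕ, x ^ q / q.factorial ≤ Real.exp x := Real.pow_div_factorial_le_exp x hx0
  have hW1 : 1 ≤ Real.exp x := Real.one_le_exp hx0
  have hMb : ∀ q ≤ P, |M q| ≤ Real.exp x := fun q hq =>
    (abs_le_pow_div_factorial hM0 hM hg0 hg1 hθ h3 hP q hq).trans (hW q)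
  have hM1 : M 1 = 0 := by
    have := hM 0 (by omega)
    simpa [hg0] using this
  have hrec : ∀ q, q + 2 ≤ P → ((q : ℝ) + 2) * (M (q + 2) - G (q + 2)) - g 1 * (M q - G q) =
      ∑ j ∈ Finset.Ico 2 (q + 2), g j * M (q + 1 - j) := by
    intro q hq
    have h := hM (q + 1) (by omega)
    rw [sum_range_succ_eq_of_zero hg0 (by omega) (fun j => M (q + 1 - j)), Nat.add_sub_cancel] at h
    push_cast at h
    have h' := hG q
    linear_combination h - h'
  have hall : ∀ q ≤ P, |M q - G q| ≤ θ * Real.exp x * (x ^ q / q.factorial) := by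
    intro q hq
    refine abs_sub_le_of_recursion (d := fun q => M q - G q) (by positivity) (by simp [hM0, hG0])
      (by simp [hM1, hG1]) hg1 hP (fun _ => True) (fun _ _ => trivial) ?_ q hq trivial
    intro q hq _
    rw [hrec q hq]
    calc _ ≤ ∑ j ∈ Finset.Ico 2 (q + 2), |g j| * Real.exp x := by
          refine (Finset.abs_sum_le_sum_abs _ _).trans (Finset.sum_le_sum fun j _ => ?_)
          rw [abs_mul]
          exact mul_le_mul_of_nonneg_left (hMb _ (by omega)) (abs_nonneg _)
      _ ≤ _ := by
          rw [← Finset.sum_mul]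
          exact mul_le_mul_of_nonneg_right (h3 (q + 1) (by omega)) (by positivity)
  have hGodd : ∀ k, G (2 * k + 1) = 0 := by
    intro k
    induction k with
    | zero => exact hG1
    | succ k ih =>
      have := hG (2 * k + 1)
      rw [ih, mul_zero] at this
      exact (mul_eq_zero.1 this).resolve_left (by positivity)
  constructor
  · refine (hall P le_rfl).trans ?_
    rw [two_mul, Real.exp_add, ← mul_assoc]
    exact mul_le_mul_of_nonneg_left (hW P) (by positivity)
  · intro hev
    have hθθ : 0 ≤ 2 * θ ^ 2 * (Real.exp x * Real.exp x) := by positivity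
    have := abs_sub_le_of_recursion (E := 2 * θ ^ 2 * (Real.exp x * Real.exp x))
      (d := fun q => M q - G q) hθθ (by simp [hM0, hG0])
      (by simp [hM1, hG1]) hg1 hP Even (fun q hq => by simpa [Nat.even_add] using hq) ?_ P le_rfl hev
    · refine this.trans ?_
      rw [show 3 * x = x + x + x by ring, Real.exp_add, Real.exp_add]
      exact (mul_le_mul_of_nonneg_left (hW P) hθθ).trans (le_of_eq (by ring))
    intro q hq heven
    rw [hrec q hq]
    rcases Nat.eq_zero_or_pos q with h0 | hpos
    · subst h0; simpa using hθθ
    have heven' : Even q := by simpa [Nat.even_add] using heven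
    rw [Finset.sum_eq_sum_Ico_succ_bot (by omega)]
    have hg2 : |g 2| ≤ θ := by
      refine le_trans ?_ (h3 (q + 1) (by omega))
      exact Finset.single_le_sum (f := fun j => |g j|) (fun j _ => abs_nonneg _)
        (Finset.mem_Ico.2 ⟨le_rfl, by omega⟩)
    have hMo : |M (q + 1 - 2)| ≤ θ * (Real.exp x * Real.exp x) := by
      obtain ⟨k, hk⟩ := heven'
      obtain ⟨l, rfl⟩ : ∃ l, k = l + 1 := ⟨k - 1, by omega⟩
      have e : q + 1 - 2 = 2 * l + 1 := by omega
      have := hall (2 * l + 1) (by omega)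
      rw [hGodd, sub_zero] at this
      rw [e, ← mul_assoc]
      exact this.trans (mul_le_mul_of_nonneg_left (hW _) (by positivity))
    calc _ ≤ |g 2| * |M (q + 1 - 2)| + ∑ j ∈ Finset.Ico 3 (q + 2), |g j| * Real.exp x := by
          refine (abs_add_le _ _).trans (add_le_add (abs_mul _ _).le ?_)
          refine (Finset.abs_sum_le_sum_abs _ _).trans (Finset.sum_le_sum fun j _ => ?_)
          rw [abs_mul]
          exact mul_le_mul_of_nonneg_left (hMb _ (by omega)) (abs_nonneg _)
      _ ≤ θ * (θ * (Real.exp x * Real.exp x)) + θ ^ 2 * (Real.exp x * Real.exp x) := by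
          rw [← Finset.sum_mul]
          refine add_le_add (mul_le_mul hg2 hMo (abs_nonneg _) hθ0) ?_
          refine mul_le_mul (h4 (q + 1) (by omega)) (le_mul_of_one_le_left (by positivity) hW1)
            (by positivity) (by positivity)
      _ = _ := by ring

end Recursion

theorem sum_Ico_pow_le {y : ℝ} (hy0 : 0 ≤ y) (hy : y ≤ 1 / 2) (a b : ℕ) :
    ∑ j ∈ Finset.Ico a b, y ^ j ≤ 2 * y ^ a := by
  refine (geom_sum_Ico_le_of_lt_one hy0 (by linarith)).trans ?_
  rw [div_le_iff₀ (by linarith)]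
  nlinarith [pow_nonneg hy0 a]

/-- If the cumulants of order at most `P` are `O(n)`, then the `P`-th moment is close to the
Gaussian one as soon as `n` is large. -/
theorem abs_moment_sub_gaussian_le {m G : ℕ → ℝ} {P n : ℕ} {c C₂ : ℝ} (hm0 : m 0 = 1) (hm1 : m 1 = 0)
    (hc : 1 ≤ c) (hC₂ : 1 ≤ C₂) (hP : 3 ≤ P) (hV0 : 0 ≤ m 2) (hV : m 2 ≤ C₂ * n)
    (hΓ : ∀ j < P, |momentCumulant m j| ≤ n * c ^ (j + 1)) (hn : 4 * c ^ 6 * P ^ 3 ≤ n)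
    (hG0 : G 0 = 1) (hG1 : G 1 = 0) (hG : ∀ q : ℕ, G (q + 2) = (q + 1) * (m 2 * G q)) :
    |m P - G P| * (P : ℝ) ^ ((P - 1) / 2) ≤
      8 * P.factorial * c ^ 6 * P ^ 3 * Real.exp (3 * (C₂ * P + 1)) * (n : ℝ) ^ ((P - 1) / 2) := by
  have hPr : (3 : ℝ) ≤ P := by exact_mod_cast hP
  have hc6 : 1 ≤ c ^ 6 := one_le_pow₀ hc
  have hn0 : (0 : ℝ) < n := lt_of_lt_of_le (by positivity) hn
  -- At this scale the second cumulant becomes at most `C₂ P`, comparable to the order `P`. The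
  -- others satisfy `|g j| ≤ n y ^ (j + 1)` with `y = c s`.
  set s := Real.sqrt (P / n) with hs
  have hs2 : s ^ 2 = P / n := Real.sq_sqrt (by positivity)
  have hs0 : 0 < s := Real.sqrt_pos.2 (by positivity)
  set y := c * s with hy
  have hy0 : 0 < y := by positivity
  have hy2 : n * y ^ 2 = c ^ 2 * P := by rw [hy, mul_pow, hs2]; field_simp
  have hyhalf : y ≤ 1 / 2 := by
    refine abs_le_of_sq_le_sq' ?_ (by norm_num) |>.2
    have h1 : c ^ 2 ≤ c ^ 6 := pow_le_pow_right₀ hc (by norm_num)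
    have h2 : (P : ℝ) ≤ P ^ 3 := le_self_pow₀ (by linarith) (by norm_num)
    have h3 : c ^ 2 * P ≤ c ^ 6 * P ^ 3 := mul_le_mul h1 h2 (by positivity) (by positivity)
    have h4 : n * (4 * y ^ 2) ≤ n * 1 := by nlinarith
    have := le_of_mul_le_mul_left h4 hn0
    linarith
  -- This bounds the geometric tail from `j = 2` on, as `y ≤ 1/2`. For fixed `P` it is of order `n ^
  -- (-1/2)`. Multiplying `θ` (odd `P`) or `θ²` (even `P`) by `s ^ (-P)` gives in both cases the
  -- power `(P - 1) / 2` of `n`, with the integer division of the statement.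
  set θ := 2 * n * y ^ 3 with hθ
  have hθ0 : 0 ≤ θ := by positivity
  have hθsq : θ ^ 2 = 4 * c ^ 6 * P ^ 3 / n := by
    rw [hθ, hy, show (2 * n * (c * s) ^ 3) ^ 2 = 4 * n ^ 2 * c ^ 6 * (s ^ 2) ^ 3 by ring, hs2]
    field_simp
  have hθ1 : θ ≤ 1 := by
    refine abs_le_of_sq_le_sq' ?_ (by norm_num) |>.2
    rw [hθsq, one_pow, div_le_one hn0]; exact hn
  have hθ2 : 2 * n * y ^ 4 ≤ θ ^ 2 := by
    have h1 : 1 ≤ c ^ 2 * P := one_le_mul_of_one_le_of_one_le (one_le_pow₀ hc) (by linarith)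
    have : θ ^ 2 = 2 * n * y ^ 4 * (2 * (n * y ^ 2)) := by rw [hθ]; ring
    rw [this, hy2]
    exact le_mul_of_one_le_right (by positivity) (by linarith)
  set x := C₂ * P + 1 with hx
  have hfac : ∀ a : ℕ, (1 : ℝ) ≤ a.factorial := fun a => by exact_mod_cast a.factorial_pos
  set M : ℕ → ℝ := fun q => m q * s ^ q / q.factorial with hMdef
  set g : ℕ → ℝ := fun j => momentCumulant m j * s ^ (j + 1) / j.factorial with hgdef
  set G' : ℕ → ℝ := fun q => G q * s ^ q / q.factorial with hGdef
  have hc0 : momentCumulant m 0 = 0 := by rw [momentCumulant_eq]; simp [hm1]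
  have hc1 : momentCumulant m 1 = m 2 := by rw [momentCumulant_eq]; simp [hm1]
  have hg : ∀ j < P, |g j| ≤ n * y * y ^ j := by
    intro j hj
    simp only [hgdef]
    rw [abs_div, abs_mul, abs_of_pos (pow_pos hs0 _), Nat.abs_cast]
    refine (div_le_self (by positivity) (hfac j)).trans ?_
    calc _ ≤ n * c ^ (j + 1) * s ^ (j + 1) := mul_le_mul_of_nonneg_right (hΓ j hj) (by positivity)
      _ = _ := by rw [hy]; ring
  have hsum : ∀ a : ℕ, ∀ q < P, ∑ j ∈ Finset.Ico a (q + 1), |g j| ≤ 2 * n * y ^ (a + 1) := by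
    intro a q hq
    calc _ ≤ ∑ j ∈ Finset.Ico a (q + 1), n * y * y ^ j :=
          Finset.sum_le_sum fun j hj => hg j (by have := (Finset.mem_Ico.1 hj).2; omega)
      _ ≤ n * y * (2 * y ^ a) := by
          rw [← Finset.mul_sum]
          exact mul_le_mul_of_nonneg_left (sum_Ico_pow_le hy0.le hyhalf _ _) (by positivity)
      _ = _ := by ring
  have hG1' : G' 1 = 0 := by simp [hGdef, hG1]
  have hrecM : ∀ q < P, ((q : ℝ) + 1) * M (q + 1) = ∑ j ∈ Finset.range (q + 1), g j * M (q - j) := by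
    intro q _
    simp only [hMdef, hgdef]
    rw [moment_succ_eq m hm0 q, Nat.factorial_succ, Finset.sum_mul, Finset.sum_div, Finset.mul_sum]
    refine Finset.sum_congr rfl fun j hj => ?_
    have hjq : j ≤ q := by simp at hj; omega
    rw [Nat.cast_choose ℝ hjq]
    have h1 := hfac q
    have h2 := hfac j
    have h3 := hfac (q - j)
    have : s ^ (q + 1) = s ^ (j + 1) * s ^ (q - j) := by rw [← pow_add]; congr 1; omega
    rw [this]
    push_cast
    field_simp
  have hgg1 : |g 1| ≤ x - 1 := by
    simp only [hgdef]
    rw [hc1, show 1 + 1 = 2 from rfl, hs2]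
    simp only [Nat.factorial_one, Nat.cast_one, div_one]
    rw [abs_of_nonneg (by positivity), hx, add_sub_cancel_right, ← mul_div_assoc, div_le_iff₀ hn0]
    nlinarith
  have key := abs_sub_gaussian_le (M := M) (g := g) (G := G') (x := x) (θ := θ) (P := P)
    (by simp [hMdef, hm0]) hrecM (by simp [hgdef, hc0]) hgg1 hθ0 hθ1 (hsum 2)
    (fun q hq => (hsum 3 q hq).trans hθ2) (by
      rw [hx]; nlinarith) (by simp [hGdef, hG0]) hG1'
    (fun q => by
      simp only [hGdef, hgdef]
      rw [hG, hc1, Nat.factorial_succ, Nat.factorial_succ]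
      have h1 := hfac q
      push_cast
      field_simp
      ring) (by omega)
  have hdiff : |m P - G P| = P.factorial / s ^ P * |M P - G' P| := by
    have h1 := hfac P
    have h2 : 0 < s ^ P := by positivity
    rw [← abs_of_pos (show 0 < (P.factorial : ℝ) / s ^ P by positivity), ← abs_mul]
    congr 1
    simp only [hMdef, hGdef]
    field_simp
  have hx0 : 0 ≤ x := by positivity
  have hexp : Real.exp (2 * x) ≤ Real.exp (3 * x) := Real.exp_le_exp.2 (by linarith)
  rw [hdiff]
  rcases Nat.even_or_odd P with hev | ⟨u, hu⟩
  · obtain ⟨k, hk⟩ := id hev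
    obtain ⟨u, rfl⟩ : ∃ u, k = u + 1 := ⟨k - 1, by omega⟩
    have hu : P = 2 * (u + 1) := by omega
    have hu' : (P - 1) / 2 = u := by omega
    have hsP : s ^ P = (P : ℝ) ^ (u + 1) / (n : ℝ) ^ (u + 1) := by
      rw [← div_pow, ← hs2, ← pow_mul, ← hu]
    rw [hu']
    calc _ ≤ P.factorial / s ^ P * (2 * θ ^ 2 * Real.exp (3 * x)) * (P : ℝ) ^ u := by
          gcongr; exact key.2 hev
      _ = 8 * P.factorial * c ^ 6 * P ^ 2 * Real.exp (3 * x) * (n : ℝ) ^ u := by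
          rw [hsP, hθsq]; field_simp; ring
      _ ≤ _ := by
          gcongr
          · linarith
          · norm_num
  · obtain ⟨w, rfl⟩ : ∃ w, u = w + 1 := ⟨u - 1, by omega⟩
    have hu' : (P - 1) / 2 = w + 1 := by omega
    have hsP : s ^ P = s ^ 3 * ((P : ℝ) ^ w / (n : ℝ) ^ w) := by
      rw [← div_pow, ← hs2, ← pow_mul, ← pow_add]; congr 1; omega
    rw [hu']
    calc _ ≤ P.factorial / s ^ P * (θ * Real.exp (2 * x)) * (P : ℝ) ^ (w + 1) := by
          gcongr; exact key.1
      _ = 2 * P.factorial * c ^ 3 * P * Real.exp (2 * x) * (n : ℝ) ^ (w + 1) := by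
          rw [hsP, hθ, hy]; field_simp; try ring
      _ ≤ _ := by
          gcongr
          · norm_num
          · norm_num
          · exact le_self_pow₀ (by linarith) (by norm_num)


/-! ### Random compositions -/

theorem shift_shift {𝒴 : Type*} (a b : ℤ) (ω : ℤ → 𝒴) : shift a (shift b ω) = shift (a + b) ω := by
  ext k; simp only [shift]; congr 1; ring

@[simp] theorem shift_zero {𝒴 : Type*} (ω : ℤ → 𝒴) : shift 0 ω = ω := by
  ext k; simp [shift]

theorem shift_natCast_add {𝒴 : Type*} (a b : ℕ) (ω : ℤ → 𝒴) :
    shift (b : ℤ) (shift (a : ℤ) ω) = shift ((a + b : ℕ) : ℤ) ω := by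
  rw [shift_shift]; congr 1; push_cast; ring

theorem iter_add {𝒴 β : Type*} (A : (ℤ → 𝒴) → β → β) (a b : ℕ) (ω : ℤ → 𝒴) :
    iter A (a + b) ω = iter A b (shift a ω) ∘ iter A a ω := by
  induction a generalizing ω with
  | zero => simp [iter]
  | succ a ih =>
    rw [show a + 1 + b = a + b + 1 by ring, iter, iter, ih, shift_shift]
    push_cast
    rfl

theorem iter_succ_eq {𝒴 β : Type*} (A : (ℤ → 𝒴) → β → β) (n : ℕ) (ω : ℤ → 𝒴) :
    iter A (n + 1) ω = A (shift n ω) ∘ iter A n ω := by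
  rw [iter_add]; rfl

section Maps

variable {𝒴 X : Type*} (T : 𝒴 → X → X)

/-- The composition `T_{ω_{n-1}} ∘ ⋯ ∘ T_{ω_0}` along the fibre of `ω`. -/
def fiberMap (n : ℕ) (ω : ℤ → 𝒴) : X → X := iter (fun ω' => T (ω' 0)) n ω

@[simp] theorem fiberMap_zero (ω : ℤ → 𝒴) : fiberMap T 0 ω = id := rfl

theorem fiberMap_one (ω : ℤ → 𝒴) : fiberMap T 1 ω = T (ω 0) := rfl

theorem fiberMap_add (a b : ℕ) (ω : ℤ → 𝒴) (x : X) :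
    fiberMap T (a + b) ω x = fiberMap T b (shift a ω) (fiberMap T a ω x) := by
  simp [fiberMap, iter_add]

theorem skew_iterate (n : ℕ) (ω : ℤ → 𝒴) (x : X) :
    (skew T)^[n] (ω, x) = (shift n ω, fiberMap T n ω x) := by
  induction n with
  | zero => simp
  | succ n ih =>
    rw [Function.iterate_succ_apply', ih, fiberMap_add]
    simp only [skew, shift_shift, fiberMap_one]
    push_cast
    rw [add_comm]

theorem seqComp_eq_fiberMap (n : ℕ) (ω : ℤ → 𝒴) :
    seqComp (fun i => T (ω i)) n = fiberMap T n ω := by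
  induction n generalizing ω with
  | zero => rfl
  | succ n ih =>
    have h := ih (shift 1 ω)
    have e : (fun i : ℕ => T (shift 1 ω i)) = fun i : ℕ => T (ω ((i + 1 : ℕ) : ℤ)) := by
      ext i; simp [shift]
    rw [e] at h
    ext x
    rw [seqComp, h, add_comm n 1, fiberMap_add, fiberMap_one]
    simp

/-- The value of the observable at time `n` along the orbit of `(ω, x)`. -/
def obs (φ : 𝒴 → X → ℝ) (n : ℕ) (ω : ℤ → 𝒴) (x : X) : ℝ := φ (ω n) (fiberMap T n ω x)

theorem obs_add (φ : 𝒴 → X → ℝ) (a b : ℕ) (ω : ℤ → 𝒴) (x : X) :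
    obs T φ (a + b) ω x = obs T φ b (shift a ω) (fiberMap T a ω x) := by
  simp only [obs, fiberMap_add, shift]
  congr 2
  push_cast; ring

theorem birkhoff_eq (φ : 𝒴 → X → ℝ) (n : ℕ) (ω : ℤ → 𝒴) (x : X) :
    birkhoff T φ n (ω, x) = ∑ j ∈ Finset.range n, obs T φ j ω x := by
  unfold birkhoff
  refine Finset.sum_congr rfl fun j _ => ?_
  rw [skew_iterate]
  simp [obs, shift]

variable [MeasurableSpace 𝒴] [MeasurableSpace X] {T}

theorem measurable_fiberMap_uncurry (hT : Measurable (skew T)) (n : ℕ) :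
    Measurable fun z : (ℤ → 𝒴) × X => fiberMap T n z.1 z.2 := by
  have : (fun z : (ℤ → 𝒴) × X => fiberMap T n z.1 z.2) = fun z => ((skew T)^[n] z).2 := by
    ext ⟨ω, x⟩; rw [skew_iterate]
  rw [this]
  exact measurable_snd.comp (hT.iterate n)

theorem measurable_fiberMap (hT : Measurable (skew T)) (n : ℕ) (ω : ℤ → 𝒴) :
    Measurable (fiberMap T n ω) :=
  (measurable_fiberMap_uncurry hT n).comp measurable_prodMk_left

theorem measurable_shift (n : ℤ) : Measurable (shift n : (ℤ → 𝒴) → ℤ → 𝒴) :=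
  measurable_pi_iff.2 fun _ => measurable_pi_apply _

theorem measurable_obs_uncurry (hT : Measurable (skew T)) {φ : 𝒴 → X → ℝ}
    (hφ : Measurable (Function.uncurry φ)) (n : ℕ) :
    Measurable fun z : (ℤ → 𝒴) × X => obs T φ n z.1 z.2 :=
  hφ.comp (((measurable_pi_apply (n : ℤ)).comp measurable_fst).prodMk
    (measurable_fiberMap_uncurry hT n))

theorem measurable_obs (hT : Measurable (skew T)) {φ : 𝒴 → X → ℝ}
    (hφ : Measurable (Function.uncurry φ)) (n : ℕ) (ω : ℤ → 𝒴) : Measurable (obs T φ n ω) :=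
  (measurable_obs_uncurry hT hφ n).comp measurable_prodMk_left

end Maps

/-! ### The `BV` norm -/

section BV

variable {X : Type*} [MeasurableSpace X] {m : Measure X} {v : (X → ℂ) → ℝ≥0∞} {C : ℝ}

theorem IsVariation.mono (hv : IsVariation m v C) {C' : ℝ} (h : C ≤ C') : IsVariation m v C' where
  smul := hv.smul
  add_le := hv.add_le
  mul_le := hv.mul_le
  const := hv.const
  sup_le f hf := (hv.sup_le f hf).trans (by gcongr)

theorem IsVariation.enorm_le (hv : IsVariation m v C) {f : X → ℂ} (hf : Measurable f) (x : X) :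
    ‖f x‖ₑ ≤ ENNReal.ofReal C * bvNorm m v f :=
  (le_iSup (fun x => ‖f x‖ₑ) x).trans (hv.sup_le f hf)

theorem IsVariation.norm_le (hv : IsVariation m v C) (hC : 0 ≤ C) {f : X → ℂ} (hf : Measurable f)
    {a : ℝ} (ha : 0 ≤ a) (h : bvNorm m v f ≤ ENNReal.ofReal a) (x : X) : ‖f x‖ ≤ C * a := by
  have h1 : ‖f x‖ₑ ≤ ENNReal.ofReal (C * a) := by
    rw [ENNReal.ofReal_mul hC]
    exact (hv.enorm_le hf x).trans (by gcongr)
  rw [← ofReal_norm] at h1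
  exact (ENNReal.ofReal_le_ofReal_iff (by positivity)).1 h1

theorem IsVariation.bvNorm_add_le (hv : IsVariation m v C) {f g : X → ℂ} (hf : Measurable f)
    (hg : Measurable g) : bvNorm m v (fun x => f x + g x) ≤ bvNorm m v f + bvNorm m v g := by
  unfold bvNorm
  have h1 : eLpNorm (fun x => f x + g x) 1 m ≤ eLpNorm f 1 m + eLpNorm g 1 m :=
    eLpNorm_add_le hf.aestronglyMeasurable hg.aestronglyMeasurable le_rfl
  calc _ ≤ (eLpNorm f 1 m + eLpNorm g 1 m) + (v f + v g) := add_le_add h1 (hv.add_le f g hf hg)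
    _ = _ := by ring

theorem IsVariation.bvNorm_const [IsProbabilityMeasure m] (hv : IsVariation m v C) (c : ℂ) :
    bvNorm m v (fun _ => c) = ‖c‖ₑ := by
  unfold bvNorm
  rw [hv.const, eLpNorm_const c one_ne_zero (IsProbabilityMeasure.ne_zero m)]
  simp

theorem eLpNorm_mul_le_supNorm (f g : X → ℂ) (hg : Measurable g) :
    eLpNorm (fun x => f x * g x) 1 m ≤ supNorm f * eLpNorm g 1 m := by
  rw [eLpNorm_one_eq_lintegral_enorm, eLpNorm_one_eq_lintegral_enorm,
    ← lintegral_const_mul _ hg.enorm]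
  refine lintegral_mono fun x => ?_
  rw [enorm_mul]
  exact mul_le_mul_left (le_iSup (fun x => ‖f x‖ₑ) x) _

/-- One term from the `L¹` norm and two from the Leibniz rule, each with a supremum bounded by `C`
times a `BV` norm. -/
theorem IsVariation.bvNorm_mul_le (hv : IsVariation m v C) {f g : X → ℂ} (hf : Measurable f)
    (hg : Measurable g) : bvNorm m v (fun x => f x * g x) ≤
      3 * ENNReal.ofReal C * bvNorm m v f * bvNorm m v g := by
  have h1 := hv.sup_le f hf
  have h2 := hv.sup_le g hg
  have hv1 : v f ≤ bvNorm m v f := le_add_self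
  have hv2 : v g ≤ bvNorm m v g := le_add_self
  have he : eLpNorm g 1 m ≤ bvNorm m v g := le_self_add
  calc bvNorm m v (fun x => f x * g x) ≤
        supNorm f * eLpNorm g 1 m + (supNorm f * v g + supNorm g * v f) :=
        add_le_add (eLpNorm_mul_le_supNorm f g hg) (hv.mul_le f g hf hg)
    _ ≤ (ENNReal.ofReal C * bvNorm m v f) * bvNorm m v g +
        ((ENNReal.ofReal C * bvNorm m v f) * bvNorm m v g +
          (ENNReal.ofReal C * bvNorm m v g) * bvNorm m v f) := by gcongr
    _ = _ := by ring

end BV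

/-! ### Fibrewise assumptions -/

section Fiber

variable {𝒴 X : Type*} [MeasurableSpace 𝒴] [MeasurableSpace X]

/-- The measure `μ_ω = h_ω dm` on the fibre over `ω`. -/
def fiberMeasure (m : Measure X) (h : (ℤ → 𝒴) → X → ℝ) (ω : ℤ → 𝒴) : Measure X :=
  m.withDensity fun x => ENNReal.ofReal (h ω x)

/-- The assumptions which do not refer to a particular `ω`, with all constants normalized. -/
structure System (m : Measure X) (v : (X → ℂ) → ℝ≥0∞) (T : 𝒴 → X → X)
    (L : 𝒴 → (X → ℂ) → (X → ℂ)) (h : (ℤ → 𝒴) → X → ℝ) (K : (ℤ → 𝒴) → ℝ) (φ : 𝒴 → X → ℝ)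
    (C M lam : ℝ) : Prop where
  var : IsVariation m v C
  one_le_C : 1 ≤ C
  one_le_M : 1 ≤ M
  lam_pos : 0 < lam
  skew_measurable : Measurable (skew T)
  transfer : ∀ y, IsTransferOperator m (T y) (L y)
  h_measurable : Measurable (Function.uncurry h)
  h_nonneg : ∀ ω x, 0 ≤ h ω x
  one_le_K : ∀ ω, 1 ≤ K ω
  φ_measurable : Measurable (Function.uncurry φ)

/-- The assumptions at a single `ω`. -/
structure FiberAt (m : Measure X) (v : (X → ℂ) → ℝ≥0∞)
    (L : 𝒴 → (X → ℂ) → (X → ℂ)) (h : (ℤ → 𝒴) → X → ℝ) (K : (ℤ → 𝒴) → ℝ) (φ : 𝒴 → X → ℝ)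
    (M lam : ℝ) (ω : ℤ → 𝒴) : Prop where
  integral_h : ∫ x, h ω x ∂m = 1
  h_pos : ∀ᵐ x ∂m, 0 < h ω x
  equivariant : L (ω 0) (fun x => (h ω x : ℂ)) =ᵐ[m] fun x => (h (shift 1 ω) x : ℂ)
  slow : ∀ n : ℕ, K ω ≤ K (shift n ω) * Real.exp (lam / 3 * n)
  decay_one : ∀ n : ℕ, 1 ≤ n →
    bvNorm m v (fun x => iter (fun ω' => L (ω' 0)) n ω (fun _ => 1) x - (h (shift n ω) x : ℂ))
      ≤ ENNReal.ofReal (K ω * Real.exp (-lam * n))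
  decay : ∀ n : ℕ, 1 ≤ n → ∀ g : X → ℂ, Measurable g →
    bvNorm m v (fun x => iter (normalizedOp L h) n ω g x - ∫ y, g y * (h ω y : ℂ) ∂m)
      ≤ ENNReal.ofReal (K ω * Real.exp (-lam * n)) * bvNorm m v g
  φ_le : ENNReal.ofReal (K ω) * bvNorm m v (fun x => (φ (ω 0) x : ℂ)) ≤ ENNReal.ofReal M

/-- The fibrewise assumptions hold along the forward orbit of `ω`. -/
def IsGood (m : Measure X) (v : (X → ℂ) → ℝ≥0∞)
    (L : 𝒴 → (X → ℂ) → (X → ℂ)) (h : (ℤ → 𝒴) → X → ℝ) (K : (ℤ → 𝒴) → ℝ) (φ : 𝒴 → X → ℝ)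
    (M lam : ℝ) (ω : ℤ → 𝒴) : Prop :=
  ∀ k : ℕ, FiberAt m v L h K φ M lam (shift k ω)

variable {m : Measure X} {v : (X → ℂ) → ℝ≥0∞} {T : 𝒴 → X → X}
  {L : 𝒴 → (X → ℂ) → (X → ℂ)} {h : (ℤ → 𝒴) → X → ℝ} {K : (ℤ → 𝒴) → ℝ} {φ : 𝒴 → X → ℝ}
  {C M lam : ℝ} {ω : ℤ → 𝒴}

omit [MeasurableSpace 𝒴] in
theorem IsGood.shift (hω : IsGood m v L h K φ M lam ω) (n : ℕ) :
    IsGood m v L h K φ M lam (shift n ω) := fun k => by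
  rw [shift_natCast_add]; exact hω _

omit [MeasurableSpace 𝒴] in
theorem IsGood.fiberAt (hω : IsGood m v L h K φ M lam ω) : FiberAt m v L h K φ M lam ω := by
  simpa using hω 0

namespace System

variable (S : System m v T L h K φ C M lam)
include S

theorem measurable_h (ω : ℤ → 𝒴) : Measurable (h ω) := S.h_measurable.comp measurable_prodMk_left

theorem measurable_φ (y : 𝒴) : Measurable (φ y) := S.φ_measurable.comp measurable_prodMk_left

theorem integrable_fiber_iff (ω : ℤ → 𝒴) (g : X → ℂ) :
    Integrable g (fiberMeasure m h ω) ↔ Integrable (fun x => g x * (h ω x : ℂ)) m := by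
  unfold fiberMeasure
  rw [integrable_withDensity_iff_integrable_smul' (S.measurable_h ω).ennreal_ofReal
    (ae_of_all _ fun _ => ENNReal.ofReal_lt_top)]
  refine integrable_congr (ae_of_all _ fun x => ?_)
  simp only [ENNReal.toReal_ofReal (S.h_nonneg ω x), Complex.real_smul]
  ring

theorem integral_fiber (ω : ℤ → 𝒴) (g : X → ℂ) :
    ∫ x, g x ∂(fiberMeasure m h ω) = ∫ x, g x * (h ω x : ℂ) ∂m := by
  unfold fiberMeasure
  rw [integral_withDensity_eq_integral_toReal_smul (S.measurable_h ω).ennreal_ofReal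
    (ae_of_all _ fun _ => ENNReal.ofReal_lt_top)]
  refine integral_congr_ae (ae_of_all _ fun x => ?_)
  simp only [ENNReal.toReal_ofReal (S.h_nonneg ω x), Complex.real_smul]
  ring

theorem isProbabilityMeasure_fiber (hω : FiberAt m v L h K φ M lam ω) :
    IsProbabilityMeasure (fiberMeasure m h ω) := by
  have hint : Integrable (h ω) m := by
    by_contra hc
    have := hω.integral_h
    rw [integral_undef hc] at this
    norm_num at this
  constructor
  unfold fiberMeasure
  rw [withDensity_apply _ MeasurableSet.univ, Measure.restrict_univ,
    ← ofReal_integral_eq_lintegral_ofReal hint (ae_of_all _ (S.h_nonneg ω)), hω.integral_h]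
  simp

/-- This is the transfer duality for `g * h ω`. Division by the next density is harmless because
that density is positive almost everywhere. So the normalized operator is dual to composition with
`T (ω 0)` between consecutive fibre measures. -/
theorem normalizedOp_dual (hω : IsGood m v L h K φ M lam ω) {g : X → ℂ} (hg : Measurable g)
    (hgi : Integrable g (fiberMeasure m h ω)) :
    Measurable (normalizedOp L h ω g) ∧
      Integrable (normalizedOp L h ω g) (fiberMeasure m h (RandomSkew.shift 1 ω)) ∧
      ∀ f : X → ℂ, Measurable f → (∃ c, ∀ x, ‖f x‖ ≤ c) →
        ∫ x, g x * f (T (ω 0) x) ∂(fiberMeasure m h ω) =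
          ∫ x, normalizedOp L h ω g x * f x ∂(fiberMeasure m h (RandomSkew.shift 1 ω)) := by
  have hhm : ∀ ω, Measurable fun x => (h ω x : ℂ) := fun ω =>
    Complex.measurable_ofReal.comp (S.measurable_h ω)
  obtain ⟨h1, h2, h3⟩ := S.transfer (ω 0) _ (hg.mul (hhm ω))
    ((S.integrable_fiber_iff ω g).1 hgi)
  have hpos := (hω 1).h_pos
  have hae : (fun x => normalizedOp L h ω g x * (h (RandomSkew.shift 1 ω) x : ℂ)) =ᵐ[m]
      L (ω 0) fun y => g y * (h ω y : ℂ) := by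
    filter_upwards [hpos] with x hx
    have : (h (RandomSkew.shift 1 ω) x : ℂ) ≠ 0 := by
      simpa using hx.ne'
    simp only [normalizedOp]
    field_simp
  refine ⟨h1.div (hhm _), (S.integrable_fiber_iff _ _).2 (h2.congr hae.symm), ?_⟩
  rintro f hf ⟨c, hc⟩
  rw [S.integral_fiber, S.integral_fiber]
  have h4 := h3 f (memLp_top_of_bound hf.aestronglyMeasurable c (ae_of_all _ hc))
  calc _ = ∫ x, g x * (h ω x : ℂ) * f (T (ω 0) x) ∂m := by congr 1; ext x; ring
    _ = _ := h4
    _ = _ := by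
      refine integral_congr_ae ?_
      filter_upwards [hae] with x hx
      change L (ω 0) (fun y => g y * (h ω y : ℂ)) x * f x = _
      rw [← hx]; ring

theorem iter_normalizedOp_dual (hω : IsGood m v L h K φ M lam ω) {g : X → ℂ} (hg : Measurable g)
    (hgi : Integrable g (fiberMeasure m h ω)) (n : ℕ) :
    Measurable (iter (normalizedOp L h) n ω g) ∧
      Integrable (iter (normalizedOp L h) n ω g) (fiberMeasure m h (RandomSkew.shift n ω)) ∧
      ∀ f : X → ℂ, Measurable f → (∃ c, ∀ x, ‖f x‖ ≤ c) →
        ∫ x, g x * f (fiberMap T n ω x) ∂(fiberMeasure m h ω) =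
          ∫ x, iter (normalizedOp L h) n ω g x * f x ∂(fiberMeasure m h (RandomSkew.shift n ω)) := by
  induction n with
  | zero => simpa [iter] using ⟨hg, hgi⟩
  | succ n ih =>
    obtain ⟨h1, h2, h3⟩ := ih
    obtain ⟨k1, k2, k3⟩ := S.normalizedOp_dual (hω.shift n) h1 h2
    have e : RandomSkew.shift 1 (RandomSkew.shift (n : ℤ) ω) = RandomSkew.shift ((n + 1 : ℕ) : ℤ) ω := by
      rw [shift_shift]; congr 1; push_cast; ring
    rw [e] at k2 k3
    rw [iter_succ_eq]
    refine ⟨k1, k2, ?_⟩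
    rintro f hf ⟨c, hc⟩
    have hTm : Measurable (T (RandomSkew.shift n ω 0)) := measurable_fiberMap S.skew_measurable 1 (RandomSkew.shift n ω)
    have := h3 (fun x => f (T (RandomSkew.shift n ω 0) x)) (hf.comp hTm) ⟨c, fun x => hc _⟩
    rw [Function.comp_apply, ← k3 f hf ⟨c, hc⟩, ← this]
    simp_rw [fiberMap_add, fiberMap_one]

/-- Equivariance of `h` says that the normalized operator fixes the constant `1`. Testing the
duality with `1` and indicators gives the claim. -/
theorem measurePreserving_fiber (hω : IsGood m v L h K φ M lam ω) :
    MeasurePreserving (T (ω 0)) (fiberMeasure m h ω) (fiberMeasure m h (RandomSkew.shift 1 ω)) := by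
  have hTm : Measurable (T (ω 0)) := measurable_fiberMap S.skew_measurable 1 ω
  have := S.isProbabilityMeasure_fiber hω.fiberAt
  have : IsProbabilityMeasure (fiberMeasure m h (RandomSkew.shift 1 ω)) :=
    S.isProbabilityMeasure_fiber (hω 1)
  refine ⟨hTm, ?_⟩
  ext s hs
  rw [Measure.map_apply hTm hs]
  have h1 := (S.normalizedOp_dual hω (g := fun _ => 1) measurable_const (integrable_const _)).2.2
    (s.indicator 1) (measurable_one.indicator hs) ⟨1, fun x => by
      by_cases hx : x ∈ s <;> simp [hx]⟩
  have h2 : ∀ᵐ x ∂(fiberMeasure m h (RandomSkew.shift 1 ω)), normalizedOp L h ω (fun _ => 1) x = 1 := by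
    refine (withDensity_absolutelyContinuous m _).ae_le ?_
    filter_upwards [hω.fiberAt.equivariant, (hω 1).h_pos] with x hx hpos
    simp only [normalizedOp, one_mul]
    rw [hx, div_self]
    simpa using hpos.ne'
  have h3 : ∫ x, (1 : ℂ) * s.indicator 1 (T (ω 0) x) ∂(fiberMeasure m h ω) =
      ∫ x, s.indicator 1 x ∂(fiberMeasure m h (RandomSkew.shift 1 ω)) := by
    rw [h1]
    refine integral_congr_ae ?_
    filter_upwards [h2] with x hx
    rw [hx, one_mul]
  have h4 : ∀ x, (1 : ℂ) * s.indicator 1 (T (ω 0) x) = (T (ω 0) ⁻¹' s).indicator 1 x := by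
    intro x; rw [one_mul]; rfl
  simp_rw [h4] at h3
  have h6 : ∀ (ν : Measure X) [IsProbabilityMeasure ν] (s : Set X), MeasurableSet s →
      ∫ x, s.indicator (1 : X → ℂ) x ∂ν = (ν.real s : ℂ) := fun ν _ s hs => by
    rw [integral_indicator hs]; simp
  rw [h6 _ _ (hTm hs), h6 _ _ hs] at h3
  have h5 : (fiberMeasure m h ω).real (T (ω 0) ⁻¹' s) =
      (fiberMeasure m h (RandomSkew.shift 1 ω)).real s := by exact_mod_cast h3
  exact (measureReal_eq_measureReal_iff).1 h5

theorem measurePreserving_fiberMap (hω : IsGood m v L h K φ M lam ω) (n : ℕ) :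
    MeasurePreserving (fiberMap T n ω) (fiberMeasure m h ω)
      (fiberMeasure m h (RandomSkew.shift n ω)) := by
  induction n with
  | zero => simpa using MeasurePreserving.id _
  | succ n ih =>
    have h1 := (S.measurePreserving_fiber (hω.shift n)).comp ih
    have e : RandomSkew.shift 1 (RandomSkew.shift (n : ℤ) ω) = RandomSkew.shift ((n + 1 : ℕ) : ℤ) ω := by
      rw [shift_shift]; congr 1; push_cast; ring
    rw [e] at h1
    have e2 : fiberMap T (n + 1) ω = T (RandomSkew.shift n ω 0) ∘ fiberMap T n ω := by
      ext x; rw [fiberMap_add, fiberMap_one]; rfl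
    rwa [e2]

end System

end Fiber


/-! ### Decay of correlations on a fibre, and replacing the fibre measure by `m`. -/

section Fiber

variable {𝒴 X : Type*} [MeasurableSpace 𝒴] [MeasurableSpace X]
  {m : Measure X} {v : (X → ℂ) → ℝ≥0∞} {T : 𝒴 → X → X}
  {L : 𝒴 → (X → ℂ) → (X → ℂ)} {h : (ℤ → 𝒴) → X → ℝ} {K : (ℤ → 𝒴) → ℝ} {φ : 𝒴 → X → ℝ}
  {C M lam : ℝ} {ω : ℤ → 𝒴}

/-- The integral of `∏ i ∈ A, φ ∘ τ^{t i}` over the fibre of `ω`. -/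
def fiberMoment (m : Measure X) (T : 𝒴 → X → X) (h : (ℤ → 𝒴) → X → ℝ) (φ : 𝒴 → X → ℝ)
    {ι : Type*} (t : ι → ℕ) (A : Finset ι) (ω : ℤ → 𝒴) : ℝ :=
  ∫ x, ∏ i ∈ A, obs T φ (t i) ω x ∂(fiberMeasure m h ω)

namespace System

variable (S : System m v T L h K φ C M lam)
include S

theorem C_nonneg : 0 ≤ C := zero_le_one.trans S.one_le_C

theorem M_nonneg : 0 ≤ M := zero_le_one.trans S.one_le_M

theorem one_le_CM : 1 ≤ C * M := one_le_mul_of_one_le_of_one_le S.one_le_C S.one_le_M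

theorem measurable_φ_complex (y : 𝒴) : Measurable fun x => (φ y x : ℂ) :=
  Complex.measurable_ofReal.comp (S.measurable_φ y)

theorem K_mul_abs_φ_le (hω : FiberAt m v L h K φ M lam ω) (x : X) :
    K ω * |φ (ω 0) x| ≤ C * M := by
  have h1 := S.var.enorm_le (S.measurable_φ_complex (ω 0)) x
  have h2 : ENNReal.ofReal (K ω) * ‖(φ (ω 0) x : ℂ)‖ₑ ≤ ENNReal.ofReal (C * M) := by
    rw [ENNReal.ofReal_mul S.C_nonneg]
    calc _ ≤ ENNReal.ofReal (K ω) * (ENNReal.ofReal C * bvNorm m v (fun x => (φ (ω 0) x : ℂ))) := by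
          gcongr
      _ = ENNReal.ofReal C * (ENNReal.ofReal (K ω) * bvNorm m v (fun x => (φ (ω 0) x : ℂ))) := by ring
      _ ≤ _ := by gcongr; exact hω.φ_le
  rw [← ofReal_norm, ← ENNReal.ofReal_mul (zero_le_one.trans (S.one_le_K ω)),
    ENNReal.ofReal_le_ofReal_iff (zero_le_one.trans S.one_le_CM)] at h2
  simpa using h2

theorem abs_φ_le (hω : FiberAt m v L h K φ M lam ω) (x : X) : |φ (ω 0) x| ≤ C * M :=
  (le_mul_of_one_le_left (abs_nonneg _) (S.one_le_K ω)).trans (S.K_mul_abs_φ_le hω x)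

theorem abs_φ_le' (hω : IsGood m v L h K φ M lam ω) (n : ℕ) (x : X) : |φ (ω n) x| ≤ C * M := by
  simpa [RandomSkew.shift] using S.abs_φ_le (hω n) x

theorem abs_obs_le (hω : IsGood m v L h K φ M lam ω) (n : ℕ) (x : X) :
    |obs T φ n ω x| ≤ C * M := S.abs_φ_le' hω n _

theorem abs_prod_obs_le (hω : IsGood m v L h K φ M lam ω) {ι : Type*} (t : ι → ℕ) (A : Finset ι)
    (x : X) : |∏ i ∈ A, obs T φ (t i) ω x| ≤ (C * M) ^ A.card := by
  rw [Finset.abs_prod, ← Finset.prod_const]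
  exact Finset.prod_le_prod (fun _ _ => abs_nonneg _) fun i _ => S.abs_obs_le hω _ x

theorem abs_fiberMoment_le (hω : IsGood m v L h K φ M lam ω) {ι : Type*} (t : ι → ℕ)
    (A : Finset ι) : |fiberMoment m T h φ t A ω| ≤ (C * M) ^ A.card := by
  have := S.isProbabilityMeasure_fiber hω.fiberAt
  exact abs_integral_le_of_bdd _ (ae_of_all _ (S.abs_prod_obs_le hω t A))

theorem measurable_prod_obs {ι : Type*} (t : ι → ℕ) (A : Finset ι) (ω : ℤ → 𝒴) :
    Measurable fun x => ∏ i ∈ A, obs T φ (t i) ω x :=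
  Finset.measurable_fun_prod _ fun _ _ => measurable_obs S.skew_measurable S.φ_measurable _ ω

theorem integrable_of_bdd_complex (hω : IsGood m v L h K φ M lam ω) {g : X → ℂ} (hg : Measurable g)
    (hb : ∃ c, ∀ x, ‖g x‖ ≤ c) : Integrable g (fiberMeasure m h ω) := by
  have := S.isProbabilityMeasure_fiber hω.fiberAt
  obtain ⟨c, hc⟩ := hb
  exact Integrable.of_bound hg.aestronglyMeasurable c (ae_of_all _ hc)

theorem exists_bound_of_bvNorm {g : X → ℂ} (hg : Measurable g) {a : ℝ} (ha : 0 ≤ a)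
    (hb : bvNorm m v g ≤ ENNReal.ofReal a) : ∃ c, ∀ x, ‖g x‖ ≤ c :=
  ⟨C * a, S.var.norm_le S.C_nonneg hg ha hb⟩

theorem bvNorm_le_add [IsProbabilityMeasure m] {g : X → ℂ} (hg : Measurable g) {c : ℂ} {a b : ℝ}
    (ha : 0 ≤ a) (h1 : bvNorm m v (fun x => g x - c) ≤ ENNReal.ofReal a) (h2 : ‖c‖ ≤ b) :
    bvNorm m v g ≤ ENNReal.ofReal (a + b) := by
  have h3 := S.var.bvNorm_add_le (hg.sub_const c) (measurable_const (a := c))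
  simp only [sub_add_cancel] at h3
  refine h3.trans ?_
  rw [S.var.bvNorm_const, ENNReal.ofReal_add ha ((norm_nonneg _).trans h2), ← ofReal_norm]
  gcongr

theorem bvNorm_sub_le [IsProbabilityMeasure m] {g : X → ℂ} (hg : Measurable g) {c : ℂ} {a b : ℝ}
    (ha : 0 ≤ a) (h1 : bvNorm m v g ≤ ENNReal.ofReal a) (h2 : ‖c‖ ≤ b) :
    bvNorm m v (fun x => g x - c) ≤ ENNReal.ofReal (a + b) := by
  have h3 := S.var.bvNorm_add_le hg (measurable_const (a := -c))
  simp only [← sub_eq_add_neg] at h3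
  refine h3.trans ?_
  rw [S.var.bvNorm_const, ENNReal.ofReal_add ha ((norm_nonneg _).trans h2), ← ofReal_norm, norm_neg]
  gcongr

/-- Products of observables along a fibre, transported to a later time, decay in `BV`. -/
theorem exists_transported [IsProbabilityMeasure m] (hω : IsGood m v L h K φ M lam ω)
    {ι : Type*} [DecidableEq ι]
    (t : ι → ℕ) (A : Finset ι) : ∀ a, (∀ i ∈ A, t i ≤ a) → ∀ n : ℕ, ∃ g : X → ℂ, Measurable g ∧
      bvNorm m v (fun x => g x - (fiberMoment m T h φ t A ω : ℂ)) ≤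
        ENNReal.ofReal ((7 * (C * M)) ^ A.card * Real.exp (-lam * n)) ∧
      ∀ F : X → ℂ, Measurable F → (∃ c, ∀ x, ‖F x‖ ≤ c) →
        ∫ x, ((∏ i ∈ A, obs T φ (t i) ω x : ℝ) : ℂ) * F (fiberMap T (a + n) ω x)
          ∂(fiberMeasure m h ω) =
        ∫ x, g x * F x ∂(fiberMeasure m h (RandomSkew.shift ((a + n : ℕ) : ℤ) ω)) := by
  have hCM := S.one_le_CM
  -- Indices are added in order of time: the earlier product is first carried to the time `t₀` of
  -- the new factor, multiplied there by the observable, and then carried on to time `a + n`.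
  induction A using Finset.induction_on_max_value t with
  | empty =>
    intro a _ n
    have := S.isProbabilityMeasure_fiber hω.fiberAt
    refine ⟨fun _ => 1, measurable_const, ?_, ?_⟩
    · have : fiberMoment m T h φ t ∅ ω = 1 := by simp [fiberMoment]
      rw [this]
      have h0 : (fun _ : X => (1 : ℂ) - ((1 : ℝ) : ℂ)) = fun _ => 0 := by ext; simp
      rw [h0, S.var.bvNorm_const]
      simp
    · rintro F hF -
      have hp := S.measurePreserving_fiberMap hω (a + n)
      simp only [Finset.prod_empty, Complex.ofReal_one, one_mul]
      rw [← hp.map_eq, integral_map hp.measurable.aemeasurable hF.aestronglyMeasurable]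
  | insert i₀ A hi₀ hmax ih =>
    intro a ha n
    set t₀ := t i₀ with ht₀
    obtain ⟨g₀, hg₀, hbv₀, hint₀⟩ := ih t₀ (fun i hi => hmax i hi) 0
    simp only [Nat.cast_zero, mul_zero, Real.exp_zero, mul_one, add_zero] at hbv₀ hint₀
    have hω₀ := hω.shift t₀
    set φ₀ : X → ℂ := fun x => (φ (ω t₀) x : ℂ) with hφ₀
    have hφm : Measurable φ₀ := S.measurable_φ_complex _
    have hφb : ∀ x, ‖φ₀ x‖ ≤ C * M := fun x => by
      simpa [hφ₀] using S.abs_φ_le' hω t₀ x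
    set g₁ : X → ℂ := fun x => φ₀ x * g₀ x with hg₁
    have hg₁m : Measurable g₁ := hφm.mul hg₀
    set N := A.card with hN
    set c := C * M with hc
    have hc0 : 0 ≤ c := by linarith
    -- norm bounds
    have hbvg₀ : bvNorm m v g₀ ≤ ENNReal.ofReal (2 * (7 * c) ^ N) := by
      have := S.bvNorm_le_add hg₀ (by positivity) hbv₀ (b := (7 * c) ^ N) (by
        rw [Complex.norm_real, Real.norm_eq_abs]
        exact (S.abs_fiberMoment_le hω t A).trans (pow_le_pow_left₀ hc0 (by linarith) _))
      rwa [← two_mul] at this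
    -- The factor `K` which decay from time `t₀` costs is paid by the observable at `t₀`. The
    -- constant `6 c (7 c) ^ N` is `3 C` from the product rule, times `M`, times the bound `2 (7 c)
    -- ^ N` for `g₀`.
    have hKg₁ : ENNReal.ofReal (K (RandomSkew.shift t₀ ω)) * bvNorm m v g₁ ≤
        ENNReal.ofReal (6 * c * (7 * c) ^ N) := by
      have h1 := (hω t₀).φ_le
      simp only [RandomSkew.shift, zero_add] at h1
      calc _ ≤ ENNReal.ofReal (K (RandomSkew.shift t₀ ω)) *
            (3 * ENNReal.ofReal C * bvNorm m v φ₀ * bvNorm m v g₀) := by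
            gcongr; exact S.var.bvNorm_mul_le hφm hg₀
        _ = 3 * ENNReal.ofReal C * (ENNReal.ofReal (K (RandomSkew.shift t₀ ω)) * bvNorm m v φ₀) *
            bvNorm m v g₀ := by ring
        _ ≤ 3 * ENNReal.ofReal C * ENNReal.ofReal M * ENNReal.ofReal (2 * (7 * c) ^ N) := by
            gcongr
        _ = _ := by
            rw [show (3 : ℝ≥0∞) = ENNReal.ofReal 3 by simp, ← ENNReal.ofReal_mul (by norm_num),
              ← ENNReal.ofReal_mul (by have := S.C_nonneg; positivity),
              ← ENNReal.ofReal_mul (by have := S.C_nonneg; have := S.M_nonneg; positivity)]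
            congr 1; rw [hc]; ring
    have hbvg₁ : bvNorm m v g₁ ≤ ENNReal.ofReal (6 * c * (7 * c) ^ N) := by
      refine le_trans (le_mul_of_one_le_left zero_le ?_) hKg₁
      rw [ENNReal.one_le_ofReal]; exact S.one_le_K _
    have hg₁i : Integrable g₁ (fiberMeasure m h (RandomSkew.shift t₀ ω)) :=
      S.integrable_of_bdd_complex hω₀ hg₁m (S.exists_bound_of_bvNorm hg₁m (by positivity) hbvg₁)
    -- the transported function
    have hle : t₀ ≤ a := ha i₀ (Finset.mem_insert_self _ _)
    obtain ⟨k, hk⟩ : ∃ k, a + n = t₀ + k := ⟨a + n - t₀, by omega⟩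
    obtain ⟨d1, -, d3⟩ := S.iter_normalizedOp_dual hω₀ hg₁m hg₁i k
    rw [shift_natCast_add] at d3
    have hident : ∀ F : X → ℂ, Measurable F → (∃ c, ∀ x, ‖F x‖ ≤ c) →
        ∫ x, ((∏ i ∈ insert i₀ A, obs T φ (t i) ω x : ℝ) : ℂ) * F (fiberMap T (t₀ + k) ω x)
          ∂(fiberMeasure m h ω) =
        ∫ x, g₁ x * F (fiberMap T k (RandomSkew.shift t₀ ω) x)
          ∂(fiberMeasure m h (RandomSkew.shift t₀ ω)) := by
      rintro F hF ⟨cF, hcF⟩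
      have := hint₀ (fun y => φ₀ y * F (fiberMap T k (RandomSkew.shift t₀ ω) y))
        (hφm.mul (hF.comp (measurable_fiberMap S.skew_measurable k _)))
        ⟨c * cF, fun x => by
          rw [norm_mul]; exact mul_le_mul (hφb x) (hcF _) (norm_nonneg _) hc0⟩
      calc _ = _ := by
            refine integral_congr_ae (ae_of_all _ fun x => ?_)
            simp only [fiberMap_add, Finset.prod_insert hi₀, Complex.ofReal_mul]
            rw [mul_comm ((obs T φ (t i₀) ω x : ℝ) : ℂ), mul_assoc]
            rfl
        _ = _ := this
        _ = _ := by
            refine integral_congr_ae (ae_of_all _ fun x => ?_)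
            simp only [hg₁]; ring
    have hmom : ((fiberMoment m T h φ t (insert i₀ A) ω : ℝ) : ℂ) =
        ∫ x, g₁ x ∂(fiberMeasure m h (RandomSkew.shift t₀ ω)) := by
      have := hident (fun _ => 1) measurable_const ⟨1, fun _ => by simp⟩
      simp only [mul_one] at this
      rw [← this, integral_complex_ofReal]
      rfl
    refine ⟨iter (normalizedOp L h) k (RandomSkew.shift t₀ ω) g₁, d1, ?_, ?_⟩
    · rw [Finset.card_insert_of_notMem hi₀]
      -- For `k = 0` there is no decay to use, and subtracting the mean adds at most `c (7 c) ^ N`.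
      -- This is the reason for `7 = 6 + 1`.
      rcases Nat.eq_zero_or_pos k with hk0 | hk0
      · subst hk0
        have hn : n = 0 := by omega
        subst hn
        have h1 : ‖((fiberMoment m T h φ t (insert i₀ A) ω : ℝ) : ℂ)‖ ≤ c * (7 * c) ^ N := by
          rw [Complex.norm_real, Real.norm_eq_abs]
          refine (S.abs_fiberMoment_le hω t _).trans ?_
          rw [Finset.card_insert_of_notMem hi₀, pow_succ', ← hc]
          exact mul_le_mul_of_nonneg_left (pow_le_pow_left₀ hc0 (by linarith) _) hc0
        refine (S.bvNorm_sub_le hg₁m (by positivity) hbvg₁ h1).trans (le_of_eq ?_)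
        congr 1
        simp only [Nat.cast_zero, mul_zero, Real.exp_zero]
        rw [hN]
        ring
      · have hdec := (hω t₀).decay k hk0 g₁ hg₁m
        rw [hmom, S.integral_fiber]
        refine hdec.trans ?_
        rw [ENNReal.ofReal_mul (zero_le_one.trans (S.one_le_K _)), mul_right_comm]
        refine (mul_le_mul_left hKg₁ _).trans ?_
        rw [← ENNReal.ofReal_mul (by positivity)]
        refine ENNReal.ofReal_le_ofReal ?_
        have hkn : (n : ℝ) ≤ k := by exact_mod_cast (by omega : n ≤ k)
        have he : Real.exp (-lam * k) ≤ Real.exp (-lam * n) :=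
          Real.exp_le_exp.2 (by nlinarith [S.lam_pos])
        calc _ ≤ 6 * c * (7 * c) ^ N * Real.exp (-lam * n) := by gcongr
          _ ≤ 7 * c * (7 * c) ^ N * Real.exp (-lam * n) := by gcongr; norm_num
          _ = _ := by ring
    · rintro F hF ⟨cF, hcF⟩
      rw [hk, hident F hF ⟨cF, hcF⟩, d3 F hF ⟨cF, hcF⟩]

/-- Decay of correlations on a fibre. -/
theorem abs_fiberMoment_union_sub_le [IsProbabilityMeasure m] (hω : IsGood m v L h K φ M lam ω)
    {ι : Type*} [DecidableEq ι] (t : ι → ℕ) (A B : Finset ι) (hAB : Disjoint A B) (a n : ℕ)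
    (hA : ∀ i ∈ A, t i ≤ a) (hB : ∀ i ∈ B, a + n ≤ t i) :
    |fiberMoment m T h φ t (A ∪ B) ω - fiberMoment m T h φ t A ω * fiberMoment m T h φ t B ω| ≤
      C * (7 * (C * M)) ^ (A.card + B.card) * Real.exp (-lam * n) := by
  obtain ⟨g, hg, hbv, hint⟩ := S.exists_transported hω t A a hA n
  set c := C * M with hc
  have hCM := S.one_le_CM
  have hc0 : 0 ≤ c := by linarith
  have hω' := hω.shift (a + n)
  have := S.isProbabilityMeasure_fiber hω.fiberAt
  have := S.isProbabilityMeasure_fiber hω'.fiberAt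
  set t' : ι → ℕ := fun i => t i - (a + n) with ht'
  set F : X → ℝ := fun y => ∏ i ∈ B, obs T φ (t' i) (RandomSkew.shift ((a + n : ℕ) : ℤ) ω) y with hF
  have hFm : Measurable F := S.measurable_prod_obs t' B _
  have hFb : ∀ x, |F x| ≤ c ^ B.card := S.abs_prod_obs_le hω' t' B
  have hFeq : ∀ x, ∏ i ∈ B, obs T φ (t i) ω x = F (fiberMap T (a + n) ω x) := by
    intro x
    refine Finset.prod_congr rfl fun i hi => ?_
    rw [← obs_add]
    congr 1
    have := hB i hi
    simp only [ht']; omega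
  have hFm' : Measurable fun x => (F x : ℂ) := Complex.measurable_ofReal.comp hFm
  have h1 := hint (fun x => (F x : ℂ)) hFm' ⟨c ^ B.card, fun x => by simpa using hFb x⟩
  have hU : ((fiberMoment m T h φ t (A ∪ B) ω : ℝ) : ℂ) =
      ∫ x, g x * F x ∂(fiberMeasure m h (RandomSkew.shift ((a + n : ℕ) : ℤ) ω)) := by
    rw [← h1, fiberMoment, ← integral_complex_ofReal]
    congr 1; ext x
    rw [Finset.prod_union hAB, hFeq x, Complex.ofReal_mul]
  have hV : ((fiberMoment m T h φ t B ω : ℝ) : ℂ) =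
      ∫ x, (F x : ℂ) ∂(fiberMeasure m h (RandomSkew.shift ((a + n : ℕ) : ℤ) ω)) := by
    have hp := S.measurePreserving_fiberMap hω (a + n)
    rw [← hp.map_eq, integral_map hp.measurable.aemeasurable hFm'.aestronglyMeasurable,
      fiberMoment, ← integral_complex_ofReal]
    congr 1; ext x; rw [hFeq x]
  set κ : ℂ := ((fiberMoment m T h φ t A ω : ℝ) : ℂ) with hκ
  have hgb : ∀ x, ‖g x - κ‖ ≤ C * ((7 * c) ^ A.card * Real.exp (-lam * n)) :=
    S.var.norm_le S.C_nonneg (hg.sub_const _) (by positivity) hbv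
  have hFi : Integrable (fun x => (F x : ℂ))
      (fiberMeasure m h (RandomSkew.shift ((a + n : ℕ) : ℤ) ω)) :=
    Integrable.of_bound hFm'.aestronglyMeasurable (c ^ B.card)
      (ae_of_all _ fun x => by simpa using hFb x)
  have hgF : Integrable (fun x => (g x - κ) * (F x : ℂ))
      (fiberMeasure m h (RandomSkew.shift ((a + n : ℕ) : ℤ) ω)) :=
    hFi.bdd_mul (hg.sub_const κ).aestronglyMeasurable (ae_of_all _ hgb)
  have hdiff : ((fiberMoment m T h φ t (A ∪ B) ω - fiberMoment m T h φ t A ω *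
      fiberMoment m T h φ t B ω : ℝ) : ℂ) =
      ∫ x, (g x - κ) * F x ∂(fiberMeasure m h (RandomSkew.shift ((a + n : ℕ) : ℤ) ω)) := by
    rw [Complex.ofReal_sub, Complex.ofReal_mul, hU, hV, ← hκ, ← integral_const_mul]
    have : (fun x => g x * (F x : ℂ)) = fun x => (g x - κ) * (F x : ℂ) + κ * (F x : ℂ) := by
      ext x; ring
    rw [this, integral_add hgF (hFi.const_mul κ)]
    ring
  rw [← Real.norm_eq_abs, ← Complex.norm_real, hdiff]
  have hbound := norm_integral_le_of_norm_le_const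
    (μ := fiberMeasure m h (RandomSkew.shift ((a + n : ℕ) : ℤ) ω))
    (f := fun x => (g x - κ) * (F x : ℂ))
    (C := C * ((7 * c) ^ A.card * Real.exp (-lam * n)) * (7 * c) ^ B.card) (ae_of_all _ fun x => by
      rw [norm_mul]
      refine mul_le_mul (hgb x) ?_ (norm_nonneg _) (by have := S.C_nonneg; positivity)
      rw [Complex.norm_real, Real.norm_eq_abs]
      exact (hFb x).trans (pow_le_pow_left₀ hc0 (by linarith) _))
  refine hbound.trans (le_of_eq ?_)
  simp only [probReal_univ, mul_one]
  rw [pow_add]; ring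

theorem integral_fiberMap_eq [IsProbabilityMeasure m] {g : X → ℂ} (hg : Measurable g)
    (hgi : Integrable g m) (n : ℕ) (ω : ℤ → 𝒴) :
    Measurable (iter (fun ω' => L (ω' 0)) n ω g) ∧ Integrable (iter (fun ω' => L (ω' 0)) n ω g) m ∧
      ∀ f : X → ℂ, Measurable f → (∃ c, ∀ x, ‖f x‖ ≤ c) →
        ∫ x, g x * f (fiberMap T n ω x) ∂m = ∫ x, iter (fun ω' => L (ω' 0)) n ω g x * f x ∂m := by
  induction n with
  | zero => simpa [iter] using ⟨hg, hgi⟩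
  | succ n ih =>
    obtain ⟨h1, h2, h3⟩ := ih
    obtain ⟨k1, k2, k3⟩ := S.transfer (RandomSkew.shift n ω 0) _ h1 h2
    rw [iter_succ_eq]
    refine ⟨k1, k2, ?_⟩
    rintro f hf ⟨c, hc⟩
    have hTm : Measurable (T (RandomSkew.shift n ω 0)) :=
      measurable_fiberMap S.skew_measurable 1 (RandomSkew.shift n ω)
    have := h3 (fun x => f (T (RandomSkew.shift n ω 0) x)) (hf.comp hTm) ⟨c, fun x => hc _⟩
    rw [Function.comp_apply, ← k3 f (memLp_top_of_bound hf.aestronglyMeasurable c (ae_of_all _ hc)),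
      ← this]
    simp_rw [fiberMap_add, fiberMap_one]

/-- Starting from `m` instead of `μ_ω` costs an exponentially small error. -/
theorem abs_integral_fiberMap_sub_le [IsProbabilityMeasure m] (hω : IsGood m v L h K φ M lam ω)
    {f : X → ℝ} (hf : Measurable f) {b : ℝ} (hb : ∀ x, |f x| ≤ b) (hb0 : 0 ≤ b) (n : ℕ)
    (hn : 1 ≤ n) :
    |∫ x, f (fiberMap T n ω x) ∂m - ∫ x, f x ∂(fiberMeasure m h (RandomSkew.shift n ω))| ≤
      K ω * Real.exp (-lam * n) * b := by
  have hfm : Measurable fun x => (f x : ℂ) := Complex.measurable_ofReal.comp hf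
  have hfb : ∀ x, ‖(f x : ℂ)‖ ≤ b := fun x => by simpa using hb x
  obtain ⟨h1, h2, h3⟩ := S.integral_fiberMap_eq (g := fun _ => 1) measurable_const
    (integrable_const _) n ω
  have h4 := h3 (fun x => (f x : ℂ)) hfm ⟨b, hfb⟩
  simp only [one_mul] at h4
  set I := iter (fun ω' => L (ω' 0)) n ω (fun _ => (1 : ℂ)) with hI
  set k : X → ℂ := fun x => (h (RandomSkew.shift n ω) x : ℂ) with hk
  have hkm : Measurable k := Complex.measurable_ofReal.comp (S.measurable_h _)
  have hki : Integrable k m := by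
    have := S.isProbabilityMeasure_fiber (hω n)
    have := (S.integrable_fiber_iff (RandomSkew.shift n ω) (fun _ => 1)).1 (integrable_const _)
    simpa using this
  have hcast : ((∫ x, f (fiberMap T n ω x) ∂m -
      ∫ x, f x ∂(fiberMeasure m h (RandomSkew.shift n ω)) : ℝ) : ℂ) = ∫ x, (I x - k x) * f x ∂m := by
    rw [Complex.ofReal_sub, ← integral_complex_ofReal, ← integral_complex_ofReal, h4, S.integral_fiber]
    have e : ∀ x, (I x - k x) * (f x : ℂ) = I x * f x - f x * k x := fun x => by ring
    simp_rw [e]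
    rw [integral_sub]
    · exact h2.mul_bdd (c := b) hfm.aestronglyMeasurable (ae_of_all _ hfb)
    · exact hki.bdd_mul (c := b) hfm.aestronglyMeasurable (ae_of_all _ hfb)
  rw [← Real.norm_eq_abs, ← Complex.norm_real, hcast]
  have hdec := (hω.fiberAt.decay_one n hn)
  have hL1 : ∫⁻ x, ‖I x - k x‖ₑ ∂m ≤ ENNReal.ofReal (K ω * Real.exp (-lam * n)) := by
    rw [← eLpNorm_one_eq_lintegral_enorm]
    exact le_self_add.trans hdec
  have hKpos : 0 ≤ K ω := zero_le_one.trans (S.one_le_K ω)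
  have hnn : ∫ x, ‖I x - k x‖ ∂m ≤ K ω * Real.exp (-lam * n) := by
    rw [integral_norm_eq_lintegral_enorm (f := fun x => I x - k x) (h1.sub hkm).aestronglyMeasurable]
    exact ENNReal.toReal_le_of_le_ofReal (by positivity) hL1
  calc _ ≤ ∫ x, ‖I x - k x‖ * b ∂m := by
        refine norm_integral_le_of_norm_le ((h2.sub hki).norm.mul_const b) (ae_of_all _ fun x => ?_)
        rw [norm_mul]
        exact mul_le_mul_of_nonneg_left (hfb x) (norm_nonneg _)
    _ ≤ _ := by
        rw [integral_mul_const]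
        exact mul_le_mul_of_nonneg_right hnn hb0

end System

/-- The analogue of `fiberMoment` started from `m` at time `s`; it only depends on the coordinates
from `s` on. -/
def startedMoment (m : Measure X) (T : 𝒴 → X → X) (φ : 𝒴 → X → ℝ)
    {ι : Type*} (t : ι → ℕ) (A : Finset ι) (s : ℕ) (ω : ℤ → 𝒴) : ℝ :=
  ∫ x, ∏ i ∈ A, obs T φ (t i - s) (shift s ω) x ∂m

namespace System

variable (S : System m v T L h K φ C M lam)
include S

theorem abs_startedMoment_le [IsProbabilityMeasure m] (hω : IsGood m v L h K φ M lam ω)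
    {ι : Type*} (t : ι → ℕ) (A : Finset ι) (s : ℕ) :
    |startedMoment m T φ t A s ω| ≤ (C * M) ^ A.card :=
  abs_integral_le_of_bdd _ (ae_of_all _ (S.abs_prod_obs_le (hω.shift s) (fun i => t i - s) A))

/-- Let `s + k` be the earliest time in `A`. Both sides integrate one function of the state at that
time, and `k` steps from `m` cost `K (σ^s ω) e^{-λ k}`. Temperedness bounds this `K` by `K (σ^{s+k}
ω) e^{λ k / 3}`, and the observable at time `s + k` cancels the latter `K`. What remains is the rate
`2 λ / 3`. -/
theorem abs_fiberMoment_sub_started_le [IsProbabilityMeasure m] (hω : IsGood m v L h K φ M lam ω)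
    {ι : Type*} [DecidableEq ι] (t : ι → ℕ) (A : Finset ι) (s n : ℕ)
    (hA : ∀ i ∈ A, s + n ≤ t i) :
    |fiberMoment m T h φ t A ω - startedMoment m T φ t A s ω| ≤
      2 * (C * M) ^ A.card * Real.exp (-(2 * lam / 3) * n) := by
  set c := C * M with hc
  have hCM := S.one_le_CM
  have hc0 : 0 ≤ c := by linarith
  rcases Finset.eq_empty_or_nonempty A with rfl | hne
  · have := S.isProbabilityMeasure_fiber hω.fiberAt
    simp [fiberMoment, startedMoment]
    positivity
  rcases Nat.eq_zero_or_pos n with rfl | hn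
  · have h1 := S.abs_fiberMoment_le hω t A
    have h2 := S.abs_startedMoment_le hω t A s
    have := abs_sub (fiberMoment m T h φ t A ω) (startedMoment m T φ t A s ω)
    simp only [Nat.cast_zero, mul_zero, Real.exp_zero, mul_one]
    linarith
  obtain ⟨i₀, hi₀, hmin⟩ := Finset.exists_min_image A t hne
  obtain ⟨k, hk⟩ : ∃ k, t i₀ = s + k := ⟨t i₀ - s, by have := hA i₀ hi₀; omega⟩
  have hkn : n ≤ k := by have := hA i₀ hi₀; omega
  set ω' := RandomSkew.shift ((s + k : ℕ) : ℤ) ω with hω'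
  have hg' : IsGood m v L h K φ M lam ω' := hω.shift (s + k)
  set t' : ι → ℕ := fun i => t i - (s + k) with ht'
  set F : X → ℝ := fun y => ∏ i ∈ A, obs T φ (t' i) ω' y with hF
  have hFm : Measurable F := S.measurable_prod_obs t' A _
  have hstart : startedMoment m T φ t A s ω = ∫ x, F (fiberMap T k (RandomSkew.shift s ω) x) ∂m := by
    unfold startedMoment
    congr 1; ext x
    refine Finset.prod_congr rfl fun i hi => ?_
    have := hmin i hi
    rw [show t i - s = k + t' i by simp only [ht']; omega, obs_add, shift_natCast_add]
  have hfib : fiberMoment m T h φ t A ω = ∫ x, F x ∂(fiberMeasure m h ω') := by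
    have hp := S.measurePreserving_fiberMap hω (s + k)
    rw [hω', ← hp.map_eq, integral_map hp.measurable.aemeasurable hFm.aestronglyMeasurable]
    unfold fiberMoment
    congr 1; ext x
    refine Finset.prod_congr rfl fun i hi => ?_
    have := hmin i hi
    rw [← obs_add]
    congr 1
    simp only [ht']; omega
  have hK1 : 0 < K ω' := lt_of_lt_of_le one_pos (S.one_le_K _)
  have hFb : ∀ x, |F x| ≤ c ^ A.card / K ω' := by
    intro x
    simp only [hF]
    rw [← Finset.mul_prod_erase A _ hi₀, abs_mul]
    have h1 : |obs T φ (t' i₀) ω' x| ≤ c / K ω' := by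
      have : t' i₀ = 0 := by simp only [ht']; omega
      rw [this, le_div_iff₀ hK1, mul_comm]
      exact S.K_mul_abs_φ_le hg'.fiberAt x
    have h2 := S.abs_prod_obs_le hg' t' (A.erase i₀) x
    calc _ ≤ c / K ω' * c ^ (A.erase i₀).card := mul_le_mul h1 h2 (abs_nonneg _) (by positivity)
      _ = _ := by
        rw [← Finset.card_erase_add_one hi₀, pow_succ]; ring
  have hmain := S.abs_integral_fiberMap_sub_le (hω.shift s) hFm hFb (by positivity) k (by omega)
  rw [shift_natCast_add, ← hω', ← hstart, ← hfib, abs_sub_comm] at hmain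
  have hslow := (hω s).slow k
  rw [shift_natCast_add, ← hω'] at hslow
  have hkn' : (n : ℝ) ≤ k := by exact_mod_cast hkn
  calc _ ≤ K (RandomSkew.shift s ω) * Real.exp (-lam * k) * (c ^ A.card / K ω') := hmain
    _ ≤ (K ω' * Real.exp (lam / 3 * k)) * Real.exp (-lam * k) * (c ^ A.card / K ω') := by gcongr
    _ = c ^ A.card * (Real.exp (lam / 3 * k) * Real.exp (-lam * k)) := by field_simp
    _ = c ^ A.card * Real.exp (-(2 * lam / 3) * k) := by rw [← Real.exp_add]; congr 2; ring
    _ ≤ c ^ A.card * Real.exp (-(2 * lam / 3) * n) := by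
      refine mul_le_mul_of_nonneg_left (Real.exp_le_exp.2 ?_) (by positivity)
      nlinarith [S.lam_pos]
    _ ≤ _ := by
      have : 0 ≤ c ^ A.card * Real.exp (-(2 * lam / 3) * n) := by positivity
      linarith

end System

end Fiber


/-! ### Fibrewise martingale approximation -/

section Fiber

variable {𝒴 X : Type*} [MeasurableSpace 𝒴] [MeasurableSpace X]
  {m : Measure X} {v : (X → ℂ) → ℝ≥0∞} {T : 𝒴 → X → X}
  {L : 𝒴 → (X → ℂ) → (X → ℂ)} {h : (ℤ → 𝒴) → X → ℝ} {K : (ℤ → 𝒴) → ℝ} {φ : 𝒴 → X → ℝ}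
  {C M lam : ℝ} {ω : ℤ → 𝒴}

/-- The mean of the observable over the fibre of `ω`. -/
def fiberMean (m : Measure X) (h : (ℤ → 𝒴) → X → ℝ) (φ : 𝒴 → X → ℝ) (ω : ℤ → 𝒴) : ℝ :=
  ∫ x, φ (ω 0) x ∂(fiberMeasure m h ω)

/-- The centred observable at time `i`, transported to time `i + n`. -/
def transported (m : Measure X) (L : 𝒴 → (X → ℂ) → (X → ℂ)) (h : (ℤ → 𝒴) → X → ℝ)
    (φ : 𝒴 → X → ℝ) (ω : ℤ → 𝒴) (i n : ℕ) (x : X) : ℝ :=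
  (iter (normalizedOp L h) n (shift i ω) (fun y => (φ (shift i ω 0) y : ℂ)) x).re -
    fiberMean m h φ (shift i ω)

/-- The coboundary part of the martingale approximation. -/
def transferSum (m : Measure X) (L : 𝒴 → (X → ℂ) → (X → ℂ)) (h : (ℤ → 𝒴) → X → ℝ)
    (φ : 𝒴 → X → ℝ) (ω : ℤ → 𝒴) (j : ℕ) (x : X) : ℝ :=
  ∑ i ∈ Finset.range j, transported m L h φ ω i (j - i) x

/-- The differences of the martingale approximation. -/
def martingaleDiff (m : Measure X) (T : 𝒴 → X → X) (L : 𝒴 → (X → ℂ) → (X → ℂ))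
    (h : (ℤ → 𝒴) → X → ℝ) (φ : 𝒴 → X → ℝ) (ω : ℤ → 𝒴) (j : ℕ) (x : X) : ℝ :=
  ∑ i ∈ Finset.range (j + 1), transported m L h φ ω i (j - i) x -
    transferSum m L h φ ω (j + 1) (T (ω j) x)

theorem sum_exp_neg_le {lam : ℝ} (hl : 0 < lam) (j : ℕ) :
    ∑ i ∈ Finset.range j, Real.exp (-lam * ((j - i : ℕ) : ℝ)) ≤ 1 / (1 - Real.exp (-lam)) := by
  have h1 : Real.exp (-lam) < 1 := Real.exp_lt_one_iff.2 (by linarith)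
  have h2 : ∀ k : ℕ, Real.exp (-lam * (k : ℝ)) = Real.exp (-lam) ^ k := fun k => by
    rw [← Real.exp_nat_mul]; ring_nf
  simp_rw [h2]
  have h3 : ∑ i ∈ Finset.range j, Real.exp (-lam) ^ (j - i) ≤
      ∑ i ∈ Finset.range (j + 1), Real.exp (-lam) ^ i := by
    have h4 := Finset.sum_range_reflect (fun i => Real.exp (-lam) ^ i) (j + 1)
    rw [← h4, Finset.sum_range_succ]
    refine le_add_of_le_of_nonneg (le_of_eq (Finset.sum_congr rfl fun i _ => ?_)) (by positivity)
    congr 1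
  refine h3.trans ?_
  rw [one_div, ← tsum_geometric_of_lt_one (Real.exp_pos _).le h1]
  exact (summable_geometric_of_lt_one (Real.exp_pos _).le h1).sum_le_tsum _
    fun _ _ => by positivity

namespace System

variable (S : System m v T L h K φ C M lam)
include S

theorem abs_fiberMean_le (hω : IsGood m v L h K φ M lam ω) :
    |fiberMean m h φ ω| ≤ C * M := by
  have := S.isProbabilityMeasure_fiber hω.fiberAt
  exact abs_integral_le_of_bdd _ (ae_of_all _ (S.abs_φ_le hω.fiberAt))

theorem integrable_φ (hω : IsGood m v L h K φ M lam ω) :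
    Integrable (fun y => (φ (ω 0) y : ℂ)) (fiberMeasure m h ω) :=
  S.integrable_of_bdd_complex hω (S.measurable_φ_complex _) ⟨C * M, fun x => by
    simpa using S.abs_φ_le hω.fiberAt x⟩

theorem measurable_transported (hω : IsGood m v L h K φ M lam ω) (i n : ℕ) :
    Measurable (transported m L h φ ω i n) :=
  (Complex.measurable_re.comp (S.iter_normalizedOp_dual (hω.shift i) (S.measurable_φ_complex _)
    (S.integrable_φ (hω.shift i)) n).1).sub_const _

theorem abs_transported_le (hω : IsGood m v L h K φ M lam ω) (i n : ℕ) (x : X) :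
    |transported m L h φ ω i n x| ≤ 2 * (C * M) * Real.exp (-lam * n) := by
  have hCM := S.one_le_CM
  rcases Nat.eq_zero_or_pos n with rfl | hn
  · have h1 := S.abs_φ_le (hω i) x
    have h2 := S.abs_fiberMean_le (hω.shift i)
    simp only [transported, iter, id, Complex.ofReal_re, Nat.cast_zero, mul_zero, Real.exp_zero,
      mul_one]
    exact (abs_sub _ _).trans (by linarith)
  · have hdec := (hω i).decay n hn _ (S.measurable_φ_complex (RandomSkew.shift i ω 0))
    have hm := (S.iter_normalizedOp_dual (hω.shift i) (S.measurable_φ_complex _)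
      (S.integrable_φ (hω.shift i)) n).1
    have hK : 0 ≤ K (RandomSkew.shift i ω) := zero_le_one.trans (S.one_le_K _)
    have hbv : ENNReal.ofReal (K (RandomSkew.shift i ω) * Real.exp (-lam * n)) *
        bvNorm m v (fun x => (φ (RandomSkew.shift i ω 0) x : ℂ)) ≤
        ENNReal.ofReal (M * Real.exp (-lam * n)) := by
      rw [ENNReal.ofReal_mul hK, ENNReal.ofReal_mul S.M_nonneg, mul_right_comm]
      gcongr
      exact (hω i).φ_le
    have h1 := S.var.norm_le S.C_nonneg (hm.sub_const _)
      (mul_nonneg S.M_nonneg (Real.exp_pos _).le) (hdec.trans hbv) x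
    rw [← S.integral_fiber, integral_complex_ofReal] at h1
    have h2 := (Complex.abs_re_le_norm _).trans h1
    rw [Complex.sub_re, Complex.ofReal_re] at h2
    refine h2.trans ?_
    have : 0 ≤ C * M * Real.exp (-lam * n) := by positivity
    linarith

/-- In weak form: `transported` is the conditional expectation of the centred observable at time `i`
given the state at time `i + n`. -/
theorem integral_transported_mul (hω : IsGood m v L h K φ M lam ω) (i n : ℕ) {F : X → ℝ}
    (hF : Measurable F) (hFb : ∃ c, ∀ x, |F x| ≤ c) :
    ∫ x, transported m L h φ ω i n x * F x ∂(fiberMeasure m h (RandomSkew.shift ((i + n : ℕ) : ℤ) ω)) =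
      ∫ x, (φ (RandomSkew.shift i ω 0) x - fiberMean m h φ (RandomSkew.shift i ω)) *
        F (fiberMap T n (RandomSkew.shift i ω) x) ∂(fiberMeasure m h (RandomSkew.shift i ω)) := by
  obtain ⟨c, hc⟩ := hFb
  have hgi := hω.shift i
  obtain ⟨h1, h2, h3⟩ := S.iter_normalizedOp_dual hgi (S.measurable_φ_complex _)
    (S.integrable_φ hgi) n
  have hFm : Measurable fun x => (F x : ℂ) := Complex.measurable_ofReal.comp hF
  have h4 := h3 (fun x => (F x : ℂ)) hFm ⟨c, fun x => by simpa using hc x⟩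
  have := S.isProbabilityMeasure_fiber (hω i)
  have := S.isProbabilityMeasure_fiber (hω (i + n))
  have hp := S.measurePreserving_fiberMap hgi n
  rw [shift_natCast_add] at h2 h4 hp
  have hFi : Integrable F (fiberMeasure m h (RandomSkew.shift ((i + n : ℕ) : ℤ) ω)) :=
    integrable_of_bdd hF.aestronglyMeasurable c (ae_of_all _ hc)
  have hFc : Integrable (fun x => (F x : ℂ))
    (fiberMeasure m h (RandomSkew.shift ((i + n : ℕ) : ℤ) ω)) := hFi.ofReal
  have hFT : Integrable (fun x => F (fiberMap T n (RandomSkew.shift i ω) x))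
      (fiberMeasure m h (RandomSkew.shift i ω)) := hp.integrable_comp_of_integrable hFi
  have hφi : Integrable (fun x => φ (RandomSkew.shift i ω 0) x *
      F (fiberMap T n (RandomSkew.shift i ω) x)) (fiberMeasure m h (RandomSkew.shift i ω)) :=
    hFT.bdd_mul (c := C * M) (S.measurable_φ _).aestronglyMeasurable (ae_of_all _ fun x => by
      simpa using S.abs_φ_le (hω i) x)
  have hre : Integrable (fun x => (iter (normalizedOp L h) n (RandomSkew.shift i ω)
      (fun y => (φ (RandomSkew.shift i ω 0) y : ℂ)) x).re * F x)
      (fiberMeasure m h (RandomSkew.shift ((i + n : ℕ) : ℤ) ω)) :=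
    (Integrable.re h2).mul_bdd (c := c) hF.aestronglyMeasurable (ae_of_all _ hc)
  have hIF : Integrable (fun x => iter (normalizedOp L h) n (RandomSkew.shift i ω)
      (fun y => (φ (RandomSkew.shift i ω 0) y : ℂ)) x * (F x : ℂ))
      (fiberMeasure m h (RandomSkew.shift ((i + n : ℕ) : ℤ) ω)) :=
    h2.mul_bdd (c := c) hFm.aestronglyMeasurable (ae_of_all _ fun x => by simpa using hc x)
  have h5 := congrArg Complex.re h4
  have e1 : ∀ x, ((φ (RandomSkew.shift i ω 0) x : ℝ) : ℂ) *
      ((F (fiberMap T n (RandomSkew.shift i ω) x) : ℝ) : ℂ) =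
      ((φ (RandomSkew.shift i ω 0) x * F (fiberMap T n (RandomSkew.shift i ω) x) : ℝ) : ℂ) :=
    fun x => by push_cast; rfl
  simp_rw [e1] at h5
  rw [integral_complex_ofReal, Complex.ofReal_re] at h5
  have h6 := integral_re hIF
  simp only [RCLike.re_to_complex, Complex.re_mul_ofReal] at h6
  rw [← h6] at h5
  simp only [transported, sub_mul]
  rw [integral_sub hre (hFi.const_mul _), integral_sub hφi (hFT.const_mul _), h5,
    integral_const_mul, integral_const_mul]
  congr 2
  rw [← hp.map_eq, integral_map hp.measurable.aemeasurable hF.aestronglyMeasurable]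

theorem measurable_transferSum (hω : IsGood m v L h K φ M lam ω) (j : ℕ) :
    Measurable (transferSum m L h φ ω j) :=
  Finset.measurable_fun_sum _ fun _ _ => S.measurable_transported hω _ _

theorem measurable_martingaleDiff (hω : IsGood m v L h K φ M lam ω) (j : ℕ) :
    Measurable (martingaleDiff m T L h φ ω j) :=
  (Finset.measurable_fun_sum _ fun _ _ => S.measurable_transported hω _ _).sub
    ((S.measurable_transferSum hω _).comp (by
      simpa [fiberMap_one, RandomSkew.shift] using
        measurable_fiberMap S.skew_measurable 1 (RandomSkew.shift j ω)))

theorem abs_transferSum_le (hω : IsGood m v L h K φ M lam ω) (j : ℕ) (x : X) :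
    |transferSum m L h φ ω j x| ≤ 2 * (C * M) / (1 - Real.exp (-lam)) := by
  have hCM := S.one_le_CM
  calc _ ≤ ∑ i ∈ Finset.range j, 2 * (C * M) * Real.exp (-lam * ((j - i : ℕ) : ℝ)) :=
        (Finset.abs_sum_le_sum_abs _ _).trans
          (Finset.sum_le_sum fun i _ => S.abs_transported_le hω _ _ x)
    _ ≤ 2 * (C * M) * (1 / (1 - Real.exp (-lam))) := by
        rw [← Finset.mul_sum]
        exact mul_le_mul_of_nonneg_left (sum_exp_neg_le S.lam_pos j) (by positivity)
    _ = _ := by ring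

theorem abs_martingaleDiff_le (hω : IsGood m v L h K φ M lam ω) (j : ℕ) (x : X) :
    |martingaleDiff m T L h φ ω j x| ≤ 3 * (2 * (C * M) / (1 - Real.exp (-lam))) := by
  have hCM := S.one_le_CM
  have h1 := S.abs_transferSum_le hω (j + 1) (T (ω j) x)
  have h2 := S.abs_transferSum_le hω j x
  have h3 := S.abs_transported_le hω j 0 x
  have h4 : 2 * (C * M) ≤ 2 * (C * M) / (1 - Real.exp (-lam)) := by
    have h5 : Real.exp (-lam) < 1 := Real.exp_lt_one_iff.2 (by linarith [S.lam_pos])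
    exact le_div_self (by positivity) (by linarith) (by linarith [Real.exp_pos (-lam)])
  simp only [Nat.cast_zero, mul_zero, Real.exp_zero, mul_one] at h3
  unfold martingaleDiff
  rw [Finset.sum_range_succ, Nat.sub_self]
  refine (abs_sub _ _).trans ?_
  have := abs_add_le (transferSum m L h φ ω j x) (transported m L h φ ω j 0 x)
  unfold transferSum at this h1 h2 ⊢
  linarith

/-- By duality, the observable of time `i` carried to time `j` and tested against `F ∘ T` gives the
same integral as the one carried to time `j + 1` and tested against `F`. Pulled back by the
measure-preserving map, the latter is the matching term of `transferSum` at `j + 1`, so the terms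
cancel one by one. -/
theorem integral_martingaleDiff_mul (hω : IsGood m v L h K φ M lam ω) (j : ℕ) {F : X → ℝ}
    (hF : Measurable F) (hFb : ∃ c, ∀ x, |F x| ≤ c) :
    ∫ x, martingaleDiff m T L h φ ω j x * F (T (ω j) x)
      ∂(fiberMeasure m h (RandomSkew.shift j ω)) = 0 := by
  obtain ⟨c, hc⟩ := hFb
  have hT1 : fiberMap T 1 (RandomSkew.shift j ω) = T (ω j) := by
    simp [fiberMap_one, RandomSkew.shift]
  have hTp := S.measurePreserving_fiberMap (hω.shift j) 1
  rw [hT1, shift_natCast_add] at hTp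
  have hTm := hTp.measurable
  have := S.isProbabilityMeasure_fiber (hω j)
  have := S.isProbabilityMeasure_fiber (hω (j + 1))
  have hkey : ∀ i ∈ Finset.range (j + 1),
      ∫ x, transported m L h φ ω i (j - i) x * F (T (ω j) x)
        ∂(fiberMeasure m h (RandomSkew.shift j ω)) =
      ∫ x, transported m L h φ ω i (j + 1 - i) (T (ω j) x) * F (T (ω j) x)
        ∂(fiberMeasure m h (RandomSkew.shift j ω)) := by
    intro i hi
    have hij : i ≤ j := Nat.lt_succ_iff.1 (Finset.mem_range.1 hi)
    have h1 := S.integral_transported_mul hω i (j - i) (hF.comp hTm) ⟨c, fun x => hc _⟩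
    have h2 := S.integral_transported_mul hω i (j - i + 1) hF ⟨c, hc⟩
    rw [show i + (j - i) = j by omega] at h1
    rw [show i + (j - i + 1) = j + 1 by omega, show j - i + 1 = j + 1 - i by omega] at h2
    rw [← integral_map (f := fun y => transported m L h φ ω i (j + 1 - i) y * F y)
      hTm.aemeasurable ((S.measurable_transported hω _ _).mul hF).aestronglyMeasurable,
      hTp.map_eq, h2]
    simp only [Function.comp_apply] at h1
    rw [h1]
    congr 1; ext x
    rw [show j + 1 - i = j - i + 1 by omega, fiberMap_add, fiberMap_one, shift_natCast_add,
      show i + (j - i) = j by omega]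
    simp [RandomSkew.shift]
  have hint : ∀ (f : X → ℝ), Measurable f → (∃ c, ∀ x, |f x| ≤ c) →
      Integrable (fun x => f x * F (T (ω j) x)) (fiberMeasure m h (RandomSkew.shift j ω)) := by
    rintro f hf ⟨d, hd⟩
    refine Integrable.bdd_mul (c := d) ?_ hf.aestronglyMeasurable (ae_of_all _ hd)
    exact integrable_of_bdd (hF.comp hTm).aestronglyMeasurable c (ae_of_all _ fun x => hc _)
  simp only [martingaleDiff, transferSum, sub_mul, Finset.sum_mul]
  rw [integral_sub, integral_finsetSum, integral_finsetSum, Finset.sum_congr rfl hkey, sub_self]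
  · exact fun i _ => hint _ ((S.measurable_transported hω _ _).comp hTm)
      ⟨_, fun x => S.abs_transported_le hω _ _ _⟩
  · exact fun i _ => hint _ (S.measurable_transported hω _ _)
      ⟨_, fun x => S.abs_transported_le hω _ _ _⟩
  · exact integrable_finsetSum _ fun i _ => hint _ (S.measurable_transported hω _ _)
      ⟨_, fun x => S.abs_transported_le hω _ _ _⟩
  · exact integrable_finsetSum _ fun i _ => hint _ ((S.measurable_transported hω _ _).comp hTm)
      ⟨_, fun x => S.abs_transported_le hω _ _ _⟩

-- The coboundary terms telescope along the orbit. Only the final one survives, since `transferSum`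
-- at time `0` is an empty sum.
omit S [MeasurableSpace 𝒴] in
theorem sum_martingaleDiff (n : ℕ) (ω : ℤ → 𝒴) (x : X) :
    ∑ j ∈ Finset.range n, martingaleDiff m T L h φ ω j (fiberMap T j ω x) =
      ∑ j ∈ Finset.range n, obs T φ j ω x -
        ∑ j ∈ Finset.range n, fiberMean m h φ (RandomSkew.shift j ω) -
        transferSum m L h φ ω n (fiberMap T n ω x) := by
  induction n with
  | zero => simp [transferSum]
  | succ n ih =>
    rw [Finset.sum_range_succ, ih, Finset.sum_range_succ, Finset.sum_range_succ]
    have e : fiberMap T (n + 1) ω x = T (ω n) (fiberMap T n ω x) := by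
      rw [fiberMap_add, fiberMap_one]; simp [RandomSkew.shift]
    have e2 : ∑ i ∈ Finset.range (n + 1), transported m L h φ ω i (n - i) (fiberMap T n ω x) =
        transferSum m L h φ ω n (fiberMap T n ω x) +
          (obs T φ n ω x - fiberMean m h φ (RandomSkew.shift n ω)) := by
      rw [Finset.sum_range_succ, Nat.sub_self]
      simp [transferSum, transported, iter, obs, RandomSkew.shift]
    rw [martingaleDiff, e2, e]
    ring

/-- Moments of the Birkhoff sums on a fibre, centred by the fibrewise means. -/
theorem integral_fiber_pow_le (hω : IsGood m v L h K φ M lam ω) (n p : ℕ) (hn : 1 ≤ n)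
    (hp : 1 ≤ p) :
    ∫ x, (∑ j ∈ Finset.range n, obs T φ j ω x -
      ∑ j ∈ Finset.range n, fiberMean m h φ (RandomSkew.shift j ω)) ^ (2 * p)
        ∂(fiberMeasure m h ω) ≤
      (700 * (2 * (C * M) / (1 - Real.exp (-lam))) ^ 2 * n * p) ^ p := by
  set U := 2 * (C * M) / (1 - Real.exp (-lam)) with hU
  have hCM := S.one_le_CM
  have hU0 : 0 < U := by
    have h5 : Real.exp (-lam) < 1 := Real.exp_lt_one_iff.2 (by linarith [S.lam_pos])
    exact div_pos (by linarith) (by linarith)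
  have := S.isProbabilityMeasure_fiber hω.fiberAt
  have hprob : ∀ i : ℕ, IsProbabilityMeasure (fiberMeasure m h (RandomSkew.shift (i : ℤ) ω)) :=
    fun i => S.isProbabilityMeasure_fiber (hω i)
  have hmart := integral_martingale_pow_le (b := 3 * U) (by positivity) n p hn hp
    (fun i : ℕ => fiberMeasure m h (RandomSkew.shift (i : ℤ) ω)) (fun i : ℕ => T (ω i))
    (martingaleDiff m T L h φ ω) (fun i => by
      have := S.measurePreserving_fiberMap (hω.shift i) 1
      rw [shift_natCast_add] at this
      simpa [fiberMap_one, RandomSkew.shift] using this)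
    (S.measurable_martingaleDiff hω) (S.abs_martingaleDiff_le hω)
    (fun i F hF hFb => S.integral_martingaleDiff_mul hω i hF hFb)
  simp only [Nat.cast_zero, shift_zero, seqComp_eq_fiberMap] at hmart
  simp only [sum_martingaleDiff (m := m) (L := L) (h := h)] at hmart
  set R : X → ℝ := fun x => ∑ j ∈ Finset.range n, obs T φ j ω x -
    ∑ j ∈ Finset.range n, fiberMean m h φ (RandomSkew.shift j ω) with hR
  set u : X → ℝ := fun x => transferSum m L h φ ω n (fiberMap T n ω x) with hu
  have hRm : Measurable R := (Finset.measurable_fun_sum _ fun j _ =>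
    measurable_obs S.skew_measurable S.φ_measurable j ω).sub_const _
  have hum : Measurable u :=
    (S.measurable_transferSum hω n).comp (measurable_fiberMap S.skew_measurable n ω)
  have hub : ∀ x, |u x| ≤ U := fun x => S.abs_transferSum_le hω n _
  have hRb : ∀ x, |R x| ≤ n * (C * M) + n * (C * M) := by
    intro x
    have h1 : |∑ j ∈ Finset.range n, obs T φ j ω x| ≤ n * (C * M) :=
      (Finset.abs_sum_le_sum_abs _ _).trans
        ((Finset.sum_le_sum fun j _ => S.abs_obs_le hω j x).trans (by simp))
    have h2 : |∑ j ∈ Finset.range n, fiberMean m h φ (RandomSkew.shift j ω)| ≤ n * (C * M) :=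
      (Finset.abs_sum_le_sum_abs _ _).trans
        ((Finset.sum_le_sum fun j _ => S.abs_fiberMean_le (hω.shift j)).trans (by simp))
    exact (abs_sub _ _).trans (by linarith)
  have hpt : ∀ x, R x ^ (2 * p) ≤ 4 ^ p * ((R x - u x) ^ (2 * p) + U ^ (2 * p)) := by
    intro x
    have h1 : |R x| ^ (2 * p) ≤ (|R x - u x| + U) ^ (2 * p) := by
      refine pow_le_pow_left₀ (abs_nonneg _) ?_ _
      have := abs_add_le (R x - u x) (u x)
      rw [sub_add_cancel] at this
      linarith [hub x]
    have h2 := add_pow_le (abs_nonneg (R x - u x)) hU0.le (2 * p)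
    have he : Even (2 * p) := even_two_mul p
    rw [he.pow_abs] at h1 h2
    refine h1.trans (h2.trans ?_)
    have h3 : (0 : ℝ) ≤ (R x - u x) ^ (2 * p) := he.pow_nonneg _
    have h4 : (2 : ℝ) ^ (2 * p - 1) ≤ 4 ^ p := by
      rw [show (4 : ℝ) = 2 ^ 2 by norm_num, ← pow_mul]
      exact pow_le_pow_right₀ (by norm_num) (by omega)
    gcongr
  have hbd : Integrable (fun x => (R x - u x) ^ (2 * p)) (fiberMeasure m h ω) := by
    refine integrable_of_bdd ((hRm.sub hum).pow_const _).aestronglyMeasurable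
      ((n * (C * M) + n * (C * M) + U) ^ (2 * p)) (ae_of_all _ fun x => ?_)
    rw [abs_pow]
    exact pow_le_pow_left₀ (abs_nonneg _) ((abs_sub _ _).trans (add_le_add (hRb x) (hub x))) _
  have hbd2 : Integrable (fun x => R x ^ (2 * p)) (fiberMeasure m h ω) := by
    refine integrable_of_bdd (hRm.pow_const _).aestronglyMeasurable
      ((n * (C * M) + n * (C * M)) ^ (2 * p)) (ae_of_all _ fun x => ?_)
    rw [abs_pow]
    exact pow_le_pow_left₀ (abs_nonneg _) (hRb x) _
  have hn' : (1 : ℝ) ≤ n := by exact_mod_cast hn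
  have hp' : (1 : ℝ) ≤ p := by exact_mod_cast hp
  have hnp : (1 : ℝ) ≤ n * p := one_le_mul_of_one_le_of_one_le hn' hp'
  -- The martingale differences are bounded by `3 U` and the coboundary by `U`. The constant
  -- obtained is `3 · 4 · 6 · 3² = 648`, rounded up to `700`.
  calc ∫ x, R x ^ (2 * p) ∂(fiberMeasure m h ω)
      ≤ ∫ x, 4 ^ p * ((R x - u x) ^ (2 * p) + U ^ (2 * p)) ∂(fiberMeasure m h ω) :=
        integral_mono hbd2 ((hbd.add (integrable_const _)).const_mul _) hpt
    _ = 4 ^ p * (∫ x, (R x - u x) ^ (2 * p) ∂(fiberMeasure m h ω) + U ^ (2 * p)) := by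
        rw [integral_const_mul, integral_add hbd (integrable_const _)]
        simp
    _ ≤ 4 ^ p * (2 * (6 * (3 * U) ^ 2 * n * p) ^ p + (6 * (3 * U) ^ 2 * n * p) ^ p) := by
        refine mul_le_mul_of_nonneg_left (add_le_add hmart ?_) (by positivity)
        rw [pow_mul]
        refine pow_le_pow_left₀ (by positivity) ?_ _
        nlinarith [sq_nonneg U]
    _ = 3 * (4 * (6 * (3 * U) ^ 2 * n * p)) ^ p := by rw [mul_pow 4]; ring
    _ ≤ 3 ^ p * (4 * (6 * (3 * U) ^ 2 * n * p)) ^ p := by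
        gcongr
        exact le_self_pow₀ (by norm_num) (by omega)
    _ = (648 * U ^ 2 * n * p) ^ p := by rw [← mul_pow]; congr 1; ring
    _ ≤ _ := by gcongr; norm_num

end System

end Fiber


/-! ### Dependence on coordinates -/

section Coordinates

variable {𝒴 X : Type*} {T : 𝒴 → X → X} {φ : 𝒴 → X → ℝ}

theorem fiberMap_congr {n : ℕ} {ω ω' : ℤ → 𝒴} (h : ∀ k : ℕ, k < n → ω k = ω' k) :
    fiberMap T n ω = fiberMap T n ω' := by
  induction n generalizing ω ω' with
  | zero => rfl
  | succ n ih =>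
    have h1 : fiberMap T n (shift 1 ω) = fiberMap T n (shift 1 ω') := ih fun k hk => by
      simpa [shift] using h (k + 1) (by omega)
    have h2 : ω 0 = ω' 0 := by simpa using h 0 (by omega)
    ext x
    have e := fiberMap_add T 1 n
    rw [add_comm n 1, e ω x, e ω' x]
    simp only [fiberMap_one, Nat.cast_one, h1, h2]

theorem obs_congr {n : ℕ} {ω ω' : ℤ → 𝒴} (h : ∀ k : ℕ, k ≤ n → ω k = ω' k) :
    obs T φ n ω = obs T φ n ω' := by
  ext x
  simp only [obs, h n le_rfl, fiberMap_congr (T := T) (fun k hk => h k hk.le)]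

/-- Started from `m`, the moment no longer involves `h`, so only the coordinates between the start
and the last time matter. `fiberMoment` lacks this property, and it is what lets mixing of the path
enter. -/
theorem startedMoment_congr [MeasurableSpace X] {m : Measure X} {ι : Type*} {t : ι → ℕ}
    {A : Finset ι} {s a : ℕ} {ω ω' : ℤ → 𝒴} (hs : ∀ i ∈ A, s ≤ t i) (ha : ∀ i ∈ A, t i ≤ a)
    (h : ∀ k : ℤ, s ≤ k → k ≤ a → ω k = ω' k) :
    startedMoment m T φ t A s ω = startedMoment m T φ t A s ω' := by
  unfold startedMoment
  congr 1; ext x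
  refine Finset.prod_congr rfl fun i hi => ?_
  rw [obs_congr (T := T) (φ := φ) (ω := shift s ω) (ω' := shift s ω') fun k hk => ?_]
  have := hs i hi
  have := ha i hi
  exact h _ (by omega) (by omega)

end Coordinates

/-! ### The global system -/

theorem System.integral_fiber_real {𝒴 X : Type*} [MeasurableSpace 𝒴] [MeasurableSpace X]
    {m : Measure X} {v : (X → ℂ) → ℝ≥0∞} {T : 𝒴 → X → X} {L : 𝒴 → (X → ℂ) → (X → ℂ)}
    {h : (ℤ → 𝒴) → X → ℝ} {K : (ℤ → 𝒴) → ℝ} {φ : 𝒴 → X → ℝ} {C M lam : ℝ}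
    (S : System m v T L h K φ C M lam) (ω : ℤ → 𝒴) (f : X → ℝ) :
    ∫ x, f x ∂(fiberMeasure m h ω) = ∫ x, h ω x * f x ∂m := by
  unfold fiberMeasure
  rw [integral_withDensity_eq_integral_toReal_smul (S.measurable_h ω).ennreal_ofReal
    (ae_of_all _ fun _ => ENNReal.ofReal_lt_top)]
  refine integral_congr_ae (ae_of_all _ fun x => ?_)
  simp only [ENNReal.toReal_ofReal (S.h_nonneg ω x), smul_eq_mul]

set_option linter.unusedSectionVars false

section Global

variable {Ω₀ 𝒴 X : Type*} [MeasurableSpace Ω₀] [MeasurableSpace 𝒴] [MeasurableSpace X]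

/-- The assumptions of the moment estimates, with normalized constants. -/
structure MixingSystem (P : Measure Ω₀) (ξ : ℤ → Ω₀ → 𝒴) (m : Measure X) (v : (X → ℂ) → ℝ≥0∞)
    (T : 𝒴 → X → X) (L : 𝒴 → (X → ℂ) → (X → ℂ)) (h : (ℤ → 𝒴) → X → ℝ) (K : (ℤ → 𝒴) → ℝ)
    (φ : 𝒴 → X → ℝ) (C M lam c₁ c₂ η : ℝ) : Prop where
  system : System m v T L h K φ C M lam
  measurable_ξ : ∀ k, Measurable (ξ k)
  isProb : IsProbabilityMeasure (skewMeasure (pathLaw P ξ) m h)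
  shift_preserving : ∀ n : ℕ, MeasurePreserving (shift n) (pathLaw P ξ) (pathLaw P ξ)
  invariant : MeasurePreserving (skew T) (skewMeasure (pathLaw P ξ) m h)
    (skewMeasure (pathLaw P ξ) m h)
  good : ∀ᵐ ω ∂(pathLaw P ξ), IsGood m v L h K φ M lam ω
  c₁_pos : 0 < c₁
  c₂_pos : 0 < c₂
  η_pos : 0 < η
  alpha_le : ∀ n : ℕ, 1 ≤ n → alphaMixing P ξ n ≤ c₁ * Real.exp (-c₂ * (n : ℝ) ^ η)
  mean_zero : ∫ z, φ (z.1 0) z.2 ∂(skewMeasure (pathLaw P ξ) m h) = 0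

theorem isProbabilityMeasure_pathLaw {P : Measure Ω₀} [IsProbabilityMeasure P] {ξ : ℤ → Ω₀ → 𝒴}
    (hξ : ∀ k, Measurable (ξ k)) : IsProbabilityMeasure (pathLaw P ξ) :=
  Measure.isProbabilityMeasure_map (measurable_pi_iff.2 hξ).aemeasurable

theorem IsStationaryProcess.measurePreserving_shift {P : Measure Ω₀} {ξ : ℤ → Ω₀ → 𝒴}
    (hξ : IsStationaryProcess P ξ) (n : ℕ) :
    MeasurePreserving (shift n) (pathLaw P ξ) (pathLaw P ξ) := by
  have h1 : MeasurePreserving (shift 1) (pathLaw P ξ) (pathLaw P ξ) := by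
    refine ⟨measurable_shift 1, ?_⟩
    conv_rhs => rw [← hξ.stationary]
    unfold pathLaw
    rw [Measure.map_map (measurable_shift 1) (measurable_pi_iff.2 hξ.measurable)]
    rfl
  induction n with
  | zero =>
    have : (shift ((0 : ℕ) : ℤ) : (ℤ → 𝒴) → ℤ → 𝒴) = id := by ext ω : 1; simp
    rw [this]; exact MeasurePreserving.id _
  | succ n ih =>
    have h2 := h1.comp ih
    have : (shift ((n + 1 : ℕ) : ℤ) : (ℤ → 𝒴) → ℤ → 𝒴) = shift 1 ∘ shift n := by
      ext ω : 1
      rw [Function.comp_apply, shift_shift]; congr 1; push_cast; ring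
    rwa [this]

/-- The standing assumptions give a mixing system. -/
theorem StandingAssumption.mixingSystem {P : Measure Ω₀} [IsProbabilityMeasure P]
    {ξ : ℤ → Ω₀ → 𝒴} {m : Measure X} [IsProbabilityMeasure m] {v : (X → ℂ) → ℝ≥0∞}
    {T : 𝒴 → X → X} {L : 𝒴 → (X → ℂ) → (X → ℂ)} {h : (ℤ → 𝒴) → X → ℝ} {K : (ℤ → 𝒴) → ℝ}
    {φ : 𝒴 → X → ℝ} {C₀ M lam c₁ c₂ η : ℝ} (hc₁ : 0 < c₁) (hc₂ : 0 < c₂) (hη : 0 < η)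
    (hlam : 0 < lam) (hξ : IsStationaryProcess P ξ) (hv : IsVariation m v C₀)
    (hT : Measurable (skew T)) (hL : ∀ y, IsTransferOperator m (T y) (L y))
    (H : StandingAssumption (pathLaw P ξ) m v T L h K lam)
    (hα : ∀ n : ℕ, 1 ≤ n → alphaMixing P ξ n ≤ c₁ * Real.exp (-c₂ * (n : ℝ) ^ η))
    (hφ : Measurable (Function.uncurry φ))
    (h0 : ∫ z, φ (z.1 0) z.2 ∂(skewMeasure (pathLaw P ξ) m h) = 0)
    (hM : scaledNorm (pathLaw P ξ) m v K φ ≤ ENNReal.ofReal M) :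
    MixingSystem P ξ m v T L h K φ (max C₀ 1) (max M 1) lam c₁ c₂ η := by
  obtain ⟨ε, hε0, hεlam, hK⟩ := H.K_tempered
  refine ⟨⟨hv.mono (le_max_left _ _), le_max_right _ _, le_max_right _ _, hlam, hT, hL,
    H.h_measurable, H.h_nonneg, hK.one_le, hφ⟩, hξ.measurable, H.isProb,
    hξ.measurePreserving_shift, H.invariant, ?_, hc₁, hc₂, hη, hα, h0⟩
  -- The assumptions hold for almost every `ω`. Pulling them back along the measure-preserving
  -- powers of the shift gives them simultaneously along the whole forward orbit.
  refine ae_all_iff.2 fun k => (hξ.measurePreserving_shift k).quasiMeasurePreserving.ae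
    (p := fun ω => FiberAt m v L h K φ (max M 1) lam ω) ?_
  have hφae : ∀ᵐ ω ∂(pathLaw P ξ), ENNReal.ofReal (K ω) *
      bvNorm m v (fun x => (φ (ω 0) x : ℂ)) ≤ ENNReal.ofReal M := by
    filter_upwards [ENNReal.ae_le_essSup (μ := pathLaw P ξ)
      (fun ω => ENNReal.ofReal (K ω) * bvNorm m v (fun x => (φ (ω 0) x : ℂ)))] with ω hω
    exact hω.trans hM
  filter_upwards [H.h_integral, H.h_pos, H.h_equivariant, H.decay_one, H.decay, hK.slow, hφae]
    with ω h1 h2 h3 h4 h5 h6 h7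
  refine ⟨h1, h2, h3, fun n => ?_, h4, h5, h7.trans (by gcongr; exact le_max_left _ _)⟩
  have h8 := (h6 n).1
  have hKp : 0 ≤ K (shift n ω) := zero_le_one.trans (hK.one_le _)
  have h9 : K ω = K ω * Real.exp (-ε * |((n : ℤ) : ℝ)|) * Real.exp (ε * n) := by
    rw [mul_assoc, ← Real.exp_add]
    simp
  rw [h9]
  have hn : (0 : ℝ) ≤ n := Nat.cast_nonneg n
  exact mul_le_mul h8 (Real.exp_le_exp.2 (by gcongr)) (Real.exp_pos _).le hKp

variable {P : Measure Ω₀} [IsProbabilityMeasure P] {ξ : ℤ → Ω₀ → 𝒴} {m : Measure X}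
  [IsProbabilityMeasure m] {v : (X → ℂ) → ℝ≥0∞}
  {T : 𝒴 → X → X} {L : 𝒴 → (X → ℂ) → (X → ℂ)} {h : (ℤ → 𝒴) → X → ℝ} {K : (ℤ → 𝒴) → ℝ}
  {φ : 𝒴 → X → ℝ} {C M lam c₁ c₂ η : ℝ}

namespace MixingSystem

variable (S : MixingSystem P ξ m v T L h K φ C M lam c₁ c₂ η)
include S

theorem measurable_integral_fiber {F : (ℤ → 𝒴) × X → ℝ} (hF : Measurable F) :
    Measurable fun ω => ∫ x, F (ω, x) ∂(fiberMeasure m h ω) := by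
  simp_rw [S.system.integral_fiber_real]
  have : Measurable fun z : (ℤ → 𝒴) × X => h z.1 z.2 * F z := S.system.h_measurable.mul hF
  exact (this.stronglyMeasurable.integral_prod_right' (ν := m)).measurable

theorem integral_eq {F : (ℤ → 𝒴) × X → ℝ} (hF : Integrable F (skewMeasure (pathLaw P ξ) m h)) :
    ∫ z, F z ∂(skewMeasure (pathLaw P ξ) m h) =
      ∫ ω, ∫ x, F (ω, x) ∂(fiberMeasure m h ω) ∂(pathLaw P ξ) := by
  have := isProbabilityMeasure_pathLaw (P := P) S.measurable_ξ
  have hm : Measurable fun z : (ℤ → 𝒴) × X => ENNReal.ofReal (h z.1 z.2) :=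
    S.system.h_measurable.ennreal_ofReal
  unfold skewMeasure at hF ⊢
  rw [integrable_withDensity_iff_integrable_smul' hm (ae_of_all _ fun _ => ENNReal.ofReal_lt_top)]
    at hF
  rw [integral_withDensity_eq_integral_toReal_smul hm (ae_of_all _ fun _ => ENNReal.ofReal_lt_top),
    integral_prod _ hF]
  refine integral_congr_ae (ae_of_all _ fun ω => ?_)
  simp only [S.system.integral_fiber_real, ENNReal.toReal_ofReal (S.system.h_nonneg _ _), smul_eq_mul]

theorem ae_of_ae {p : (ℤ → 𝒴) × X → Prop} (hp : ∀ᵐ ω ∂(pathLaw P ξ), ∀ x, p (ω, x)) :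
    ∀ᵐ z ∂(skewMeasure (pathLaw P ξ) m h), p z := by
  have := isProbabilityMeasure_pathLaw (P := P) S.measurable_ξ
  refine (withDensity_absolutelyContinuous _ _).ae_le ?_
  have h1 := (Measure.quasiMeasurePreserving_fst (μ := pathLaw P ξ) (ν := m)).ae hp
  filter_upwards [h1] with z hz
  exact hz z.2

theorem ae_abs_obs_le (t : ℕ) :
    ∀ᵐ z ∂(skewMeasure (pathLaw P ξ) m h), |obs T φ t z.1 z.2| ≤ C * M := by
  refine S.ae_of_ae ?_
  filter_upwards [S.good] with ω hω x
  exact S.system.abs_obs_le hω t x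

theorem measurable_obs (t : ℕ) : Measurable fun z : (ℤ → 𝒴) × X => obs T φ t z.1 z.2 :=
  measurable_obs_uncurry S.system.skew_measurable S.system.φ_measurable t

theorem integral_comp_skew (r : ℕ) {F : (ℤ → 𝒴) × X → ℝ} (hF : Measurable F) :
    ∫ z, F ((skew T)^[r] z) ∂(skewMeasure (pathLaw P ξ) m h) =
      ∫ z, F z ∂(skewMeasure (pathLaw P ξ) m h) := by
  have h1 := S.invariant.iterate r
  conv_rhs => rw [← h1.map_eq]
  rw [integral_map h1.measurable.aemeasurable hF.aestronglyMeasurable]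

theorem jointMoment_eq {ι : Type*} (t : ι → ℕ) (A : Finset ι) :
    jointMoment (skewMeasure (pathLaw P ξ) m h) (fun t z => obs T φ t z.1 z.2) t A =
      ∫ ω, fiberMoment m T h φ t A ω ∂(pathLaw P ξ) := by
  have := S.isProb
  refine S.integral_eq (integrable_of_bdd
    (Finset.measurable_fun_prod _ fun i _ => S.measurable_obs _).aestronglyMeasurable
    ((C * M) ^ A.card) (S.ae_of_ae ?_))
  filter_upwards [S.good] with ω hω x
  exact S.system.abs_prod_obs_le hω t A x

theorem jointMoment_add {ι : Type*} (t : ι → ℕ) (A : Finset ι) (r : ℕ) :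
    jointMoment (skewMeasure (pathLaw P ξ) m h) (fun t z => obs T φ t z.1 z.2) (fun i => t i + r) A =
      jointMoment (skewMeasure (pathLaw P ξ) m h) (fun t z => obs T φ t z.1 z.2) t A := by
  unfold jointMoment
  rw [← S.integral_comp_skew r (F := fun z => ∏ i ∈ A, obs T φ (t i) z.1 z.2)
    (Finset.measurable_fun_prod _ fun i _ => S.measurable_obs _)]
  congr 1; ext ⟨ω, x⟩
  simp only [skew_iterate]
  refine Finset.prod_congr rfl fun i _ => ?_
  rw [add_comm, obs_add]

theorem measurable_fiberMoment {ι : Type*} (t : ι → ℕ) (A : Finset ι) :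
    Measurable (fiberMoment m T h φ t A) :=
  S.measurable_integral_fiber (F := fun z => ∏ i ∈ A, obs T φ (t i) z.1 z.2)
    (Finset.measurable_fun_prod _ fun _ _ => S.measurable_obs _)

theorem measurable_startedMoment {ι : Type*} (t : ι → ℕ) (A : Finset ι) (s : ℕ) :
    Measurable (startedMoment m T φ t A s) := by
  have h1 : Measurable fun z : (ℤ → 𝒴) × X => ∏ i ∈ A, obs T φ (t i - s) (RandomSkew.shift s z.1) z.2 :=
    Finset.measurable_fun_prod _ fun i _ =>
      (S.measurable_obs (t i - s)).comp (((measurable_shift s).comp measurable_fst).prodMk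
        measurable_snd)
  exact (h1.stronglyMeasurable.integral_prod_right' (ν := m)).measurable

/-- Covariances of almost surely bounded functions of the past and of the future. -/
theorem abs_cov_le {F G : (ℤ → 𝒴) → ℝ} {a b : ℝ} (ha : 0 ≤ a) (hb : 0 ≤ b)
    (hF : Measurable F) (hFa : ∀ᵐ ω ∂(pathLaw P ξ), |F ω| ≤ a) (hG : Measurable G)
    (hGb : ∀ᵐ ω ∂(pathLaw P ξ), |G ω| ≤ b) (k : ℤ) (n : ℕ) (hn : 1 ≤ n)
    (hFk : ∀ ω, F (fun j => ω (min j k)) = F ω)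
    (hGk : ∀ ω, G (fun j => ω (max j (k + n))) = G ω) :
    |∫ ω, F ω * G ω ∂(pathLaw P ξ) - (∫ ω, F ω ∂(pathLaw P ξ)) * ∫ ω, G ω ∂(pathLaw P ξ)| ≤
      4 * a * b * (c₁ * Real.exp (-c₂ * (n : ℝ) ^ η)) := by
  -- The covariance bound on the path space asks for bounds at every point. Truncation supplies
  -- them: it changes the functions only on null sets and keeps the coordinates on which they
  -- depend.
  have hclip : ∀ (c x : ℝ), 0 ≤ c → |max (-c) (min c x)| ≤ c := fun c x hc =>
    abs_le.2 ⟨le_max_left _ _, max_le (by linarith) (min_le_left _ _)⟩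
  have hclip' : ∀ (c x : ℝ), |x| ≤ c → max (-c) (min c x) = x := fun c x hx => by
    rw [min_eq_right (abs_le.1 hx).2, max_eq_right (abs_le.1 hx).1]
  have hFG : ∫ ω, max (-a) (min a (F ω)) * max (-b) (min b (G ω)) ∂(pathLaw P ξ) =
      ∫ ω, F ω * G ω ∂(pathLaw P ξ) := by
    refine integral_congr_ae ?_
    filter_upwards [hFa, hGb] with ω h1 h2
    rw [hclip' a _ h1, hclip' b _ h2]
  have h1 := abs_cov_pathLaw_le (P := P) S.measurable_ξ
    (F := fun ω => max (-a) (min a (F ω))) (G := fun ω => max (-b) (min b (G ω)))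
    (measurable_const.max (measurable_const.min hF)) (fun ω => hclip a _ ha)
    (measurable_const.max (measurable_const.min hG)) (fun ω => hclip b _ hb) k n
    (fun ω => by simp only [hFk]) (fun ω => by simp only [hGk])
  have hFe : (fun ω => max (-a) (min a (F ω))) =ᵐ[pathLaw P ξ] F := by
    filter_upwards [hFa] with ω hω; exact hclip' a _ hω
  have hGe : (fun ω => max (-b) (min b (G ω))) =ᵐ[pathLaw P ξ] G := by
    filter_upwards [hGb] with ω hω; exact hclip' b _ hω
  rw [integral_congr_ae hFe, integral_congr_ae hGe, hFG] at h1
  exact h1.trans (mul_le_mul_of_nonneg_left (S.alpha_le n hn) (by positivity))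

/-- Joint moments of `φ ∘ τ^t` factor over time gaps. -/
theorem momentMixing : MomentMixing (skewMeasure (pathLaw P ξ) m h)
    (fun t z => obs T φ t z.1 z.2) (7 * (C * M))
    (fun g => C * Real.exp (-lam * g) + 8 * Real.exp (-(2 * lam / 3) * ((g / 2 : ℕ) : ℝ)) +
      4 * (c₁ * Real.exp (-c₂ * ((g - g / 2 : ℕ) : ℝ) ^ η))) := by
  intro ι _ τ A B a g hAB hA hB
  have hQ := isProbabilityMeasure_pathLaw (P := P) S.measurable_ξ
  have hμ := S.isProb
  have hCM := S.system.one_le_CM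
  set c := C * M with hc
  have hc0 : 0 ≤ c := by linarith
  have hC := S.system.one_le_C
  have hc₁ := S.c₁_pos
  have hpow : c ^ (A.card + B.card) ≤ (7 * c) ^ (A.card + B.card) :=
    pow_le_pow_left₀ hc0 (by linarith) _
  have hpow0 : 0 ≤ c ^ (A.card + B.card) := by positivity
  -- By invariance all times may be delayed by `g`. This leaves `g` free steps before the block `A`,
  -- so that its moment too can be started from `m`, at time `0`.
  set t : ι → ℕ := fun i => τ i + g with ht
  rw [← S.jointMoment_add τ (A ∪ B) g, ← S.jointMoment_add τ A g, ← S.jointMoment_add τ B g,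
    S.jointMoment_eq, S.jointMoment_eq, S.jointMoment_eq]
  set fU := fiberMoment m T h φ t (A ∪ B) with hfU
  set fA := fiberMoment m T h φ t A with hfA
  set fB := fiberMoment m T h φ t B with hfB
  have hUm : Measurable fU := S.measurable_fiberMoment _ _
  have hAm : Measurable fA := S.measurable_fiberMoment _ _
  have hBm : Measurable fB := S.measurable_fiberMoment _ _
  have hUb : ∀ᵐ ω ∂(pathLaw P ξ), |fU ω| ≤ c ^ (A.card + B.card) := by
    filter_upwards [S.good] with ω hω
    rw [← Finset.card_union_of_disjoint hAB]
    exact S.system.abs_fiberMoment_le hω _ _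
  have hAb : ∀ᵐ ω ∂(pathLaw P ξ), |fA ω| ≤ c ^ A.card := by
    filter_upwards [S.good] with ω hω; exact S.system.abs_fiberMoment_le hω _ _
  have hBb : ∀ᵐ ω ∂(pathLaw P ξ), |fB ω| ≤ c ^ B.card := by
    filter_upwards [S.good] with ω hω; exact S.system.abs_fiberMoment_le hω _ _
  have hIA := abs_integral_le_of_bdd _ hAb
  have hIB := abs_integral_le_of_bdd _ hBb
  have hIU := abs_integral_le_of_bdd _ hUb
  have hUi := integrable_of_bdd hUm.aestronglyMeasurable _ hUb
  have hABb : ∀ᵐ ω ∂(pathLaw P ξ), |fA ω * fB ω| ≤ c ^ (A.card + B.card) := by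
    filter_upwards [hAb, hBb] with ω h1 h2
    rw [abs_mul, pow_add]; gcongr
  have hABi : Integrable (fun ω => fA ω * fB ω) (pathLaw P ξ) := integrable_of_bdd (hAm.mul hBm).aestronglyMeasurable _ hABb
  rcases Nat.eq_zero_or_pos g with hg0 | hg0
  · subst hg0
    have h3 : |(∫ ω, fA ω ∂(pathLaw P ξ)) * ∫ ω, fB ω ∂(pathLaw P ξ)| ≤ c ^ (A.card + B.card) := by
      rw [abs_mul, pow_add]; gcongr
    refine (abs_sub _ _).trans ?_
    have h4 : (2 : ℝ) ≤ C * Real.exp (-lam * (0 : ℕ)) +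
        8 * Real.exp (-(2 * lam / 3) * ((0 / 2 : ℕ) : ℝ)) +
        4 * (c₁ * Real.exp (-c₂ * ((0 - 0 / 2 : ℕ) : ℝ) ^ η)) := by
      have : 0 ≤ 4 * (c₁ * Real.exp (-c₂ * ((0 - 0 / 2 : ℕ) : ℝ) ^ η)) := by positivity
      simp only [Nat.cast_zero, mul_zero, Real.exp_zero, Nat.zero_div] at this ⊢
      linarith
    calc _ ≤ c ^ (A.card + B.card) * 2 := by linarith
      _ ≤ _ := mul_le_mul hpow h4 (by norm_num) (by positivity)
  -- functions of separated blocks of coordinates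
  set s := a + g + (g - g / 2) with hs
  have htA : ∀ i ∈ A, 0 + g ≤ t i := fun i _ => by simp only [ht]; omega
  have htA' : ∀ i ∈ A, t i ≤ a + g := fun i hi => by have := hA i hi; simp only [ht]; omega
  have htB : ∀ i ∈ B, s + g / 2 ≤ t i := fun i hi => by have := hB i hi; simp only [ht]; omega
  set F := startedMoment m T φ t A 0 with hF
  set G := startedMoment m T φ t B s with hG
  have hFm : Measurable F := S.measurable_startedMoment _ _ _
  have hGm : Measurable G := S.measurable_startedMoment _ _ _
  have hFb : ∀ᵐ ω ∂(pathLaw P ξ), |F ω| ≤ c ^ A.card := by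
    filter_upwards [S.good] with ω hω; exact S.system.abs_startedMoment_le hω _ _ _
  have hGb : ∀ᵐ ω ∂(pathLaw P ξ), |G ω| ≤ c ^ B.card := by
    filter_upwards [S.good] with ω hω; exact S.system.abs_startedMoment_le hω _ _ _
  set e := Real.exp (-(2 * lam / 3) * ((g / 2 : ℕ) : ℝ)) with he
  have he0 : 0 < e := Real.exp_pos _
  have hFA : ∀ᵐ ω ∂(pathLaw P ξ), |fA ω - F ω| ≤ 2 * c ^ A.card * e := by
    filter_upwards [S.good] with ω hω
    refine (S.system.abs_fiberMoment_sub_started_le hω t A 0 g htA).trans ?_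
    refine mul_le_mul_of_nonneg_left (Real.exp_le_exp.2 ?_) (by positivity)
    have : ((g / 2 : ℕ) : ℝ) ≤ g := by exact_mod_cast Nat.div_le_self g 2
    nlinarith [S.system.lam_pos]
  have hGB : ∀ᵐ ω ∂(pathLaw P ξ), |fB ω - G ω| ≤ 2 * c ^ B.card * e := by
    filter_upwards [S.good] with ω hω
    exact S.system.abs_fiberMoment_sub_started_le hω t B s (g / 2) htB
  have hFGb : ∀ᵐ ω ∂(pathLaw P ξ), |F ω * G ω| ≤ c ^ (A.card + B.card) := by
    filter_upwards [hFb, hGb] with ω h1 h2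
    rw [abs_mul, pow_add]; gcongr
  have hFGi : Integrable (fun ω => F ω * G ω) (pathLaw P ξ) := integrable_of_bdd (hFm.mul hGm).aestronglyMeasurable _ hFGb
  have hFi := integrable_of_bdd hFm.aestronglyMeasurable _ hFb
  have hGi := integrable_of_bdd hGm.aestronglyMeasurable _ hGb
  have hAi := integrable_of_bdd hAm.aestronglyMeasurable _ hAb
  have hBi := integrable_of_bdd hBm.aestronglyMeasurable _ hBb
  have hcov := S.abs_cov_le (a := c ^ A.card) (b := c ^ B.card) (by positivity) (by positivity)
    hFm hFb hGm hGb ((a + g : ℕ) : ℤ) (g - g / 2) (by omega)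
    (fun ω => startedMoment_congr (fun i _ => Nat.zero_le _) htA' fun k _ hk => by
      rw [min_eq_left hk])
    (fun ω => startedMoment_congr (a := ∑ i ∈ B, t i) (fun i hi => by have := htB i hi; omega)
      (fun i hi => Finset.single_le_sum (fun _ _ => Nat.zero_le _) hi) fun k hk _ => by
      rw [max_eq_left]; push_cast [hs] at hk ⊢; exact hk)
  have d1 : |∫ ω, fU ω ∂(pathLaw P ξ) - ∫ ω, fA ω * fB ω ∂(pathLaw P ξ)| ≤
      (7 * c) ^ (A.card + B.card) * (C * Real.exp (-lam * g)) := by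
    rw [← integral_sub hUi hABi]
    refine abs_integral_le_of_bdd _ ?_
    filter_upwards [S.good] with ω hω
    refine (S.system.abs_fiberMoment_union_sub_le hω t A B hAB (a + g) g htA' fun i hi => ?_).trans
      (le_of_eq (by ring))
    have := hB i hi; simp only [ht]; omega
  have d2 : |∫ ω, fA ω * fB ω ∂(pathLaw P ξ) - ∫ ω, F ω * G ω ∂(pathLaw P ξ)| ≤
      4 * c ^ (A.card + B.card) * e := by
    rw [← integral_sub hABi hFGi]
    refine abs_integral_le_of_bdd _ ?_
    filter_upwards [hBb, hFb, hFA, hGB] with ω h2 h3 h4 h5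
    calc |fA ω * fB ω - F ω * G ω| = |(fA ω - F ω) * fB ω + F ω * (fB ω - G ω)| := by
          congr 1; ring
      _ ≤ |fA ω - F ω| * |fB ω| + |F ω| * |fB ω - G ω| := by
          rw [← abs_mul, ← abs_mul]; exact abs_add_le _ _
      _ ≤ (2 * c ^ A.card * e) * c ^ B.card + c ^ A.card * (2 * c ^ B.card * e) := by gcongr
      _ = _ := by rw [pow_add]; ring
  have d3 : |(∫ ω, F ω ∂(pathLaw P ξ)) * (∫ ω, G ω ∂(pathLaw P ξ)) -
      (∫ ω, fA ω ∂(pathLaw P ξ)) * ∫ ω, fB ω ∂(pathLaw P ξ)| ≤ 4 * c ^ (A.card + B.card) * e := by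
    have h1 : |∫ ω, fA ω ∂(pathLaw P ξ) - ∫ ω, F ω ∂(pathLaw P ξ)| ≤ 2 * c ^ A.card * e := by
      rw [← integral_sub hAi hFi]; exact abs_integral_le_of_bdd _ hFA
    have h2 : |∫ ω, fB ω ∂(pathLaw P ξ) - ∫ ω, G ω ∂(pathLaw P ξ)| ≤ 2 * c ^ B.card * e := by
      rw [← integral_sub hBi hGi]; exact abs_integral_le_of_bdd _ hGB
    have h3 := abs_integral_le_of_bdd _ hFb
    rw [abs_sub_comm]
    generalize ∫ ω, fA ω ∂(pathLaw P ξ) = x at *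
    generalize ∫ ω, fB ω ∂(pathLaw P ξ) = y at *
    generalize ∫ ω, F ω ∂(pathLaw P ξ) = x' at *
    generalize ∫ ω, G ω ∂(pathLaw P ξ) = y' at *
    calc |x * y - x' * y'| = |(x - x') * y + x' * (y - y')| := by congr 1; ring
      _ ≤ |x - x'| * |y| + |x'| * |y - y'| := by
          rw [← abs_mul, ← abs_mul]; exact abs_add_le _ _
      _ ≤ (2 * c ^ A.card * e) * c ^ B.card + c ^ A.card * (2 * c ^ B.card * e) := by gcongr
      _ = _ := by rw [pow_add]; ring
  set E := c₁ * Real.exp (-c₂ * ((g - g / 2 : ℕ) : ℝ) ^ η) with hE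
  have hE0 : 0 ≤ E := by positivity
  have d4 : 4 * c ^ A.card * c ^ B.card * E ≤ (7 * c) ^ (A.card + B.card) * (4 * E) := by
    calc _ = c ^ (A.card + B.card) * (4 * E) := by rw [pow_add]; ring
      _ ≤ _ := by gcongr
  have d5 : c ^ (A.card + B.card) * e ≤ (7 * c) ^ (A.card + B.card) * e := by gcongr
  have d6 := abs_sub_le (∫ ω, fU ω ∂(pathLaw P ξ)) (∫ ω, fA ω * fB ω ∂(pathLaw P ξ))
    ((∫ ω, fA ω ∂(pathLaw P ξ)) * ∫ ω, fB ω ∂(pathLaw P ξ))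
  have d7 := abs_sub_le (∫ ω, fA ω * fB ω ∂(pathLaw P ξ)) (∫ ω, F ω * G ω ∂(pathLaw P ξ))
    ((∫ ω, fA ω ∂(pathLaw P ξ)) * ∫ ω, fB ω ∂(pathLaw P ξ))
  have d8 := abs_sub_le (∫ ω, F ω * G ω ∂(pathLaw P ξ))
    ((∫ ω, F ω ∂(pathLaw P ξ)) * ∫ ω, G ω ∂(pathLaw P ξ))
    ((∫ ω, fA ω ∂(pathLaw P ξ)) * ∫ ω, fB ω ∂(pathLaw P ξ))
  linarith

end MixingSystem

end Global


set_option linter.unusedSectionVars false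

/-! ### Even moments for few summands -/

theorem abs_pow_two_mul (x : ℝ) (p : ℕ) : |x| ^ (2 * p) = x ^ (2 * p) :=
  (even_two_mul p).pow_abs x

theorem pow_two_mul_le_of_abs_le {x a b : ℝ} (p : ℕ) (ha : 0 ≤ a) (hb : 0 ≤ b)
    (h : |x| ≤ a + b) : x ^ (2 * p) ≤ 4 ^ p * (a ^ (2 * p) + b ^ (2 * p)) := by
  rw [← abs_pow_two_mul]
  refine (pow_le_pow_left₀ (abs_nonneg _) h _).trans ((add_pow_le ha hb (2 * p)).trans ?_)
  have h4 : (2 : ℝ) ^ (2 * p - 1) ≤ 4 ^ p := by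
    rw [show (4 : ℝ) = 2 ^ 2 by norm_num, ← pow_mul]
    exact pow_le_pow_right₀ (by norm_num) (by omega)
  gcongr

theorem sum_pow_two_mul_le (R : ℕ) (a : ℕ → ℝ) (p : ℕ) (hp : 1 ≤ p) :
    (∑ i ∈ Finset.range R, a i) ^ (2 * p) ≤
      (R : ℝ) ^ (2 * p - 1) * ∑ i ∈ Finset.range R, a i ^ (2 * p) := by
  rcases Nat.eq_zero_or_pos R with rfl | hR
  · simp [show p ≠ 0 by omega]
  have h1 := pow_sum_div_card_le_sum_pow (s := Finset.range R) (f := fun i => |a i|)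
    (fun i _ => abs_nonneg _) (2 * p - 1)
  rw [Nat.sub_add_cancel (by omega), Finset.card_range,
    div_le_iff₀ (by positivity)] at h1
  simp only [abs_pow_two_mul] at h1
  rw [← abs_pow_two_mul]
  exact (pow_le_pow_left₀ (abs_nonneg _) (Finset.abs_sum_le_sum_abs _ _) _).trans
    (h1.trans_eq (mul_comm _ _))

theorem sum_range_eq_sum_residue (f : ℕ → ℝ) {n R N : ℕ} (h : n ≤ R * N)
    (hf : ∀ j, n ≤ j → f j = 0) :
    ∑ j ∈ Finset.range n, f j =
      ∑ i ∈ Finset.range R, ∑ l ∈ Finset.range N, f (i + R * l) := by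
  have h1 : ∑ j ∈ Finset.range n, f j = ∑ j ∈ Finset.range (R * N), f j :=
    Finset.sum_subset (Finset.range_subset_range.2 h) fun j _ hj =>
      hf j (not_lt.1 fun h => hj (Finset.mem_range.2 h))
  rw [h1, Finset.sum_comm]
  clear h1 h
  induction N with
  | zero => simp
  | succ N ih =>
    rw [Nat.mul_succ, Finset.sum_range_add, ih, Finset.sum_range_succ]
    simp_rw [add_comm]

section Global

variable {Ω₀ 𝒴 X : Type*} [MeasurableSpace Ω₀] [MeasurableSpace 𝒴] [MeasurableSpace X]
  {P : Measure Ω₀} [IsProbabilityMeasure P] {ξ : ℤ → Ω₀ → 𝒴} {m : Measure X}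
  [IsProbabilityMeasure m] {v : (X → ℂ) → ℝ≥0∞}
  {T : 𝒴 → X → X} {L : 𝒴 → (X → ℂ) → (X → ℂ)} {h : (ℤ → 𝒴) → X → ℝ} {K : (ℤ → 𝒴) → ℝ}
  {φ : 𝒴 → X → ℝ} {C M lam c₁ c₂ η : ℝ}

/-- The mean of the observable at time `N` started from `m`, truncated at level `c`. -/
def localMean (m : Measure X) (T : 𝒴 → X → X) (φ : 𝒴 → X → ℝ) (c : ℝ) (N : ℕ) (ω : ℤ → 𝒴) : ℝ :=
  max (-c) (min c (∫ x, obs T φ N ω x ∂m))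

theorem abs_localMean_le {c : ℝ} (hc : 0 ≤ c) (N : ℕ) (ω : ℤ → 𝒴) :
    |localMean m T φ c N ω| ≤ c :=
  abs_le.2 ⟨le_max_left _ _, max_le (by linarith) (min_le_left _ _)⟩

theorem localMean_congr {c : ℝ} {N : ℕ} {ω ω' : ℤ → 𝒴} (h : ∀ k : ℕ, k ≤ N → ω k = ω' k) :
    localMean m T φ c N ω = localMean m T φ c N ω' := by
  unfold localMean
  rw [obs_congr h]

namespace MixingSystem

variable (S : MixingSystem P ξ m v T L h K φ C M lam c₁ c₂ η)
include S

theorem measurable_fiberMean : Measurable (fiberMean m h φ) :=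
  S.measurable_integral_fiber (F := fun z => φ (z.1 0) z.2) (S.measurable_obs 0)

theorem measurable_localMean (c : ℝ) (N : ℕ) : Measurable (localMean m T φ c N) :=
  measurable_const.max (measurable_const.min
    (((S.measurable_obs N).stronglyMeasurable.integral_prod_right' (ν := m)).measurable))

theorem integral_fiberMean : ∫ ω, fiberMean m h φ ω ∂(pathLaw P ξ) = 0 := by
  have := S.isProb
  rw [← S.mean_zero]
  refine (S.integral_eq (integrable_of_bdd (S.measurable_obs 0).aestronglyMeasurable (C * M) (S.ae_of_ae ?_))).symm
  filter_upwards [S.good] with ω hω x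
  exact S.system.abs_φ_le hω.fiberAt x

/-- The case of one observable in `abs_fiberMoment_sub_started_le`. At a good `ω` the truncation in
`localMean` is inactive. -/
theorem abs_fiberMean_sub_localMean_le {ω : ℤ → 𝒴} (hω : IsGood m v L h K φ M lam ω) (j N : ℕ) :
    |fiberMean m h φ (shift ((j + N : ℕ) : ℤ) ω) - localMean m T φ (C * M) N (shift j ω)| ≤
      2 * (C * M) * Real.exp (-(2 * lam / 3) * N) := by
  have h1 := S.system.abs_fiberMoment_sub_started_le hω (fun _ : Unit => j + N) {()} j N
    (fun _ _ => le_rfl)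
  have h2 : fiberMoment m T h φ (fun _ : Unit => j + N) {()} ω =
      fiberMean m h φ (shift ((j + N : ℕ) : ℤ) ω) := by
    have hp := S.system.measurePreserving_fiberMap hω (j + N)
    unfold fiberMean
    rw [← hp.map_eq, integral_map hp.measurable.aemeasurable
      (S.system.measurable_φ _).aestronglyMeasurable]
    simp [fiberMoment, obs, shift]
  have h3 : startedMoment m T φ (fun _ : Unit => j + N) {()} j ω =
      ∫ x, obs T φ N (shift j ω) x ∂m := by
    simp [startedMoment]
  have h4 := S.system.abs_startedMoment_le hω (fun _ : Unit => j + N) {()} j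
  rw [h3, Finset.card_singleton, pow_one] at h4
  rw [h2, h3, Finset.card_singleton, pow_one] at h1
  rwa [localMean, min_eq_right (abs_le.1 h4).2, max_eq_right (abs_le.1 h4).1]

/-- Even moments of a residue class of centred local means. -/
theorem integral_class_pow_le {N R : ℕ} (hN : 1 ≤ N) (hR : R = 2 * N) (n n' p i₀ : ℕ)
    (hn' : 1 ≤ n') (hp : 1 ≤ p) {b κ : ℝ} (hb : b = 2 * (C * M))
    (hκ : κ = ∫ ω, localMean m T φ (C * M) N ω ∂(pathLaw P ξ)) :
    ∫ ω, (∑ l ∈ Finset.range n', if i₀ + R * l < n then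
        localMean m T φ (C * M) N (shift ((i₀ + R * l : ℕ) : ℤ) ω) - κ else 0) ^ (2 * p)
        ∂(pathLaw P ξ) ≤
      (2 * p * b ^ 2 * n' * Real.exp 2) ^ p *
        (1 + n' * (4 * (n' * b) ^ (2 * p) * (c₁ * Real.exp (-c₂ * (N : ℝ) ^ η)) *
          Real.exp (4 * p))) := by
  have hQ := isProbabilityMeasure_pathLaw (P := P) S.measurable_ξ
  have hCM := S.system.one_le_CM
  have hc₁ := S.c₁_pos
  set c := C * M with hc
  have hb1 : 1 ≤ b := by rw [hb]; linarith
  have hn1 : (1 : ℝ) ≤ n' := by exact_mod_cast hn'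
  have hp1 : (1 : ℝ) ≤ p := by exact_mod_cast hp
  have hnb : 1 ≤ n' * b := one_le_mul_of_one_le_of_one_le hn1 hb1
  set g := localMean m T φ c N with hg
  have hgm : Measurable g := S.measurable_localMean c N
  have hgb : ∀ ω, |g ω| ≤ c := abs_localMean_le (by linarith) N
  have hκb : |κ| ≤ c := by rw [hκ]; exact abs_integral_le_of_bdd _ (ae_of_all _ hgb)
  set Y : ℕ → (ℤ → 𝒴) → ℝ := fun l ω =>
    if i₀ + R * l < n then g (shift ((i₀ + R * l : ℕ) : ℤ) ω) - κ else 0 with hY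
  have hYm : ∀ l, Measurable (Y l) := fun l => by
    simp only [hY]
    split_ifs
    · exact (hgm.comp (measurable_shift _)).sub_const _
    · exact measurable_const
  have hYb : ∀ l ω, |Y l ω| ≤ b := fun l ω => by
    simp only [hY]
    split_ifs
    · exact (abs_sub _ _).trans (by have := hgb (shift ((i₀ + R * l : ℕ) : ℤ) ω); linarith)
    · simpa using zero_le_one.trans hb1
  have hY0 : ∀ l, ∫ ω, Y l ω ∂(pathLaw P ξ) = 0 := fun l => by
    simp only [hY]
    split_ifs
    · have hs := S.shift_preserving (i₀ + R * l)
      have hgi : Integrable (fun ω => g (shift ((i₀ + R * l : ℕ) : ℤ) ω)) (pathLaw P ξ) :=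
        integrable_of_bdd (hgm.comp (measurable_shift _)).aestronglyMeasurable c
          (ae_of_all _ fun ω => hgb _)
      rw [integral_sub hgi (integrable_const _)]
      have h1 : ∫ ω, g (shift ((i₀ + R * l : ℕ) : ℤ) ω) ∂(pathLaw P ξ) =
          ∫ ω, g ω ∂(pathLaw P ξ) := by
        conv_rhs => rw [← hs.map_eq]
        rw [integral_map hs.measurable.aemeasurable hgm.aestronglyMeasurable]
      rw [h1, ← hκ]; simp
    · simp
  -- The summand `l` reads only the coordinates from `i₀ + R l` to `i₀ + R l + N`. As `R = 2 N`, a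
  -- window starts `N` after the previous one ends, and this is the gap given to the mixing bound.
  have hYc : ∀ l, ∀ ω ω' : ℤ → 𝒴, (∀ k : ℤ, (i₀ + R * l : ℕ) ≤ k → k ≤ (i₀ + R * l + N : ℕ) →
      ω k = ω' k) → Y l ω = Y l ω' := fun l ω ω' hωω => by
    simp only [hY]
    split_ifs
    · rw [hg, localMean_congr (ω := shift ((i₀ + R * l : ℕ) : ℤ) ω)
        (ω' := shift ((i₀ + R * l : ℕ) : ℤ) ω')]
      intro k hk
      exact hωω _ (by omega) (by push_cast; omega)
    · rfl
  set α := c₁ * Real.exp (-c₂ * (N : ℝ) ^ η) with hα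
  have hα0 : 0 ≤ α := by positivity
  -- Chosen so that `n' (s b)² = 2 p`, which makes the main exponential `e ^ (2 p)`. Also `s ≤ 2 p`,
  -- so the error term carries at most `e ^ (4 p)`.
  set s := Real.sqrt (2 * p / n') / b with hs
  have hs2 : (s * b) ^ 2 = 2 * p / n' := by
    rw [hs, div_mul_cancel₀ _ (by positivity), Real.sq_sqrt (by positivity)]
  have hs0 : 0 < s := div_pos (Real.sqrt_pos.2 (by positivity)) (by linarith)
  have hsle : s ≤ 2 * p := by
    refine (div_le_self (Real.sqrt_nonneg _) hb1).trans (Real.sqrt_le_iff.2 ⟨by positivity, ?_⟩)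
    rw [div_le_iff₀ (by linarith)]
    have h1 : (2 * p : ℝ) ≤ (2 * p) ^ 2 := le_self_pow₀ (by linarith) two_ne_zero
    nlinarith [sq_nonneg (2 * p : ℝ)]
  have hmain := abs_integral_sum_pow_le (μ := pathLaw P ξ) (Y := Y) (b := b)
    (δ := 4 * (n' * b) ^ (2 * p) * α) (s := s) (by linarith) (by positivity) hs0 (q := 2 * p)
    (n := n') (by omega) hYm hYb hY0 (fun i hi a j haj => by
      have hSb : ∀ ω, |(∑ l ∈ Finset.range i, Y l ω) ^ a| ≤ (n' * b) ^ a := fun ω => by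
        rw [abs_pow]
        refine pow_le_pow_left₀ (abs_nonneg _) ((Finset.abs_sum_le_sum_abs _ _).trans
          ((Finset.sum_le_sum fun l _ => hYb l ω).trans ?_)) _
        have : (i : ℝ) ≤ n' := by exact_mod_cast hi.le
        simp only [Finset.sum_const, Finset.card_range, nsmul_eq_mul]
        gcongr
      have hYjb : ∀ ω, |Y i ω ^ j| ≤ (n' * b) ^ j := fun ω => by
        rw [abs_pow]
        exact pow_le_pow_left₀ (abs_nonneg _) ((hYb i ω).trans
          (le_mul_of_one_le_left (by linarith) hn1)) _
      refine (S.abs_cov_le (a := (n' * b) ^ a) (b := (n' * b) ^ j) (by positivity) (by positivity)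
        ((Finset.measurable_fun_sum _ fun l _ => hYm l).pow_const a) (ae_of_all _ hSb)
        ((hYm i).pow_const j) (ae_of_all _ hYjb) ((i₀ + R * i : ℕ) - (N : ℤ)) N hN
        (fun ω => ?_) (fun ω => ?_)).trans ?_
      · congr 1
        refine Finset.sum_congr rfl fun l hl => hYc l _ _ fun k _ hk => ?_
        have hl' : l + 1 ≤ i := Finset.mem_range.1 hl
        have : R * l + R ≤ R * i := by rw [← Nat.mul_succ]; exact Nat.mul_le_mul_left _ hl'
        rw [min_eq_left]
        omega
      · congr 1
        refine hYc i _ _ fun k hk _ => ?_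
        rw [max_eq_left]
        omega
      · calc 4 * (n' * b) ^ a * (n' * b) ^ j * α = 4 * (n' * b) ^ (a + j) * α := by
              rw [pow_add]; ring
          _ ≤ 4 * (n' * b) ^ (2 * p) * α := by
              have := pow_le_pow_right₀ hnb haj
              gcongr)
  refine (le_abs_self _).trans (hmain.trans ?_)
  rw [hs2]
  have e1 : (n' : ℝ) * (2 * p / n') = 2 * p := by field_simp
  rw [e1]
  have e2 : ((2 * p).factorial : ℝ) / s ^ (2 * p) * Real.exp (2 * p) ≤
      (2 * p * b ^ 2 * n' * Real.exp 2) ^ p := by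
    have e3 : s ^ (2 * p) = (2 * p / n') ^ p / b ^ (2 * p) := by
      rw [eq_div_iff (by positivity), ← mul_pow, pow_mul, hs2]
    have e4 : ((2 * p).factorial : ℝ) ≤ ((2 * p) ^ 2) ^ p := by
      rw [← pow_mul]; exact_mod_cast Nat.factorial_le_pow (2 * p)
    have e5 : Real.exp (2 * p) = Real.exp 2 ^ p := by rw [← Real.exp_nat_mul]; ring_nf
    rw [e3, e5, pow_mul b, ← div_pow, div_mul_eq_mul_div, div_le_iff₀ (by positivity), ← mul_pow]
    refine (mul_le_mul_of_nonneg_right e4 (by positivity)).trans (le_of_eq ?_)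
    rw [← mul_pow]
    congr 1
    field_simp
  have e6 : Real.exp (2 * s) ≤ Real.exp (4 * p) := Real.exp_le_exp.2 (by linarith)
  calc _ = ((2 * p).factorial : ℝ) / s ^ (2 * p) * Real.exp (2 * p) *
        (1 + n' * (4 * (n' * b) ^ (2 * p) * α * Real.exp (2 * s))) := by ring
    _ ≤ _ := by gcongr

/-- Even moments of the sums of fibrewise means. -/
theorem integral_sum_fiberMean_pow_le {N : ℕ} (hN : 1 ≤ N) (n n' p : ℕ)
    (hn' : 1 ≤ n') (hp : 1 ≤ p) (hnn : n ≤ 2 * N * n') {b : ℝ} (hb : b = 2 * (C * M)) :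
    ∫ ω, (∑ j ∈ Finset.range n, fiberMean m h φ (shift j ω)) ^ (2 * p) ∂(pathLaw P ξ) ≤
      4 ^ p * ((n * (2 * b * Real.exp (-(2 * lam / 3) * N))) ^ (2 * p) + (2 * N) ^ (2 * p) *
        ((2 * p * b ^ 2 * n' * Real.exp 2) ^ p *
        (1 + n' * (4 * (n' * b) ^ (2 * p) * (c₁ * Real.exp (-c₂ * (N : ℝ) ^ η)) *
          Real.exp (4 * p))))) := by
  have hQ := isProbabilityMeasure_pathLaw (P := P) S.measurable_ξ
  have hCM := S.system.one_le_CM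
  set c := C * M with hc
  set g := localMean m T φ c N with hg
  have hgm : Measurable g := S.measurable_localMean c N
  have hgb : ∀ ω, |g ω| ≤ c := abs_localMean_le (by linarith) N
  set κ := ∫ ω, g ω ∂(pathLaw P ξ) with hκ
  set e := Real.exp (-(2 * lam / 3) * N) with he
  have he0 : 0 < e := Real.exp_pos _
  have hψm := S.measurable_fiberMean
  set ψ := fiberMean m h φ with hψ
  have hψb : ∀ᵐ ω ∂(pathLaw P ξ), |ψ ω| ≤ c := by
    filter_upwards [S.good] with ω hω
    exact S.system.abs_fiberMean_le hω
  have hψs : ∫ ω, ψ (shift N ω) ∂(pathLaw P ξ) = 0 := by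
    rw [← S.integral_fiberMean]
    have hs := S.shift_preserving N
    conv_rhs => rw [← hs.map_eq]
    rw [integral_map hs.measurable.aemeasurable hψm.aestronglyMeasurable]
  -- The local mean is close to the fibre mean `N` steps later, whose integral vanishes by
  -- stationarity.
  have hκb : |κ| ≤ 2 * c * e := by
    have hgi : Integrable g (pathLaw P ξ) :=
      integrable_of_bdd hgm.aestronglyMeasurable c (ae_of_all _ hgb)
    have hψi : Integrable (fun ω => ψ (shift N ω)) (pathLaw P ξ) :=
      integrable_of_bdd (hψm.comp (measurable_shift _)).aestronglyMeasurable c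
        ((S.shift_preserving N).quasiMeasurePreserving.ae hψb)
    have h1 : κ = ∫ ω, (g ω - ψ (shift N ω)) ∂(pathLaw P ξ) := by
      rw [integral_sub hgi hψi, hψs, sub_zero]
    rw [h1]
    refine abs_integral_le_of_bdd _ ?_
    filter_upwards [S.good] with ω hω
    have := S.abs_fiberMean_sub_localMean_le hω 0 N
    rw [abs_sub_comm, zero_add, Nat.cast_zero, shift_zero] at this
    exact this
  set A : (ℤ → 𝒴) → ℕ → ℝ := fun ω j => if j < n then g (shift (j : ℤ) ω) - κ else 0 with hA
  -- The path is shifted by `N` in advance, because a local mean at time `j` approximates the fibre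
  -- mean at time `j + N`. The error `2 b e` per term is `b e` from this approximation and `b e`
  -- from the mean `κ`.
  have hkey : ∀ᵐ ω ∂(pathLaw P ξ), (∑ j ∈ Finset.range n, ψ (shift j (shift N ω))) ^ (2 * p) ≤
      4 ^ p * ((n * (2 * b * e)) ^ (2 * p) + (2 * N : ℕ) ^ (2 * p - 1) *
        ∑ i ∈ Finset.range (2 * N), (∑ l ∈ Finset.range n', A ω (i + 2 * N * l)) ^ (2 * p)) := by
    filter_upwards [S.good] with ω hω
    have h1 : ∀ j ∈ Finset.range n, |ψ (shift j (shift N ω)) - A ω j| ≤ 2 * b * e := by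
      intro j hj
      have h2 := S.abs_fiberMean_sub_localMean_le hω j N
      simp only [hA, if_pos (Finset.mem_range.1 hj)]
      rw [shift_natCast_add, add_comm N j]
      calc _ = |(ψ (shift ((j + N : ℕ) : ℤ) ω) - g (shift j ω)) + κ| := by congr 1; ring
        _ ≤ _ := (abs_add_le _ _).trans (by rw [hb]; linarith)
    have h3 : |∑ j ∈ Finset.range n, ψ (shift j (shift N ω))| ≤
        n * (2 * b * e) + |∑ j ∈ Finset.range n, A ω j| := by
      have h4 : |∑ j ∈ Finset.range n, (ψ (shift j (shift N ω)) - A ω j)| ≤ n * (2 * b * e) :=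
        (Finset.abs_sum_le_sum_abs _ _).trans ((Finset.sum_le_sum h1).trans (by simp))
      rw [Finset.sum_sub_distrib] at h4
      have := abs_add_le (∑ j ∈ Finset.range n, ψ (shift j (shift N ω)) -
        ∑ j ∈ Finset.range n, A ω j) (∑ j ∈ Finset.range n, A ω j)
      rw [sub_add_cancel] at this
      linarith
    refine (pow_two_mul_le_of_abs_le p (by rw [hb]; positivity) (abs_nonneg _) h3).trans ?_
    rw [abs_pow_two_mul, sum_range_eq_sum_residue (A ω) hnn fun j hj =>
      if_neg (not_lt.2 hj)]
    have := sum_pow_two_mul_le (2 * N) (fun i => ∑ l ∈ Finset.range n', A ω (i + 2 * N * l)) p hp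
    gcongr
  have hst : ∫ ω, (∑ j ∈ Finset.range n, ψ (shift j ω)) ^ (2 * p) ∂(pathLaw P ξ) =
      ∫ ω, (∑ j ∈ Finset.range n, ψ (shift j (shift N ω))) ^ (2 * p) ∂(pathLaw P ξ) := by
    have hs := S.shift_preserving N
    conv_lhs => rw [← hs.map_eq]
    rw [integral_map hs.measurable.aemeasurable]
    exact ((Finset.measurable_fun_sum _ fun j _ => hψm.comp (measurable_shift _)).pow_const
      _).aestronglyMeasurable
  have hAm : ∀ j, Measurable fun ω => A ω j := fun j => by
    simp only [hA]
    split_ifs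
    · exact (hgm.comp (measurable_shift _)).sub_const _
    · exact measurable_const
  have hAb : ∀ ω j, |A ω j| ≤ c + |κ| := fun ω j => by
    simp only [hA]
    split_ifs
    · exact (abs_sub _ _).trans (by have := hgb (shift (j : ℤ) ω); linarith)
    · simp only [abs_zero]; positivity
  have hSi : ∀ i, Integrable (fun ω => (∑ l ∈ Finset.range n', A ω (i + 2 * N * l)) ^ (2 * p))
      (pathLaw P ξ) := fun i => by
    refine integrable_of_bdd ((Finset.measurable_fun_sum _ fun l _ => hAm _).pow_const
      _).aestronglyMeasurable ((n' * (c + |κ|)) ^ (2 * p)) (ae_of_all _ fun ω => ?_)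
    rw [abs_pow]
    exact pow_le_pow_left₀ (abs_nonneg _) ((Finset.abs_sum_le_sum_abs _ _).trans
      ((Finset.sum_le_sum fun l _ => hAb ω _).trans (by simp [mul_add]))) _
  have hclass : ∀ i ∈ Finset.range (2 * N),
      ∫ ω, (∑ l ∈ Finset.range n', A ω (i + 2 * N * l)) ^ (2 * p) ∂(pathLaw P ξ) ≤ _ := fun i _ =>
    S.integral_class_pow_le hN rfl n n' p i hn' hp hb hκ
  rw [hst]
  refine (integral_mono_of_nonneg
    (g := fun ω => 4 ^ p * ((n * (2 * b * e)) ^ (2 * p) + (2 * N : ℕ) ^ (2 * p - 1) *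
      ∑ i ∈ Finset.range (2 * N), (∑ l ∈ Finset.range n', A ω (i + 2 * N * l)) ^ (2 * p)))
    (ae_of_all _ fun ω => (even_two_mul p).pow_nonneg _)
    (((integrable_const _).add ((integrable_finsetSum _ fun i _ => hSi i).const_mul _)).const_mul _)
    hkey).trans ?_
  rw [integral_const_mul, integral_add (integrable_const _)
    ((integrable_finsetSum _ fun i _ => hSi i).const_mul _), integral_const_mul,
    integral_finsetSum _ fun i _ => hSi i]
  simp only [integral_const, probReal_univ, one_smul]
  refine mul_le_mul_of_nonneg_left (add_le_add le_rfl ?_) (by positivity)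
  refine (mul_le_mul_of_nonneg_left (Finset.sum_le_sum hclass) (by positivity)).trans (le_of_eq ?_)
  rw [Finset.sum_const, Finset.card_range, nsmul_eq_mul, ← mul_assoc]
  congr 1
  rw [← pow_succ, Nat.sub_add_cancel (by omega)]
  push_cast
  rfl

theorem integrable_pow_birkhoff (n q : ℕ) :
    Integrable (fun z => birkhoff T φ n z ^ q) (skewMeasure (pathLaw P ξ) m h) := by
  have := S.isProb
  have hm : Measurable fun z : (ℤ → 𝒴) × X => birkhoff T φ n z := by
    simp_rw [fun z : (ℤ → 𝒴) × X => birkhoff_eq T φ n z.1 z.2]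
    exact Finset.measurable_fun_sum _ fun j _ => S.measurable_obs j
  refine integrable_of_bdd (hm.pow_const _).aestronglyMeasurable ((n * (C * M)) ^ q)
    (S.ae_of_ae ?_)
  filter_upwards [S.good] with ω hω x
  rw [birkhoff_eq, abs_pow]
  exact pow_le_pow_left₀ (abs_nonneg _) ((Finset.abs_sum_le_sum_abs _ _).trans
    ((Finset.sum_le_sum fun j _ => S.system.abs_obs_le hω j x).trans (by simp))) _

/-- Even moments of the Birkhoff sums, in terms of those of the sums of fibrewise means. -/
theorem integral_birkhoff_pow_le (n p : ℕ) (hn : 1 ≤ n) (hp : 1 ≤ p) :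
    ∫ z, birkhoff T φ n z ^ (2 * p) ∂(skewMeasure (pathLaw P ξ) m h) ≤
      4 ^ p * ((700 * (2 * (C * M) / (1 - Real.exp (-lam))) ^ 2 * n * p) ^ p +
        ∫ ω, (∑ j ∈ Finset.range n, fiberMean m h φ (shift j ω)) ^ (2 * p) ∂(pathLaw P ξ)) := by
  have hQ := isProbabilityMeasure_pathLaw (P := P) S.measurable_ξ
  have hCM := S.system.one_le_CM
  rw [S.integral_eq (S.integrable_pow_birkhoff n (2 * p))]
  have hψm := S.measurable_fiberMean
  set ψ := fiberMean m h φ with hψ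
  set U := 2 * (C * M) / (1 - Real.exp (-lam)) with hU
  have hψi : Integrable (fun ω => (∑ j ∈ Finset.range n, ψ (shift j ω)) ^ (2 * p))
      (pathLaw P ξ) := by
    refine integrable_of_bdd ((Finset.measurable_fun_sum _ fun j _ =>
      hψm.comp (measurable_shift _)).pow_const _).aestronglyMeasurable
      ((n * (C * M)) ^ (2 * p)) ?_
    filter_upwards [S.good] with ω hω
    rw [abs_pow]
    exact pow_le_pow_left₀ (abs_nonneg _) ((Finset.abs_sum_le_sum_abs _ _).trans
      ((Finset.sum_le_sum fun j _ => S.system.abs_fiberMean_le (hω.shift j)).trans (by simp))) _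
  refine (integral_mono_of_nonneg
    (g := fun ω => 4 ^ p * ((700 * U ^ 2 * n * p) ^ p +
      (∑ j ∈ Finset.range n, ψ (shift j ω)) ^ (2 * p)))
    (ae_of_all _ fun ω => integral_nonneg fun x => (even_two_mul p).pow_nonneg _)
    (((integrable_const _).add hψi).const_mul _) ?_).trans (le_of_eq ?_)
  · filter_upwards [S.good] with ω hω
    have := S.system.isProbabilityMeasure_fiber hω.fiberAt
    have h1 := S.system.integral_fiber_pow_le hω n p hn hp
    set sψ := ∑ j ∈ Finset.range n, ψ (shift j ω) with hsψ
    have hRm : Measurable fun x => ∑ j ∈ Finset.range n, obs T φ j ω x - sψ :=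
      (Finset.measurable_fun_sum _ fun j _ =>
        RandomSkew.measurable_obs S.system.skew_measurable S.system.φ_measurable j ω).sub_const _
    have hRi : Integrable (fun x => (∑ j ∈ Finset.range n, obs T φ j ω x - sψ) ^ (2 * p))
        (fiberMeasure m h ω) := by
      refine integrable_of_bdd (hRm.pow_const _).aestronglyMeasurable
        ((n * (C * M) + |sψ|) ^ (2 * p)) (ae_of_all _ fun x => ?_)
      rw [abs_pow]
      refine pow_le_pow_left₀ (abs_nonneg _) ((abs_sub _ _).trans (add_le_add ?_ le_rfl)) _
      exact (Finset.abs_sum_le_sum_abs _ _).trans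
        ((Finset.sum_le_sum fun j _ => S.system.abs_obs_le hω j x).trans (by simp))
    refine (integral_mono_of_nonneg
      (g := fun x => 4 ^ p * ((∑ j ∈ Finset.range n, obs T φ j ω x - sψ) ^ (2 * p) +
        sψ ^ (2 * p)))
      (ae_of_all _ fun x => (even_two_mul p).pow_nonneg _)
      ((hRi.add (integrable_const _)).const_mul _) (ae_of_all _ fun x => ?_)).trans ?_
    · have := pow_two_mul_le_of_abs_le (x := birkhoff T φ n (ω, x)) p
        (abs_nonneg (∑ j ∈ Finset.range n, obs T φ j ω x - sψ)) (abs_nonneg sψ) (by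
          rw [birkhoff_eq]
          have := abs_add_le (∑ j ∈ Finset.range n, obs T φ j ω x - sψ) sψ
          rwa [sub_add_cancel] at this)
      simpa only [abs_pow_two_mul] using this
    · rw [integral_const_mul, integral_add hRi (integrable_const _)]
      simp only [integral_const, probReal_univ, one_smul]
      gcongr
  · rw [integral_const_mul, integral_add (integrable_const _) hψi]
    simp

end MixingSystem

end Global


/-! ### Elementary estimates -/

/-- With `y = x ^ θ`, the power of `1 + x` is dominated by one of `1 + y`, and `y ^ J e^{-κ y}` is
controlled by `J! / κ ^ J`. The form `(R k ^ B) ^ k` keeps the dependence on the order `k` inside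
the base, as the cumulant bounds require. -/
theorem exp_neg_rpow_mul_pow_le {κ θ : ℝ} (hκ : 0 < κ) (hθ : 0 < θ) :
    ∃ R : ℝ, 1 ≤ R ∧ ∃ B : ℕ, ∀ k : ℕ, 1 ≤ k → ∀ x : ℝ, 0 ≤ x →
      Real.exp (-κ * x ^ θ) * (1 + x) ^ (2 * k) ≤ (R * (k : ℝ) ^ B) ^ k := by
  set m := ⌈1 / θ⌉₊ with hm
  have hm' : 1 / θ ≤ m := Nat.le_ceil _
  set a := max ((2 * m / κ) ^ (2 * m)) 1 with ha
  have ha1 : 1 ≤ a := le_max_right _ _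
  have hek : 1 ≤ Real.exp κ := Real.one_le_exp hκ.le
  have h4 : 1 ≤ 4 * Real.exp κ := by linarith
  refine ⟨4 * Real.exp κ * a, one_le_mul_of_one_le_of_one_le h4 ha1, 2 * m, fun k hk x hx => ?_⟩
  set y := x ^ θ with hy
  have hy0 : 0 ≤ y := Real.rpow_nonneg hx θ
  have h1 : 1 + x ≤ 2 * (1 + y) ^ m := by
    have hone : (1 : ℝ) ≤ (1 + y) ^ m := one_le_pow₀ (by linarith)
    rcases le_total x 1 with hx1 | hx1
    · linarith
    · have hy1 : 1 ≤ y := Real.one_le_rpow hx1 hθ.le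
      have : x ≤ (1 + y) ^ m := by
        calc x = y ^ (1 / θ) := by
              rw [hy, ← Real.rpow_mul hx, mul_one_div_cancel hθ.ne', Real.rpow_one]
          _ ≤ y ^ (m : ℝ) := Real.rpow_le_rpow_of_exponent_le hy1 hm'
          _ = y ^ m := Real.rpow_natCast _ _
          _ ≤ _ := pow_le_pow_left₀ hy0 (by linarith) _
      linarith
  set J := m * (2 * k) with hJ
  have h2 : (1 + x) ^ (2 * k) ≤ 4 ^ k * (1 + y) ^ J := by
    calc _ ≤ (2 * (1 + y) ^ m) ^ (2 * k) := pow_le_pow_left₀ (by linarith) h1 _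
      _ = 2 ^ (2 * k) * (1 + y) ^ J := by rw [mul_pow, ← pow_mul]
      _ = _ := by rw [pow_mul]; norm_num
  have h3 : Real.exp (-κ * y) * (1 + y) ^ J ≤ Real.exp κ * (J / κ) ^ J := by
    have h5 := Real.pow_div_factorial_le_exp (κ * (1 + y)) (by positivity) J
    rw [div_le_iff₀ (by positivity), mul_pow] at h5
    have h6 : ((J.factorial : ℕ) : ℝ) ≤ (J : ℝ) ^ J := by exact_mod_cast Nat.factorial_le_pow J
    rw [div_pow, ← mul_div_assoc, le_div_iff₀ (by positivity)]
    calc _ = Real.exp (-κ * y) * (κ ^ J * (1 + y) ^ J) := by ring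
      _ ≤ Real.exp (-κ * y) * (Real.exp (κ * (1 + y)) * (J : ℝ) ^ J) :=
          mul_le_mul_of_nonneg_left (h5.trans (by gcongr)) (Real.exp_pos _).le
      _ = Real.exp κ * (J : ℝ) ^ J := by
          rw [← mul_assoc, ← Real.exp_add]; congr 2; ring
  have h7 : ((J : ℝ) / κ) ^ J ≤ (a * (k : ℝ) ^ (2 * m)) ^ k := by
    have e : (J : ℝ) / κ = 2 * m / κ * k := by rw [hJ]; push_cast; ring
    rw [e, show J = 2 * m * k by rw [hJ]; ring, pow_mul, mul_pow]
    gcongr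
    exact le_max_left _ _
  have hexpk : Real.exp κ ≤ Real.exp κ ^ k := le_self_pow₀ hek (by omega)
  calc _ ≤ Real.exp (-κ * y) * (4 ^ k * (1 + y) ^ J) := by gcongr
    _ = 4 ^ k * (Real.exp (-κ * y) * (1 + y) ^ J) := by ring
    _ ≤ 4 ^ k * (Real.exp κ ^ k * (a * (k : ℝ) ^ (2 * m)) ^ k) :=
        mul_le_mul_of_nonneg_left (h3.trans (mul_le_mul hexpk h7 (by positivity) (by positivity)))
          (by positivity)
    _ = _ := by rw [← mul_pow, ← mul_pow]; congr 1; ring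

/-- The rate at which joint moments decouple over a gap. -/
def gapRate (C lam c₁ c₂ η : ℝ) (g : ℕ) : ℝ :=
  C * Real.exp (-lam * g) + 8 * Real.exp (-(2 * lam / 3) * ((g / 2 : ℕ) : ℝ)) +
    4 * (c₁ * Real.exp (-c₂ * ((g - g / 2 : ℕ) : ℝ) ^ η))

theorem exists_gapRate_bound {C lam c₁ c₂ η : ℝ} (hC : 1 ≤ C) (hlam : 0 < lam) (hc₁ : 0 < c₁)
    (hc₂ : 0 < c₂) (hη : 0 < η) :
    ∃ R : ℝ, 1 ≤ R ∧ ∃ B : ℕ, ∀ k : ℕ, 1 ≤ k → ∀ g : ℕ,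
      gapRate C lam c₁ c₂ η g * (1 + (g : ℝ)) ^ (2 * k) ≤ (R * (k : ℝ) ^ B) ^ k := by
  obtain ⟨R₁, hR₁, B₁, h₁⟩ := exp_neg_rpow_mul_pow_le hlam one_pos
  obtain ⟨R₂, hR₂, B₂, h₂⟩ := exp_neg_rpow_mul_pow_le (κ := 2 * lam / 3) (by positivity) one_pos
  obtain ⟨R₃, hR₃, B₃, h₃⟩ := exp_neg_rpow_mul_pow_le hc₂ hη
  set A := C + 8 + 4 * c₁ with hA
  have hA1 : 1 ≤ A := by linarith
  have hR12 := one_le_mul_of_one_le_of_one_le hR₁ hR₂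
  have hR123 := one_le_mul_of_one_le_of_one_le hR12 hR₃
  refine ⟨A * 4 * (R₁ * R₂ * R₃), ?_, B₁ + B₂ + B₃, fun k hk g => ?_⟩
  · exact one_le_mul_of_one_le_of_one_le (by linarith) hR123
  set Q := R₁ * R₂ * R₃ * (k : ℝ) ^ (B₁ + B₂ + B₃) with hQ
  have hk1 : (1 : ℝ) ≤ k := by exact_mod_cast hk
  have hcmp : ∀ (R : ℝ) (B : ℕ), 1 ≤ R → R ≤ R₁ * R₂ * R₃ → B ≤ B₁ + B₂ + B₃ →
      (R * (k : ℝ) ^ B) ^ k ≤ Q ^ k := fun R B hR hle hB => by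
    have := pow_le_pow_right₀ hk1 hB
    exact pow_le_pow_left₀ (by positivity) (mul_le_mul hle this (by positivity) (by linarith)) _
  have hR23 := one_le_mul_of_one_le_of_one_le hR₂ hR₃
  have hQ1 := hcmp R₁ B₁ hR₁ (by
    rw [mul_assoc]; exact le_mul_of_one_le_right (by linarith) hR23) (by omega)
  have hQ2 := hcmp R₂ B₂ hR₂ ((le_mul_of_one_le_left (by linarith) hR₁).trans
    (le_mul_of_one_le_right (by linarith) hR₃)) (by omega)
  have hQ3 := hcmp R₃ B₃ hR₃ (le_mul_of_one_le_left (by linarith) hR12) (by omega)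
  have hpow : ∀ x : ℝ, 0 ≤ x → (g : ℝ) ≤ 2 * x + 1 →
      (1 + (g : ℝ)) ^ (2 * k) ≤ 4 ^ k * (1 + x) ^ (2 * k) := fun x hx hg => by
    calc _ ≤ (2 * (1 + x)) ^ (2 * k) := pow_le_pow_left₀ (by positivity) (by linarith) _
      _ = _ := by rw [mul_pow, pow_mul 2]; norm_num
  have t₁ : Real.exp (-lam * g) * (1 + (g : ℝ)) ^ (2 * k) ≤ 4 ^ k * Q ^ k := by
    have := h₁ k hk g (Nat.cast_nonneg _)
    rw [Real.rpow_one] at this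
    have h4 : (1 : ℝ) ≤ 4 ^ k := one_le_pow₀ (by norm_num)
    have hQ0 : 0 ≤ Q ^ k := by positivity
    nlinarith
  have t₂ : Real.exp (-(2 * lam / 3) * ((g / 2 : ℕ) : ℝ)) * (1 + (g : ℝ)) ^ (2 * k) ≤
      4 ^ k * Q ^ k := by
    have h5 := h₂ k hk ((g / 2 : ℕ) : ℝ) (Nat.cast_nonneg _)
    rw [Real.rpow_one] at h5
    have h6 := hpow ((g / 2 : ℕ) : ℝ) (Nat.cast_nonneg _)
      (by exact_mod_cast (by omega : g ≤ 2 * (g / 2) + 1))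
    calc _ ≤ Real.exp (-(2 * lam / 3) * ((g / 2 : ℕ) : ℝ)) *
          (4 ^ k * (1 + ((g / 2 : ℕ) : ℝ)) ^ (2 * k)) := by gcongr
      _ = 4 ^ k * (Real.exp (-(2 * lam / 3) * ((g / 2 : ℕ) : ℝ)) *
          (1 + ((g / 2 : ℕ) : ℝ)) ^ (2 * k)) := by ring
      _ ≤ _ := mul_le_mul_of_nonneg_left (h5.trans hQ2) (by positivity)
  have t₃ : Real.exp (-c₂ * ((g - g / 2 : ℕ) : ℝ) ^ η) * (1 + (g : ℝ)) ^ (2 * k) ≤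
      4 ^ k * Q ^ k := by
    have h5 := h₃ k hk ((g - g / 2 : ℕ) : ℝ) (Nat.cast_nonneg _)
    have h6 := hpow ((g - g / 2 : ℕ) : ℝ) (Nat.cast_nonneg _)
      (by exact_mod_cast (by omega : g ≤ 2 * (g - g / 2) + 1))
    calc _ ≤ Real.exp (-c₂ * ((g - g / 2 : ℕ) : ℝ) ^ η) *
          (4 ^ k * (1 + ((g - g / 2 : ℕ) : ℝ)) ^ (2 * k)) := by gcongr
      _ = 4 ^ k * (Real.exp (-c₂ * ((g - g / 2 : ℕ) : ℝ) ^ η) *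
          (1 + ((g - g / 2 : ℕ) : ℝ)) ^ (2 * k)) := by ring
      _ ≤ _ := mul_le_mul_of_nonneg_left (h5.trans hQ3) (by positivity)
  have hAk : A ≤ A ^ k := le_self_pow₀ hA1 (by omega)
  calc gapRate C lam c₁ c₂ η g * (1 + (g : ℝ)) ^ (2 * k)
      = C * (Real.exp (-lam * g) * (1 + (g : ℝ)) ^ (2 * k)) +
        8 * (Real.exp (-(2 * lam / 3) * ((g / 2 : ℕ) : ℝ)) * (1 + (g : ℝ)) ^ (2 * k)) +
        4 * c₁ * (Real.exp (-c₂ * ((g - g / 2 : ℕ) : ℝ) ^ η) * (1 + (g : ℝ)) ^ (2 * k)) := by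
        unfold gapRate; ring
    _ ≤ C * (4 ^ k * Q ^ k) + 8 * (4 ^ k * Q ^ k) + 4 * c₁ * (4 ^ k * Q ^ k) := by gcongr
    _ = A * (4 ^ k * Q ^ k) := by rw [hA]; ring
    _ ≤ A ^ k * (4 ^ k * Q ^ k) := by gcongr
    _ = _ := by rw [← mul_pow, ← mul_pow]; congr 1; rw [hQ]; ring

/-- In the application `x = N ^ η ≥ p²`, so the mixing error is at most `(e^{-c₂ p}) ^ p`. This
overwhelms `(y b) ^ (2 p)`, whose base is only polynomial in `p`, and leaves a constant to the power
`p`. -/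
theorem one_add_block_error_le {A b c₁ c₂ K x y : ℝ} {p E : ℕ} (hb : 1 ≤ b) (hAb : 1 ≤ A * b)
    (hc₁ : 0 < c₁) (hc₂ : 0 < c₂) (hp : 1 ≤ p) (hy : 0 ≤ y) (hyb : y * b ≤ A * b * (p : ℝ) ^ E)
    (hK1 : 1 ≤ K) (hK : Real.exp (-c₂ * p) * ((p : ℝ) ^ E) ^ 3 ≤ K) (hx : (p : ℝ) ^ 2 ≤ x) :
    1 + y * (4 * (y * b) ^ (2 * p) * (c₁ * Real.exp (-c₂ * x)) * Real.exp (4 * p)) ≤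
      ((1 + 4 * c₁) * ((A * b) ^ 3 * Real.exp 4 * K)) ^ p := by
  have hp1 : (1 : ℝ) ≤ p := by exact_mod_cast hp
  have hexp4 : 1 ≤ Real.exp 4 := Real.one_le_exp (by norm_num)
  set K₃ := (A * b) ^ 3 * Real.exp 4 * K with hK₃
  have hK₃1 : 1 ≤ K₃ := one_le_mul_of_one_le_of_one_le
    (one_le_mul_of_one_le_of_one_le (one_le_pow₀ hAb) hexp4) hK1
  set W := A * b * (p : ℝ) ^ E with hW
  have hW1 : 1 ≤ W := one_le_mul_of_one_le_of_one_le hAb (one_le_pow₀ hp1)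
  have hW0 : 0 ≤ W := by linarith
  have hyW : y ≤ W ^ p :=
    (le_mul_of_one_le_right hy hb).trans (hyb.trans (le_self_pow₀ hW1 (by omega)))
  have h5 : Real.exp (-c₂ * x) ≤ Real.exp (-c₂ * p) ^ p := by
    rw [← Real.exp_nat_mul]
    refine Real.exp_le_exp.2 ?_
    nlinarith
  have h6 : W ^ 3 * Real.exp (-c₂ * p) * Real.exp 4 ≤ K₃ := by
    calc _ = (A * b) ^ 3 * Real.exp 4 * (Real.exp (-c₂ * p) * ((p : ℝ) ^ E) ^ 3) := by
          rw [hW]; ring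
      _ ≤ _ := mul_le_mul_of_nonneg_left hK (by positivity)
  have h7 : Real.exp (4 * p) = Real.exp 4 ^ p := by rw [← Real.exp_nat_mul]; ring_nf
  have hK₃p : 1 ≤ K₃ ^ p := one_le_pow₀ hK₃1
  have h8 : (y * b) ^ (2 * p) ≤ W ^ (2 * p) := pow_le_pow_left₀ (by positivity) hyb _
  have h9 : (W ^ 3 * Real.exp (-c₂ * p) * Real.exp 4) ^ p ≤ K₃ ^ p :=
    pow_le_pow_left₀ (by positivity) h6 _
  have h10 : 1 + 4 * c₁ ≤ (1 + 4 * c₁) ^ p := le_self_pow₀ (by linarith) (by omega)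
  rw [h7]
  clear_value K₃ W
  calc 1 + y * (4 * (y * b) ^ (2 * p) * (c₁ * Real.exp (-c₂ * x)) * Real.exp 4 ^ p)
      ≤ 1 + W ^ p * (4 * W ^ (2 * p) * (c₁ * Real.exp (-c₂ * p) ^ p) * Real.exp 4 ^ p) := by
        gcongr
    _ = 1 + 4 * c₁ * (W ^ 3 * Real.exp (-c₂ * p) * Real.exp 4) ^ p := by
        rw [mul_pow, mul_pow, pow_mul W 2]; ring
    _ ≤ K₃ ^ p + 4 * c₁ * K₃ ^ p := by gcongr
    _ = (1 + 4 * c₁) * K₃ ^ p := by ring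
    _ ≤ (1 + 4 * c₁) ^ p * K₃ ^ p := mul_le_mul_of_nonneg_right h10 (by linarith)
    _ = _ := by rw [mul_pow]

theorem pow_combine_le {a₁ a₂ a₃ z x₁ x₂ x₃ : ℝ} {p : ℕ} (h₁ : 0 ≤ a₁) (h₂ : 0 ≤ a₂)
    (h₃ : 0 ≤ a₃) (hz : 0 ≤ z) (hp : 1 ≤ p) (e₁ : x₁ ≤ (a₁ * z) ^ p) (e₂ : x₂ ≤ (a₂ * z) ^ p)
    (e₃ : x₃ ≤ (a₃ * z) ^ p) :
    4 ^ p * (x₁ + 4 ^ p * (x₂ + x₃)) ≤ (16 * (a₁ + a₂ + a₃) * z) ^ p := by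
  have hp0 : p ≠ 0 := by omega
  have g1 := pow_add_pow_le (mul_nonneg h₂ hz) (mul_nonneg h₃ hz) hp0
  have g2 := pow_add_pow_le (mul_nonneg h₁ hz)
    (add_nonneg (mul_nonneg h₂ hz) (mul_nonneg h₃ hz)) hp0
  have h4p : (1 : ℝ) ≤ 4 ^ p := one_le_pow₀ (by norm_num)
  have g3 : (a₁ * z) ^ p ≤ 4 ^ p * (a₁ * z) ^ p :=
    le_mul_of_one_le_left (pow_nonneg (mul_nonneg h₁ hz) _) h4p
  calc 4 ^ p * (x₁ + 4 ^ p * (x₂ + x₃))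
      ≤ 4 ^ p * (4 ^ p * (a₁ * z) ^ p + 4 ^ p * ((a₂ * z) ^ p + (a₃ * z) ^ p)) := by
        refine mul_le_mul_of_nonneg_left (add_le_add (e₁.trans g3) ?_) (by positivity)
        exact mul_le_mul_of_nonneg_left (add_le_add e₂ e₃) (by positivity)
    _ = 16 ^ p * ((a₁ * z) ^ p + ((a₂ * z) ^ p + (a₃ * z) ^ p)) := by
        rw [show (16 : ℝ) ^ p = 4 ^ p * 4 ^ p by rw [← mul_pow]; norm_num]; ring
    _ ≤ 16 ^ p * (a₁ * z + (a₂ * z + a₃ * z)) ^ p := by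
        refine mul_le_mul_of_nonneg_left (le_trans ?_ g2) (by positivity)
        linarith
    _ = _ := by rw [← mul_pow]; congr 1; ring

/-- The choice of the block length for even moments of order `2 * p`. -/
theorem exists_even_moment_const {b U lam c₁ c₂ η A : ℝ} (hb : 1 ≤ b)
    (hlam : 0 < lam) (hc₁ : 0 < c₁) (hc₂ : 0 < c₂) (hη : 0 < η) (hA : 1 ≤ A) {E : ℕ} (hE : 1 ≤ E) :
    ∃ D : ℝ, 1 ≤ D ∧ ∀ n p : ℕ, 1 ≤ n → 1 ≤ p → (n : ℝ) ≤ A * (p : ℝ) ^ E →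
      ∃ N : ℕ, 1 ≤ N ∧
        (n < 2 * N → (n * b) ^ (2 * p) ≤ (D * n * (p : ℝ) ^ (1 + 2 * (1 / η))) ^ p) ∧
        (2 * N ≤ n → ∃ n' : ℕ, 1 ≤ n' ∧ n ≤ 2 * N * n' ∧
          4 ^ p * ((700 * U ^ 2 * n * p) ^ p +
            4 ^ p * ((n * (2 * b * Real.exp (-(2 * lam / 3) * N))) ^ (2 * p) + (2 * N) ^ (2 * p) *
              ((2 * p * b ^ 2 * n' * Real.exp 2) ^ p *
              (1 + n' * (4 * (n' * b) ^ (2 * p) * (c₁ * Real.exp (-c₂ * (N : ℝ) ^ η)) *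
                Real.exp (4 * p)))))) ≤ (D * n * (p : ℝ) ^ (1 + 2 * (1 / η))) ^ p) := by
  obtain ⟨R₁, hR₁, B₁, h₁⟩ := exp_neg_rpow_mul_pow_le (κ := 4 * lam / 3) (θ := 2 * (1 / η))
    (by positivity) (by positivity)
  obtain ⟨R₂, hR₂, B₂, h₂⟩ := exp_neg_rpow_mul_pow_le hc₂ one_pos
  set K₁ := (R₁ * (E : ℝ) ^ B₁) ^ E with hK₁
  set K₂ := (R₂ * ((3 * E : ℕ) : ℝ) ^ B₂) ^ (3 * E) with hK₂
  have hE1 : (1 : ℝ) ≤ E := by exact_mod_cast hE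
  have hK₁1 : 1 ≤ K₁ := one_le_pow₀ (one_le_mul_of_one_le_of_one_le hR₁ (one_le_pow₀ hE1))
  have hK₂1 : 1 ≤ K₂ := one_le_pow₀ (one_le_mul_of_one_le_of_one_le hR₂ (one_le_pow₀ (by
    push_cast; linarith)))
  have hexp1 : ∀ x : ℝ, 0 ≤ x → 1 ≤ Real.exp x := fun x hx => Real.one_le_exp hx
  have hAb : 1 ≤ A * b := one_le_mul_of_one_le_of_one_le hA hb
  set K₃ := (A * b) ^ 3 * Real.exp 4 * K₂ with hK₃
  have hK₃1 : 1 ≤ K₃ := one_le_mul_of_one_le_of_one_le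
    (one_le_mul_of_one_le_of_one_le (one_le_pow₀ hAb) (hexp1 4 (by norm_num))) hK₂1
  set a₁ := 700 * U ^ 2 with ha₁
  set a₂ := 4 * b ^ 2 * A * K₁ with ha₂
  set a₃ := 16 * b ^ 2 * Real.exp 2 * ((1 + 4 * c₁) * K₃) with ha₃
  have ha₁0 : 0 ≤ a₁ := by positivity
  have ha₂1 : 1 ≤ a₂ := one_le_mul_of_one_le_of_one_le
    (one_le_mul_of_one_le_of_one_le (by nlinarith) hA) hK₁1
  have ha₃0 : 0 ≤ a₃ := by positivity
  refine ⟨16 * (a₁ + a₂ + a₃) + 4 * b ^ 2, by nlinarith, fun n p hn hp hnA => ?_⟩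
  have hn1 : (1 : ℝ) ≤ n := by exact_mod_cast hn
  have hp1 : (1 : ℝ) ≤ p := by exact_mod_cast hp
  set x := (p : ℝ) ^ (2 * (1 / η)) with hx
  have hx1 : 1 ≤ x := Real.one_le_rpow hp1 (by positivity)
  have hpx : (p : ℝ) ^ (1 + 2 * (1 / η)) = p * x := by
    rw [Real.rpow_add (by linarith), Real.rpow_one]
  rw [hpx]
  -- `x = p ^ (2 / η)` is the smallest scale with `x ^ η = p²`, as needed for the mixing error of a
  -- block to beat powers `n ^ (2 p)` with `n ≤ A p ^ E`. Summing over `2 N` residue classes costs a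
  -- factor `N` in the variance; hence the exponent `1 + 2 / η`.
  set N := ⌈x⌉₊ with hN
  have hNx : x ≤ N := Nat.le_ceil x
  have hN2 : (N : ℝ) ≤ 2 * x := by
    have := Nat.ceil_lt_add_one (show 0 ≤ x by linarith)
    linarith
  have hN1 : 1 ≤ N := by
    have : (1 : ℝ) ≤ N := by linarith
    exact_mod_cast this
  have hNη : (p : ℝ) ^ 2 ≤ (N : ℝ) ^ η := by
    calc (p : ℝ) ^ 2 = x ^ η := by
          rw [hx, ← Real.rpow_mul (by linarith), mul_assoc, one_div_mul_cancel hη.ne', mul_one]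
          exact (Real.rpow_natCast _ 2).symm
      _ ≤ _ := Real.rpow_le_rpow (by linarith) hNx hη.le
  have hpx1 : (p : ℝ) ≤ p * x := le_mul_of_one_le_right (by linarith) hx1
  have hpx2 : x ≤ p * x := le_mul_of_one_le_left (by linarith) hp1
  clear_value N x K₁ K₂
  refine ⟨N, hN1, fun hlt => ?_, fun hle => ?_⟩
  · rw [pow_mul]
    refine pow_le_pow_left₀ (by positivity) ?_ _
    have hnx : (n : ℝ) ≤ 4 * x := by
      have : (n : ℝ) ≤ 2 * N := by exact_mod_cast hlt.le
      linarith
    calc (n * b) ^ 2 = b ^ 2 * n * n := by ring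
      _ ≤ b ^ 2 * n * (4 * (p * x)) := by gcongr; linarith
      _ = 4 * b ^ 2 * n * (p * x) := by ring
      _ ≤ _ := by gcongr; nlinarith
  · set n' := n / (2 * N) + 1 with hn'
    have hnn : n ≤ 2 * N * n' := by
      have := Nat.div_add_mod n (2 * N)
      have := Nat.mod_lt n (show 0 < 2 * N by omega)
      rw [hn', Nat.mul_add]; omega
    have hnn' : 2 * N * n' ≤ 2 * n := by
      have := Nat.mul_div_le n (2 * N)
      rw [hn', Nat.mul_add]; omega
    have hnn'r : 2 * (N : ℝ) * n' ≤ 2 * n := by exact_mod_cast hnn'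
    have hn'1 : (1 : ℝ) ≤ n' := by exact_mod_cast Nat.succ_le_succ (Nat.zero_le _)
    have hNr : (1 : ℝ) ≤ N := by exact_mod_cast hN1
    have hn'n : (n' : ℝ) ≤ n := by nlinarith
    refine ⟨n', Nat.succ_le_succ (Nat.zero_le _), hnn, ?_⟩
    set z := n * (p * x) with hz
    have hz0 : 0 ≤ z := by positivity
    have e₁ : (700 * U ^ 2 * n * p) ^ p ≤ (a₁ * z) ^ p := by
      refine pow_le_pow_left₀ (by positivity) ?_ _
      rw [hz, ha₁, ← mul_assoc]
      gcongr
    have e₂ : (n * (2 * b * Real.exp (-(2 * lam / 3) * N))) ^ (2 * p) ≤ (a₂ * z) ^ p := by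
      rw [pow_mul]
      refine pow_le_pow_left₀ (by positivity) ?_ _
      have h3 := h₁ E hE p (by linarith)
      rw [← hx, ← hK₁] at h3
      have h4 : (p : ℝ) ^ E ≤ (1 + (p : ℝ)) ^ (2 * E) :=
        (pow_le_pow_left₀ (by linarith) (by linarith) _).trans
          (pow_le_pow_right₀ (by linarith) (by omega))
      have h5 : n * Real.exp (-(2 * lam / 3) * N) ^ 2 ≤ A * K₁ := by
        rw [← Real.exp_nat_mul]
        have h6 : Real.exp ((2 : ℕ) * (-(2 * lam / 3) * N)) ≤ Real.exp (-(4 * lam / 3) * x) := by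
          have : lam * x ≤ lam * N := mul_le_mul_of_nonneg_left hNx hlam.le
          refine Real.exp_le_exp.2 ?_
          push_cast
          linarith
        calc _ ≤ A * (p : ℝ) ^ E * Real.exp (-(4 * lam / 3) * x) := by gcongr
          _ ≤ A * (1 + (p : ℝ)) ^ (2 * E) * Real.exp (-(4 * lam / 3) * x) := by gcongr
          _ = A * (Real.exp (-(4 * lam / 3) * x) * (1 + (p : ℝ)) ^ (2 * E)) := by ring
          _ ≤ _ := by gcongr
      calc _ = 4 * b ^ 2 * n * (n * Real.exp (-(2 * lam / 3) * N) ^ 2) := by ring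
        _ ≤ 4 * b ^ 2 * n * (A * K₁) := by gcongr
        _ = a₂ * n := by rw [ha₂]; ring
        _ ≤ a₂ * z := by
          rw [hz]
          gcongr
          exact le_mul_of_one_le_right (by linarith) (hp1.trans hpx1)
    have e₃ : (2 * (N : ℝ)) ^ (2 * p) * (2 * p * b ^ 2 * n' * Real.exp 2) ^ p ≤
        (16 * b ^ 2 * Real.exp 2 * z) ^ p := by
      rw [pow_mul, ← mul_pow]
      refine pow_le_pow_left₀ (by positivity) ?_ _
      calc _ = (2 * N) * (2 * N * n') * (2 * p * b ^ 2 * Real.exp 2) := by ring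
        _ ≤ (2 * (2 * x)) * (2 * n) * (2 * p * b ^ 2 * Real.exp 2) := by gcongr
        _ = _ := by rw [hz]; ring
    have e₄ : 1 + n' * (4 * (n' * b) ^ (2 * p) * (c₁ * Real.exp (-c₂ * (N : ℝ) ^ η)) *
        Real.exp (4 * p)) ≤ ((1 + 4 * c₁) * K₃) ^ p := by
      refine one_add_block_error_le (E := E) hb hAb hc₁ hc₂ hp (by linarith) ?_ hK₂1 ?_ hNη
      · calc n' * b ≤ n * b := by gcongr
          _ ≤ A * (p : ℝ) ^ E * b := by gcongr
          _ = _ := by ring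
      · have h3 := h₂ (3 * E) (by omega) p (by linarith)
        rw [Real.rpow_one, ← hK₂] at h3
        have h4 : ((p : ℝ) ^ E) ^ 3 ≤ (1 + (p : ℝ)) ^ (2 * (3 * E)) := by
          rw [← pow_mul]
          exact (pow_le_pow_left₀ (by linarith) (by linarith) _).trans
            (pow_le_pow_right₀ (by linarith) (by omega))
        exact (mul_le_mul_of_nonneg_left h4 (Real.exp_pos _).le).trans h3
    have e₅ : (2 * (N : ℝ)) ^ (2 * p) * ((2 * p * b ^ 2 * n' * Real.exp 2) ^ p *
        (1 + n' * (4 * (n' * b) ^ (2 * p) * (c₁ * Real.exp (-c₂ * (N : ℝ) ^ η)) *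
        Real.exp (4 * p)))) ≤ (a₃ * z) ^ p := by
      rw [← mul_assoc]
      refine (mul_le_mul e₃ e₄ (by positivity) (by positivity)).trans (le_of_eq ?_)
      rw [← mul_pow, ha₃]; congr 1; ring
    refine (pow_combine_le ha₁0 (by linarith) ha₃0 hz0 hp e₁ e₂ e₅).trans ?_
    refine pow_le_pow_left₀ (by positivity) ?_ _
    rw [mul_assoc (_ + _) (n : ℝ), ← hz]
    exact mul_le_mul_of_nonneg_right (le_add_of_nonneg_right (by positivity)) hz0

/-- The last summand bounds the whole sum from below. -/
theorem le_rosenthalBound {c₀ γ : ℝ} (hc₀ : 0 < c₀) {p : ℕ} (hp : 3 ≤ p) (n : ℕ) :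
    c₀ ^ p * (p.factorial : ℝ) ^ (1 + γ) * (n : ℝ) ^ ((p - 1) / 2) / (p : ℝ) ^ ((p - 1) / 2) ≤
      rosenthalBound c₀ γ p n := by
  set u := (p - 1) / 2 with hu
  have hp0 : (0 : ℝ) < p := by exact_mod_cast (by omega : 0 < p)
  have hfac : (u.factorial : ℝ) ≤ (p : ℝ) ^ u := by
    calc (u.factorial : ℝ) ≤ (u : ℝ) ^ u := by exact_mod_cast Nat.factorial_le_pow u
      _ ≤ _ := by gcongr; omega
  have hterm : 1 / (p : ℝ) ^ u ≤ (p : ℝ) ^ u / (u.factorial : ℝ) ^ 2 := by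
    rw [div_le_div_iff₀ (by positivity) (by positivity), one_mul, ← sq]
    exact pow_le_pow_left₀ (by positivity) hfac 2
  unfold rosenthalBound
  rw [mul_div_assoc]
  refine mul_le_mul_of_nonneg_left ?_ (by positivity)
  calc (n : ℝ) ^ u / (p : ℝ) ^ u = (n : ℝ) ^ u * (1 / (p : ℝ) ^ u) := by ring
    _ ≤ (n : ℝ) ^ u * ((p : ℝ) ^ u / (u.factorial : ℝ) ^ 2) := by gcongr
    _ ≤ _ := Finset.single_le_sum (f := fun u : ℕ => (n : ℝ) ^ u * ((p : ℝ) ^ u /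
        (u.factorial : ℝ) ^ 2)) (fun _ _ => by positivity) (Finset.mem_Icc.2 ⟨by omega, le_rfl⟩)

theorem rosenthalBound_nonneg {c₀ γ : ℝ} (hc₀ : 0 < c₀) (p n : ℕ) : 0 ≤ rosenthalBound c₀ γ p n := by
  unfold rosenthalBound; positivity

theorem rosenthalBound_isBigO (c₀ γ : ℝ) (p : ℕ) :
    (fun n : ℕ => rosenthalBound c₀ γ p n) =O[atTop] fun n : ℕ => (n : ℝ) ^ ((p - 1) / 2) := by
  unfold rosenthalBound
  refine IsBigO.const_mul_left (IsBigO.fun_sum fun u hu => ?_) _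
  simp_rw [mul_comm _ ((p : ℝ) ^ u / _)]
  refine IsBigO.const_mul_left (IsBigO.of_bound 1 ?_) _
  filter_upwards [eventually_ge_atTop 1] with n hn
  have hn1 : (1 : ℝ) ≤ n := by exact_mod_cast hn
  rw [one_mul, Real.norm_of_nonneg (by positivity), Real.norm_of_nonneg (by positivity)]
  exact pow_le_pow_right₀ hn1 (Finset.mem_Icc.1 hu).2


/-! ### Moments of Birkhoff sums -/

/-- Apart from `P!`, all factors are polynomial or exponential in `P`; the former are absorbed
through `P ^ E ≤ E! e ^ P`. In this regime the exponent `γ` gives nothing but room. -/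
theorem le_of_large {D₀ C₂ γ c₀ : ℝ} (hD₀ : 1 ≤ D₀) (hγ : 0 ≤ γ) {B P : ℕ}
    (hP : 3 ≤ P) (hc₀ : 8 * D₀ ^ 6 * ((6 * (B + 3) + 3).factorial : ℝ) * Real.exp 3 *
      Real.exp (1 + 3 * C₂) ≤ c₀) :
    8 * (P.factorial : ℝ) * (D₀ * (P : ℝ) ^ (B + 3)) ^ 6 * (P : ℝ) ^ 3 *
      Real.exp (3 * (C₂ * P + 1)) ≤ c₀ ^ P * (P.factorial : ℝ) ^ (1 + γ) := by
  set E := 6 * (B + 3) + 3 with hE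
  have hfac : (1 : ℝ) ≤ P.factorial := by exact_mod_cast Nat.factorial_pos P
  have hfacE : (1 : ℝ) ≤ E.factorial := by exact_mod_cast Nat.factorial_pos E
  have h1 : (P.factorial : ℝ) ≤ (P.factorial : ℝ) ^ (1 + γ) := by
    conv_lhs => rw [← Real.rpow_one (P.factorial : ℝ)]
    exact Real.rpow_le_rpow_of_exponent_le hfac (by linarith)
  have h2 : (P : ℝ) ^ E ≤ E.factorial * Real.exp P := by
    have := Real.pow_div_factorial_le_exp (P : ℝ) (by positivity) E
    rw [div_le_iff₀ (by positivity)] at this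
    linarith
  set k := 8 * D₀ ^ 6 * (E.factorial : ℝ) * Real.exp 3 with hk
  have hk1 : 1 ≤ k := by
    have h3 : 1 ≤ D₀ ^ 6 := one_le_pow₀ hD₀
    have h4 : 1 ≤ Real.exp 3 := Real.one_le_exp (by norm_num)
    exact one_le_mul_of_one_le_of_one_le (one_le_mul_of_one_le_of_one_le (by linarith) hfacE) h4
  have h5 : 8 * (D₀ * (P : ℝ) ^ (B + 3)) ^ 6 * (P : ℝ) ^ 3 * Real.exp (3 * (C₂ * P + 1)) ≤
      c₀ ^ P := by
    have e1 : (P : ℝ) ^ E = ((P : ℝ) ^ (B + 3)) ^ 6 * (P : ℝ) ^ 3 := by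
      rw [hE, pow_add (P : ℝ) (6 * (B + 3)) 3, mul_comm 6 (B + 3), pow_mul]
    have e2 : Real.exp (3 * (C₂ * P + 1)) = Real.exp (3 * C₂ * P) * Real.exp 3 := by
      rw [← Real.exp_add]; congr 1; ring
    calc _ = 8 * D₀ ^ 6 * (P : ℝ) ^ E * (Real.exp (3 * C₂ * P) * Real.exp 3) := by
          rw [e1, e2]; ring
      _ ≤ 8 * D₀ ^ 6 * (E.factorial * Real.exp P) * (Real.exp (3 * C₂ * P) * Real.exp 3) := by
          gcongr
      _ = k * Real.exp (1 + 3 * C₂) ^ P := by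
          have : Real.exp (1 + 3 * C₂) ^ P = Real.exp P * Real.exp (3 * C₂ * P) := by
            rw [← Real.exp_nat_mul, ← Real.exp_add]; congr 1; ring
          rw [this, hk]; ring
      _ ≤ k ^ P * Real.exp (1 + 3 * C₂) ^ P := by
          gcongr
          exact le_self_pow₀ hk1 (by omega)
      _ = (k * Real.exp (1 + 3 * C₂)) ^ P := (mul_pow _ _ _).symm
      _ ≤ c₀ ^ P := pow_le_pow_left₀ (by positivity) hc₀ _
  have hc₀0 : 0 ≤ c₀ := le_trans (by positivity) hc₀
  calc _ = (8 * (D₀ * (P : ℝ) ^ (B + 3)) ^ 6 * (P : ℝ) ^ 3 * Real.exp (3 * (C₂ * P + 1))) *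
        P.factorial := by ring
    _ ≤ c₀ ^ P * (P.factorial : ℝ) ^ (1 + γ) := by gcongr

/-- From `P! ≥ (P / e) ^ P`. Of the available `P ^ ((2 + 2 γ) P)`, the part `P ^ ((1 + 2 γ) P)` pays
for the moment bound and the remaining `P ^ P` for the division by the square of `P ^ ((P - 1) /
2)`. -/
theorem le_factorial_rpow_sq {γ : ℝ} (hγ : 0 ≤ γ) {P : ℕ} (hP : 1 ≤ P) :
    ((P : ℝ) * (P : ℝ) ^ (1 + 2 * γ) * Real.exp (-(2 + 2 * γ))) ^ P ≤
      ((P.factorial : ℝ) ^ (1 + γ)) ^ 2 := by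
  have hP0 : (0 : ℝ) < P := by exact_mod_cast hP
  set y : ℝ := P * Real.exp (-1) with hy
  have hy0 : 0 < y := by positivity
  have h1 : y ^ P ≤ P.factorial := by
    have := Real.pow_div_factorial_le_exp (P : ℝ) hP0.le P
    rw [div_le_iff₀ (by positivity)] at this
    have e : Real.exp (-1) ^ P = (Real.exp P)⁻¹ := by
      rw [← Real.exp_nat_mul, ← Real.exp_neg]; ring_nf
    rw [hy, mul_pow, e, ← div_eq_mul_inv, div_le_iff₀ (Real.exp_pos _)]
    linarith
  have h2 : (y ^ (1 + γ)) ^ P ≤ (P.factorial : ℝ) ^ (1 + γ) := by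
    rw [Real.rpow_pow_comm hy0.le]
    exact Real.rpow_le_rpow (by positivity) h1 (by linarith)
  have h3 : (P : ℝ) * (P : ℝ) ^ (1 + 2 * γ) * Real.exp (-(2 + 2 * γ)) = (y ^ (1 + γ)) ^ 2 := by
    have e1 : (P : ℝ) * (P : ℝ) ^ (1 + 2 * γ) = (P : ℝ) ^ (2 + 2 * γ) := by
      rw [show 2 + 2 * γ = 1 + (1 + 2 * γ) by ring, Real.rpow_add hP0 1 (1 + 2 * γ), Real.rpow_one]
    have e2 : (y ^ (1 + γ)) ^ 2 = y ^ (2 + 2 * γ) := by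
      rw [← Real.rpow_natCast, ← Real.rpow_mul hy0.le]; congr 1; push_cast; ring
    rw [e1, e2, hy, Real.mul_rpow hP0.le (Real.exp_pos _).le, ← Real.exp_mul]
    congr 2; ring
  rw [h3, ← pow_mul, mul_comm 2 P, pow_mul]
  exact pow_le_pow_left₀ (by positivity) h2 2

/-- Squares are compared. The power `n ^ P` exceeds the permitted `n ^ (2 u)` by at most `n²`, and
the assumption `n ≤ A P ^ E` makes `n²` at most exponential in `P`, so `c₀ ^ P` absorbs it. -/
theorem abs_le_of_small {A C' γ c₀ d : ℝ} (hA : 1 ≤ A) (hC' : 1 ≤ C') (hγ : 0 ≤ γ)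
    {E P n : ℕ} (hP : 3 ≤ P) (hn : 1 ≤ n) (hnA : (n : ℝ) ≤ A * (P : ℝ) ^ E)
    (hd : d ^ 2 ≤ 4 * (C' * n * (P : ℝ) ^ (1 + 2 * γ)) ^ P)
    (hc₀ : 4 * A ^ 2 * ((2 * E).factorial : ℝ) * (C' * Real.exp (3 + 2 * γ)) ≤ c₀) :
    |d| ≤ c₀ ^ P * (P.factorial : ℝ) ^ (1 + γ) * (n : ℝ) ^ ((P - 1) / 2) /
      (P : ℝ) ^ ((P - 1) / 2) := by
  set u := (P - 1) / 2 with hu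
  have hP0 : (0 : ℝ) < P := by exact_mod_cast (by omega : 0 < P)
  have hP1 : (1 : ℝ) ≤ P := by exact_mod_cast (by omega : 1 ≤ P)
  have hn1 : (1 : ℝ) ≤ n := by exact_mod_cast hn
  set k := 4 * A ^ 2 * ((2 * E).factorial : ℝ) with hk
  have hfacE : (1 : ℝ) ≤ (2 * E).factorial := by exact_mod_cast Nat.factorial_pos _
  have hk1 : 1 ≤ k := by
    have : 1 ≤ A ^ 2 := one_le_pow₀ hA
    exact one_le_mul_of_one_le_of_one_le (by linarith) hfacE
  have hexp : 1 ≤ Real.exp (3 + 2 * γ) := Real.one_le_exp (by linarith)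
  have hc₀1 : 1 ≤ c₀ := (one_le_mul_of_one_le_of_one_le hk1
    (one_le_mul_of_one_le_of_one_le hC' hexp)).trans hc₀
  set q := (P : ℝ) ^ (1 + 2 * γ) with hq
  have hq0 : 0 < q := Real.rpow_pos_of_pos hP0 _
  have hF := le_factorial_rpow_sq hγ (show 1 ≤ P by omega)
  rw [← hq] at hF
  set F := (P.factorial : ℝ) ^ (1 + γ) with hFdef
  refine abs_le_of_sq_le_sq ?_ (by positivity)
  refine hd.trans ?_
  rw [div_pow, le_div_iff₀ (by positivity)]
  have h1 : ((P : ℝ) ^ u) ^ 2 ≤ (P : ℝ) ^ P := by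
    rw [← pow_mul]; exact pow_le_pow_right₀ hP1 (by omega)
  have h2 : (n : ℝ) ^ P ≤ (n : ℝ) ^ 2 * ((n : ℝ) ^ u) ^ 2 := by
    rw [← pow_mul, ← pow_add]; exact pow_le_pow_right₀ hn1 (by omega)
  have h3 : 4 * (n : ℝ) ^ 2 ≤ k * Real.exp P := by
    have h4 := Real.pow_div_factorial_le_exp (P : ℝ) hP0.le (2 * E)
    rw [div_le_iff₀ (by positivity)] at h4
    calc 4 * (n : ℝ) ^ 2 ≤ 4 * (A * (P : ℝ) ^ E) ^ 2 := by gcongr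
      _ = 4 * A ^ 2 * (P : ℝ) ^ (2 * E) := by rw [mul_comm 2 E, pow_mul]; ring
      _ ≤ 4 * A ^ 2 * (Real.exp P * (2 * E).factorial) := by gcongr
      _ = _ := by rw [hk]; ring
  have h5 : k * Real.exp P * C' ^ P * Real.exp (2 + 2 * γ) ^ P ≤ (c₀ ^ P) ^ 2 := by
    calc _ = k * (C' * Real.exp (3 + 2 * γ)) ^ P := by
          have : Real.exp (3 + 2 * γ) ^ P = Real.exp P * Real.exp (2 + 2 * γ) ^ P := by
            rw [← Real.exp_nat_mul, ← Real.exp_nat_mul, ← Real.exp_add]; congr 1; ring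
          rw [mul_pow, this]; ring
      _ ≤ k ^ P * (C' * Real.exp (3 + 2 * γ)) ^ P := by
          gcongr
          exact le_self_pow₀ hk1 (by omega)
      _ = (k * (C' * Real.exp (3 + 2 * γ))) ^ P := (mul_pow _ _ _).symm
      _ ≤ c₀ ^ P := pow_le_pow_left₀ (by positivity) hc₀ _
      _ ≤ _ := le_self_pow₀ (one_le_pow₀ hc₀1) two_ne_zero
  have h6 : Real.exp (2 + 2 * γ) ^ P * Real.exp (-(2 + 2 * γ)) ^ P = 1 := by
    rw [← mul_pow, ← Real.exp_add]; simp
  calc 4 * (C' * n * q) ^ P * ((P : ℝ) ^ u) ^ 2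
      ≤ 4 * (C' * n * q) ^ P * (P : ℝ) ^ P := by gcongr
    _ = 4 * (n : ℝ) ^ P * (C' ^ P * q ^ P * (P : ℝ) ^ P) := by rw [mul_pow, mul_pow]; ring
    _ ≤ 4 * ((n : ℝ) ^ 2 * ((n : ℝ) ^ u) ^ 2) * (C' ^ P * q ^ P * (P : ℝ) ^ P) := by gcongr
    _ = 4 * (n : ℝ) ^ 2 * (((n : ℝ) ^ u) ^ 2 * (C' ^ P * q ^ P * (P : ℝ) ^ P)) := by ring
    _ ≤ k * Real.exp P * (((n : ℝ) ^ u) ^ 2 * (C' ^ P * q ^ P * (P : ℝ) ^ P)) := by gcongr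
    _ = (k * Real.exp P * C' ^ P * Real.exp (2 + 2 * γ) ^ P) * (((n : ℝ) ^ u) ^ 2 *
        (P * q * Real.exp (-(2 + 2 * γ))) ^ P) := by
        rw [mul_pow (_ * _), mul_pow]
        calc _ = k * Real.exp P * (((n : ℝ) ^ u) ^ 2 * (C' ^ P * q ^ P * (P : ℝ) ^ P)) *
              (Real.exp (2 + 2 * γ) ^ P * Real.exp (-(2 + 2 * γ)) ^ P) := by rw [h6, mul_one]
          _ = _ := by ring
    _ ≤ (c₀ ^ P) ^ 2 * (((n : ℝ) ^ u) ^ 2 * F ^ 2) := by gcongr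
    _ = _ := by ring

section Global

variable {Ω₀ 𝒴 X : Type*} [MeasurableSpace Ω₀] [MeasurableSpace 𝒴] [MeasurableSpace X]
  {P : Measure Ω₀} [IsProbabilityMeasure P] {ξ : ℤ → Ω₀ → 𝒴} {m : Measure X}
  [IsProbabilityMeasure m] {v : (X → ℂ) → ℝ≥0∞}
  {T : 𝒴 → X → X} {L : 𝒴 → (X → ℂ) → (X → ℂ)} {h : (ℤ → 𝒴) → X → ℝ} {K : (ℤ → 𝒴) → ℝ}
  {φ : 𝒴 → X → ℝ} {C M lam c₁ c₂ η : ℝ}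

namespace MixingSystem

variable (S : MixingSystem P ξ m v T L h K φ C M lam c₁ c₂ η)
include S

theorem measurable_birkhoff (n : ℕ) : Measurable (birkhoff T φ n) := by
  have : birkhoff T φ n = fun z : (ℤ → 𝒴) × X => ∑ j ∈ Finset.range n, obs T φ j z.1 z.2 := by
    ext z; exact birkhoff_eq T φ n z.1 z.2
  rw [this]
  exact Finset.measurable_fun_sum _ fun j _ => S.measurable_obs j

theorem memLp_birkhoff (n : ℕ) (q : ℝ≥0∞) :
    MemLp (birkhoff T φ n) q (skewMeasure (pathLaw P ξ) m h) := by
  have := S.isProb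
  refine MemLp.of_bound (S.measurable_birkhoff n).aestronglyMeasurable (n * (C * M)) (S.ae_of_ae ?_)
  filter_upwards [S.good] with ω hω x
  rw [birkhoff_eq]
  exact (Finset.abs_sum_le_sum_abs _ _).trans
    ((Finset.sum_le_sum fun j _ => S.system.abs_obs_le hω j x).trans (by simp))

theorem integral_birkhoff (n : ℕ) :
    ∫ z, birkhoff T φ n z ∂(skewMeasure (pathLaw P ξ) m h) = 0 := by
  have := S.isProb
  simp_rw [fun z : (ℤ → 𝒴) × X => birkhoff_eq T φ n z.1 z.2]
  rw [integral_finsetSum _ fun j _ => integrable_of_bdd (S.measurable_obs j).aestronglyMeasurable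
    (C * M) (S.ae_abs_obs_le j)]
  refine Finset.sum_eq_zero fun j _ => ?_
  rw [← S.mean_zero, ← S.integral_comp_skew j (F := fun z => φ (z.1 0) z.2) (S.measurable_obs 0)]
  refine integral_congr_ae (ae_of_all _ fun z => ?_)
  obtain ⟨ω, x⟩ := z
  simp only [skew_iterate]
  simp [obs, shift]

theorem variance_birkhoff (n : ℕ) :
    variance (birkhoff T φ n) (skewMeasure (pathLaw P ξ) m h) =
      ∫ z, birkhoff T φ n z ^ 2 ∂(skewMeasure (pathLaw P ξ) m h) := by
  have := S.isProb
  rw [variance_eq_sub (S.memLp_birkhoff n 2), S.integral_birkhoff]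
  simp

theorem abs_momentCumulant_birkhoff_le {R : ℝ} {B : ℕ} (hR : 1 ≤ R)
    (hρ : ∀ k : ℕ, 1 ≤ k → ∀ g : ℕ,
      gapRate C lam c₁ c₂ η g * (1 + (g : ℝ)) ^ (2 * k) ≤ (R * (k : ℝ) ^ B) ^ k)
    (n : ℕ) (hn : 1 ≤ n) (j : ℕ) :
    |momentCumulant (fun p => ∫ z, birkhoff T φ n z ^ p ∂(skewMeasure (pathLaw P ξ) m h)) j| ≤
      n * (4 * R * (7 * (C * M)) * ((j + 1 : ℕ) : ℝ) ^ (B + 3)) ^ (j + 1) := by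
  have := S.isProb
  have hCM := S.system.one_le_CM
  have hj1 : (1 : ℝ) ≤ ((j + 1 : ℕ) : ℝ) := by exact_mod_cast Nat.succ_le_succ (Nat.zero_le j)
  have h1 := abs_momentCumulant_le (μ := skewMeasure (pathLaw P ξ) m h)
    (X := fun t z => obs T φ t z.1 z.2) (D := 7 * (C * M)) (by linarith) S.measurable_obs
    (fun t => by filter_upwards [S.ae_abs_obs_le t] with z hz; linarith)
    S.momentMixing (j := j) (R := (R * ((j + 1 : ℕ) : ℝ) ^ B) ^ (j + 1))
    (one_le_pow₀ (one_le_mul_of_one_le_of_one_le hR (one_le_pow₀ hj1)))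
    (hρ (j + 1) (by omega)) n hn
  simp_rw [fun z : (ℤ → 𝒴) × X => birkhoff_eq T φ n z.1 z.2]
  refine h1.trans (mul_le_mul_of_nonneg_left ?_ (Nat.cast_nonneg n))
  have h4 : (4 : ℝ) ^ j ≤ 4 ^ (j + 1) := pow_le_pow_right₀ (by norm_num) (by omega)
  rw [← Nat.cast_succ] at *
  calc _ ≤ (R * ((j + 1 : ℕ) : ℝ) ^ B) ^ (j + 1) * ((7 * (C * M)) ^ (j + 1) *
        ((j + 1 : ℕ) : ℝ) ^ (j + 1)) * ((j + 1 : ℕ) : ℝ) ^ (2 * (j + 1)) * 4 ^ (j + 1) := by gcongr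
    _ = _ := by
      rw [pow_mul, ← mul_pow, ← mul_pow, ← mul_pow, ← mul_pow]
      congr 1
      rw [pow_add]
      ring

theorem second_moment_le {R : ℝ} {B : ℕ} (hR : 1 ≤ R)
    (hρ : ∀ k : ℕ, 1 ≤ k → ∀ g : ℕ,
      gapRate C lam c₁ c₂ η g * (1 + (g : ℝ)) ^ (2 * k) ≤ (R * (k : ℝ) ^ B) ^ k)
    (n : ℕ) : ∫ z, birkhoff T φ n z ^ 2 ∂(skewMeasure (pathLaw P ξ) m h) ≤
      (4 * R * (7 * (C * M)) * (2 : ℝ) ^ (B + 3)) ^ 2 * n := by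
  rcases Nat.eq_zero_or_pos n with rfl | hn
  · simp [birkhoff]
  have h1 := S.abs_momentCumulant_birkhoff_le hR hρ n hn 1
  rw [momentCumulant_eq] at h1
  simp only [Finset.sum_range_one, pow_one, S.integral_birkhoff, Nat.sub_zero, mul_zero,
    sub_zero] at h1
  refine (le_abs_self _).trans (h1.trans (le_of_eq ?_))
  norm_num
  ring

/-- Even moments, given a suitable block length. -/
theorem integral_birkhoff_pow_le_of_block {n p N : ℕ} (hn : 1 ≤ n) (hp : 1 ≤ p) (hN : 1 ≤ N)
    {Bd : ℝ} (h1 : n < 2 * N → (n * (2 * (C * M))) ^ (2 * p) ≤ Bd)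
    (h2 : 2 * N ≤ n → ∃ n' : ℕ, 1 ≤ n' ∧ n ≤ 2 * N * n' ∧
      4 ^ p * ((700 * (2 * (C * M) / (1 - Real.exp (-lam))) ^ 2 * n * p) ^ p +
        4 ^ p * ((n * (2 * (2 * (C * M)) * Real.exp (-(2 * lam / 3) * N))) ^ (2 * p) +
          (2 * N) ^ (2 * p) * ((2 * p * (2 * (C * M)) ^ 2 * n' * Real.exp 2) ^ p *
            (1 + n' * (4 * (n' * (2 * (C * M))) ^ (2 * p) *
              (c₁ * Real.exp (-c₂ * (N : ℝ) ^ η)) * Real.exp (4 * p)))))) ≤ Bd) :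
    ∫ z, birkhoff T φ n z ^ (2 * p) ∂(skewMeasure (pathLaw P ξ) m h) ≤ Bd := by
  have := S.isProb
  have hCM := S.system.one_le_CM
  rcases lt_or_ge n (2 * N) with hlt | hge
  · refine le_trans ?_ (h1 hlt)
    refine (le_abs_self _).trans (abs_integral_le_of_bdd _ (S.ae_of_ae ?_))
    filter_upwards [S.good] with ω hω x
    rw [birkhoff_eq, abs_pow]
    refine pow_le_pow_left₀ (abs_nonneg _) ((Finset.abs_sum_le_sum_abs _ _).trans
      ((Finset.sum_le_sum fun j _ => S.system.abs_obs_le hω j x).trans ?_)) _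
    simp only [Finset.sum_const, Finset.card_range, nsmul_eq_mul]
    exact mul_le_mul_of_nonneg_left (by linarith) (Nat.cast_nonneg n)
  · obtain ⟨n', hn', hnn, hle⟩ := h2 hge
    refine (S.integral_birkhoff_pow_le n p hn hp).trans (le_trans ?_ hle)
    exact mul_le_mul_of_nonneg_left (add_le_add le_rfl
      (S.integral_sum_fiberMean_pow_le hN n n' p hn' hp hnn rfl)) (by positivity)

end MixingSystem

end Global


/-! ### Assembling the moment estimate and the growth of the norms. -/

theorem rpow_half_add_two {V : ℝ} (hV : 0 ≤ V) (q : ℕ) :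
    V ^ (((q + 2 : ℕ) : ℝ) / 2) = V * V ^ ((q : ℝ) / 2) := by
  rw [show ((q + 2 : ℕ) : ℝ) / 2 = 1 + (q : ℝ) / 2 by push_cast; ring,
    Real.rpow_add_of_nonneg hV zero_le_one (by positivity), Real.rpow_one]

theorem gaussian_moment_sq_le (p : ℕ) : (∫ x, x ^ p ∂(gaussianReal 0 1)) ^ 2 ≤ (p : ℝ) ^ p := by
  rcases Nat.even_or_odd' p with ⟨k, rfl | rfl⟩
  · have h1 := gaussian_moment_even_le k
    have h2 := pow_le_pow_left₀ (gaussian_moment_nonneg (2 * k)) h1 2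
    refine h2.trans (le_of_eq ?_)
    rw [← pow_mul, mul_comm k 2]
    push_cast
    rfl
  · rw [gaussian_moment_odd, sq, mul_zero]
    positivity

section Global

variable {Ω₀ 𝒴 X : Type*} [MeasurableSpace Ω₀] [MeasurableSpace 𝒴] [MeasurableSpace X]
  {P : Measure Ω₀} [IsProbabilityMeasure P] {ξ : ℤ → Ω₀ → 𝒴} {m : Measure X}
  [IsProbabilityMeasure m] {v : (X → ℂ) → ℝ≥0∞}
  {T : 𝒴 → X → X} {L : 𝒴 → (X → ℂ) → (X → ℂ)} {h : (ℤ → 𝒴) → X → ℝ} {K : (ℤ → 𝒴) → ℝ}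
  {φ : 𝒴 → X → ℝ} {C M lam c₁ c₂ η : ℝ}

namespace MixingSystem

variable (S : MixingSystem P ξ m v T L h K φ C M lam c₁ c₂ η)
include S

/-- The Rosenthal type estimate, with the constant expressed through the cumulant bounds and the
bounds of even moments for few summands. -/
theorem abs_moment_sub_le {R D D₀ C₂ A c₀ : ℝ} {B E : ℕ} (hR : 1 ≤ R)
    (hρ : ∀ k : ℕ, 1 ≤ k → ∀ g : ℕ,
      gapRate C lam c₁ c₂ η g * (1 + (g : ℝ)) ^ (2 * k) ≤ (R * (k : ℝ) ^ B) ^ k)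
    (hD₀ : D₀ = 4 * R * (7 * (C * M))) (hC₂ : C₂ = (D₀ * (2 : ℝ) ^ (B + 3)) ^ 2)
    (hA : A = 4 * D₀ ^ 6) (hE : E = 6 * (B + 3) + 3) (hD : 1 ≤ D)
    (hsmall : ∀ n p : ℕ, 1 ≤ n → 1 ≤ p → (n : ℝ) ≤ A * (p : ℝ) ^ E →
      ∫ z, birkhoff T φ n z ^ (2 * p) ∂(skewMeasure (pathLaw P ξ) m h) ≤
        (D * n * (p : ℝ) ^ (1 + 2 * (1 / η))) ^ p)
    (hc₁' : 8 * D₀ ^ 6 * (E.factorial : ℝ) * Real.exp 3 * Real.exp (1 + 3 * C₂) ≤ c₀)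
    (hc₂' : 4 * A ^ 2 * ((2 * E).factorial : ℝ) *
      ((D + C₂) * Real.exp (3 + 2 * (1 / η))) ≤ c₀) (hc₀ : 0 < c₀) (p n : ℕ) (hp : 1 ≤ p) :
    |∫ z, birkhoff T φ n z ^ p ∂(skewMeasure (pathLaw P ξ) m h) -
        (variance (birkhoff T φ n) (skewMeasure (pathLaw P ξ) m h)) ^ ((p : ℝ) / 2) *
          ∫ x, x ^ p ∂(gaussianReal 0 1)| ≤ rosenthalBound c₀ (1 / η) p n := by
  have hprob := S.isProb
  have hCM := S.system.one_le_CM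
  have hγ : 0 ≤ 1 / η := by have := S.η_pos; positivity
  have hD₀1 : 1 ≤ D₀ := by
    rw [hD₀]; exact one_le_mul_of_one_le_of_one_le (by linarith) (by linarith)
  have hC₂1 : 1 ≤ C₂ := by
    rw [hC₂]
    exact one_le_pow₀ (one_le_mul_of_one_le_of_one_le hD₀1 (one_le_pow₀ (by norm_num)))
  have hA1 : 1 ≤ A := by
    rw [hA]; exact one_le_mul_of_one_le_of_one_le (by norm_num) (one_le_pow₀ hD₀1)
  set μ := skewMeasure (pathLaw P ξ) m h with hμ
  set mom : ℕ → ℝ := fun p => ∫ z, birkhoff T φ n z ^ p ∂μ with hmom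
  have hm0 : mom 0 = 1 := by simp [hmom]
  have hm1 : mom 1 = 0 := by simpa [hmom] using S.integral_birkhoff n
  have hvar : variance (birkhoff T φ n) μ = mom 2 := S.variance_birkhoff n
  have hV0 : 0 ≤ mom 2 := integral_nonneg fun z => sq_nonneg _
  have hV : mom 2 ≤ C₂ * n := by
    have := S.second_moment_le hR hρ n
    rwa [← hD₀, ← hC₂] at this
  rw [hvar]
  set G : ℕ → ℝ := fun q => mom 2 ^ ((q : ℝ) / 2) * ∫ x, x ^ q ∂(gaussianReal 0 1) with hG
  have hGadd : ∀ q : ℕ, G (q + 2) = (q + 1) * (mom 2 * G q) := fun q => by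
    simp only [hG]
    rw [rpow_half_add_two hV0, gaussian_moment_add_two]
    ring
  have hG0 : G 0 = 1 := by simp [hG]
  have hG1 : G 1 = 0 := by simp [hG]
  change |mom p - G p| ≤ _
  have hnonneg := rosenthalBound_nonneg (γ := 1 / η) hc₀ p n
  -- For `p ≤ 2` the sum on the right is empty, so equality is required. It holds because the mean
  -- is zero and the second moment is the variance.
  rcases Nat.lt_or_ge p 3 with hp3 | hp3
  · interval_cases p
    · rw [hm1, hG1]; simpa using hnonneg
    · have := hGadd 0
      rw [hG0] at this
      rw [this]; simpa using hnonneg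
  rcases Nat.eq_zero_or_pos n with hn0 | hn
  · have h1 : ∀ q, 1 ≤ q → mom q = 0 := fun q hq => by
      simp [hmom, hn0, birkhoff, show q ≠ 0 by omega]
    have h2 : G p = 0 := by
      simp only [hG, h1 2 (by norm_num)]
      rw [Real.zero_rpow (by positivity), zero_mul]
    rw [h1 p hp, h2]; simpa using hnonneg
  refine le_trans ?_ (le_rosenthalBound hc₀ hp3 n)
  have hp0 : (0 : ℝ) < p := by exact_mod_cast hp
  have hp1 : (1 : ℝ) ≤ p := by exact_mod_cast hp
  -- With `c = D₀ p ^ (B + 3)`, the threshold `A p ^ E` is exactly the `4 c ^ 6 p ^ 3` demanded by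
  -- `abs_moment_sub_gaussian_le`.
  rcases le_total (A * (p : ℝ) ^ E) n with hbig | hsm
  · set c := D₀ * (p : ℝ) ^ (B + 3) with hc
    have hc1 : 1 ≤ c := one_le_mul_of_one_le_of_one_le hD₀1 (one_le_pow₀ hp1)
    have h1 := RandomSkew.abs_moment_sub_gaussian_le (m := mom) (G := G) (P := p) (n := n) (c := c)
      (C₂ := C₂) hm0 hm1 hc1 hC₂1 hp3 hV0 hV (fun j hj => by
        refine (S.abs_momentCumulant_birkhoff_le hR hρ n hn j).trans ?_
        rw [← hD₀]
        have h2 : ((j + 1 : ℕ) : ℝ) ≤ p := by exact_mod_cast hj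
        have h3 : D₀ * ((j + 1 : ℕ) : ℝ) ^ (B + 3) ≤ c := by rw [hc]; gcongr
        exact mul_le_mul_of_nonneg_left (pow_le_pow_left₀ (by positivity) h3 _)
          (Nat.cast_nonneg n)) (by
        refine le_trans (le_of_eq ?_) hbig
        rw [hA, hE, hc, pow_add (p : ℝ) (6 * (B + 3)) 3, mul_comm 6 (B + 3), pow_mul]; ring)
      hG0 hG1 hGadd
    rw [le_div_iff₀ (by positivity)]
    refine h1.trans ?_
    rw [hE] at hc₁'
    exact mul_le_mul_of_nonneg_right (le_of_large hD₀1 hγ hp3 hc₁') (by positivity)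
  -- Below the threshold the two terms are estimated separately. The moment is treated through `(E
  -- S^p)² ≤ E S^{2p}`, so odd orders need no separate argument.
  · refine abs_le_of_small (C' := D + C₂) hA1 (by linarith) hγ hp3 hn hsm ?_ hc₂'
    have h1 : mom p ^ 2 ≤ (D * n * (p : ℝ) ^ (1 + 2 * (1 / η))) ^ p := by
      refine le_trans ?_ (hsmall n p hn hp hsm)
      have hv := variance_nonneg (fun z => birkhoff T φ n z ^ p) μ
      have hL : MemLp (fun z => birkhoff T φ n z ^ p) 2 μ := by
        refine (memLp_two_iff_integrable_sq
          ((S.measurable_birkhoff n).pow_const p).aestronglyMeasurable).2 ?_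
        simp_rw [← pow_mul]
        exact S.integrable_pow_birkhoff n _
      rw [variance_eq_sub hL] at hv
      have e : ∫ z, ((fun z => birkhoff T φ n z ^ p) ^ 2) z ∂μ =
          ∫ z, birkhoff T φ n z ^ (2 * p) ∂μ := by
        congr 1; ext z; simp only [Pi.pow_apply]; rw [← pow_mul, mul_comm p 2]
      rw [e] at hv
      exact sub_nonneg.1 hv
    have hq : (p : ℝ) ≤ (p : ℝ) ^ (1 + 2 * (1 / η)) := by
      conv_lhs => rw [← Real.rpow_one (p : ℝ)]
      exact Real.rpow_le_rpow_of_exponent_le hp1 (by linarith)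
    have h2 : G p ^ 2 ≤ (C₂ * n * (p : ℝ) ^ (1 + 2 * (1 / η))) ^ p := by
      have e : (mom 2 ^ ((p : ℝ) / 2)) ^ 2 = mom 2 ^ p := by
        rw [← Real.rpow_natCast, ← Real.rpow_mul hV0]
        push_cast
        rw [div_mul_cancel₀ _ two_ne_zero, Real.rpow_natCast]
      calc G p ^ 2 = mom 2 ^ p * (∫ x, x ^ p ∂(gaussianReal 0 1)) ^ 2 := by
            simp only [hG]; rw [mul_pow, e]
        _ ≤ (C₂ * n) ^ p * (p : ℝ) ^ p := by
            gcongr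
            exact gaussian_moment_sq_le p
        _ ≤ (C₂ * n) ^ p * ((p : ℝ) ^ (1 + 2 * (1 / η))) ^ p := by gcongr
        _ = _ := by rw [← mul_pow]
    have h3 : (D * n * (p : ℝ) ^ (1 + 2 * (1 / η))) ^ p ≤
        ((D + C₂) * n * (p : ℝ) ^ (1 + 2 * (1 / η))) ^ p := by
      gcongr; linarith
    have h4 : (C₂ * n * (p : ℝ) ^ (1 + 2 * (1 / η))) ^ p ≤
        ((D + C₂) * n * (p : ℝ) ^ (1 + 2 * (1 / η))) ^ p := by
      gcongr; linarith
    nlinarith [sq_nonneg (mom p + G p)]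

/-- The `L^q` norms of the Birkhoff sums grow at most like `√n`. -/
theorem eLpNorm_birkhoff_isBigO {C₂ c₀ γ : ℝ}
    (hV : ∀ n : ℕ, variance (birkhoff T φ n) (skewMeasure (pathLaw P ξ) m h) ≤ C₂ * n)
    (hm : ∀ p n : ℕ, 1 ≤ p →
      |∫ z, birkhoff T φ n z ^ p ∂(skewMeasure (pathLaw P ξ) m h) -
        (variance (birkhoff T φ n) (skewMeasure (pathLaw P ξ) m h)) ^ ((p : ℝ) / 2) *
          ∫ x, x ^ p ∂(gaussianReal 0 1)| ≤ rosenthalBound c₀ γ p n) {q : ℝ} (hq : 0 < q) :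
    (fun n : ℕ => (eLpNorm (birkhoff T φ n) (ENNReal.ofReal q)
      (skewMeasure (pathLaw P ξ) m h)).toReal) =O[atTop] fun n : ℕ => Real.sqrt n := by
  have hprob := S.isProb
  set μ := skewMeasure (pathLaw P ξ) m h with hμ
  -- The exponent `2 p ≥ q` is even, so the corresponding norm is expressed by a plain moment.
  set p := ⌈q⌉₊ with hp
  have hp1 : 1 ≤ p := Nat.one_le_ceil_iff.2 hq
  have hqp : q ≤ (2 * p : ℕ) := by
    have := Nat.le_ceil q
    push_cast
    have : (0 : ℝ) ≤ p := Nat.cast_nonneg p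
    linarith
  set g := ∫ x, x ^ (2 * p) ∂(gaussianReal 0 1) with hg
  have hg0 : 0 ≤ g := gaussian_moment_nonneg _
  have hmom : (fun n : ℕ => ∫ z, birkhoff T φ n z ^ (2 * p) ∂μ) =O[atTop]
      fun n : ℕ => (n : ℝ) ^ p := by
    have h1 : (fun n : ℕ => rosenthalBound c₀ γ (2 * p) n) =O[atTop] fun n : ℕ => (n : ℝ) ^ p := by
      refine (rosenthalBound_isBigO c₀ γ (2 * p)).trans (IsBigO.of_bound 1 ?_)
      filter_upwards [eventually_ge_atTop 1] with n hn
      have hn1 : (1 : ℝ) ≤ n := by exact_mod_cast hn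
      rw [one_mul, Real.norm_of_nonneg (by positivity), Real.norm_of_nonneg (by positivity)]
      exact pow_le_pow_right₀ hn1 (by omega)
    have h2 : (fun n : ℕ => variance (birkhoff T φ n) μ ^ p * g) =O[atTop]
        fun n : ℕ => (n : ℝ) ^ p := by
      refine IsBigO.of_bound (C₂ ^ p * g) (Eventually.of_forall fun n => ?_)
      have hv0 := variance_nonneg (birkhoff T φ n) μ
      rw [Real.norm_of_nonneg (by positivity), Real.norm_of_nonneg (by positivity)]
      calc _ ≤ (C₂ * n) ^ p * g := by gcongr; exact hV n
        _ = _ := by rw [mul_pow]; ring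
    have h3 : (fun n : ℕ => ∫ z, birkhoff T φ n z ^ (2 * p) ∂μ -
        variance (birkhoff T φ n) μ ^ p * g) =O[atTop]
        fun n : ℕ => rosenthalBound c₀ γ (2 * p) n := by
      refine IsBigO.of_bound 1 (Eventually.of_forall fun n => ?_)
      have h4 := hm (2 * p) n (by omega)
      rw [show (((2 * p : ℕ) : ℝ) / 2) = (p : ℝ) by push_cast; ring, Real.rpow_natCast] at h4
      rw [one_mul]
      exact h4.trans (le_abs_self _)
    simpa using (h3.trans h1).add h2
  obtain ⟨D, hD0, hD⟩ := hmom.exists_nonneg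
  refine IsBigO.of_bound (D ^ (((2 * p : ℕ) : ℝ)⁻¹)) ?_
  filter_upwards [hD.bound] with n hn
  have h2p : (2 * p : ℕ) ≠ 0 := by omega
  have hle : eLpNorm (birkhoff T φ n) (ENNReal.ofReal q) μ ≤
      eLpNorm (birkhoff T φ n) ((2 * p : ℕ) : ℝ≥0∞) μ := by
    refine eLpNorm_le_eLpNorm_of_exponent_le ?_ (S.measurable_birkhoff n).aestronglyMeasurable
    rw [← ENNReal.ofReal_natCast]
    exact ENNReal.ofReal_le_ofReal hqp
  have hform := (S.memLp_birkhoff n ((2 * p : ℕ) : ℝ≥0∞)).eLpNorm_eq_integral_rpow_norm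
    (by exact_mod_cast h2p) (ENNReal.natCast_ne_top _)
  have hpos : 0 ≤ ∫ z, birkhoff T φ n z ^ (2 * p) ∂μ :=
    integral_nonneg fun z => (even_two_mul p).pow_nonneg _
  have e : ∫ z, ‖birkhoff T φ n z‖ ^ (((2 * p : ℕ) : ℝ≥0∞)).toReal ∂μ =
      ∫ z, birkhoff T φ n z ^ (2 * p) ∂μ := by
    congr 1; ext z
    rw [ENNReal.toReal_natCast, Real.rpow_natCast, Real.norm_eq_abs, abs_pow_two_mul]
  rw [e, ENNReal.toReal_natCast] at hform
  rw [Real.norm_of_nonneg ENNReal.toReal_nonneg, Real.norm_of_nonneg (Real.sqrt_nonneg _)]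
  rw [Real.norm_of_nonneg hpos, Real.norm_of_nonneg (by positivity)] at hn
  have h5 : (eLpNorm (birkhoff T φ n) (ENNReal.ofReal q) μ).toReal ≤
      (∫ z, birkhoff T φ n z ^ (2 * p) ∂μ) ^ (((2 * p : ℕ) : ℝ)⁻¹) :=
    ENNReal.toReal_le_of_le_ofReal (by positivity) (hle.trans hform.le)
  refine h5.trans ((Real.rpow_le_rpow hpos hn (by positivity)).trans (le_of_eq ?_))
  rw [Real.mul_rpow hD0 (by positivity)]
  congr 1
  have hs : (n : ℝ) ^ p = Real.sqrt n ^ (2 * p) := by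
    rw [pow_mul, Real.sq_sqrt (Nat.cast_nonneg n)]
  rw [hs, ← Real.rpow_natCast, ← Real.rpow_mul (Real.sqrt_nonneg _),
    mul_inv_cancel₀ (by exact_mod_cast h2p), Real.rpow_one]

end MixingSystem

end Global

end RandomSkew

end

/-! ### Choice of constants and conclusion. -/

theorem mainTheorem6 (c₁ c₂ η C₀ lam M : ℝ) (hc₁ : 0 < c₁) (hc₂ : 0 < c₂) (hη : 0 < η)
    (hlam : 0 < lam) :
    ∃ c₀ : ℝ, 0 < c₀ ∧
      ∀ (Ω₀ 𝒴 X : Type*) [MeasurableSpace Ω₀] [MeasurableSpace 𝒴] [MeasurableSpace X]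
        (P : Measure Ω₀) [IsProbabilityMeasure P] (ξ : ℤ → Ω₀ → 𝒴)
        (m : Measure X) [IsProbabilityMeasure m] (v : (X → ℂ) → ℝ≥0∞)
        (T : 𝒴 → X → X) (L : 𝒴 → (X → ℂ) → (X → ℂ))
        (h : (ℤ → 𝒴) → X → ℝ) (K : (ℤ → 𝒴) → ℝ) (φ : 𝒴 → X → ℝ),
        RandomSkew.IsStationaryProcess P ξ →
        RandomSkew.IsVariation m v C₀ →
        Measurable (RandomSkew.skew T) →
        (∀ y, RandomSkew.IsTransferOperator m (T y) (L y)) →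
        RandomSkew.StandingAssumption (RandomSkew.pathLaw P ξ) m v T L h K lam →
        (∀ n : ℕ, 1 ≤ n → RandomSkew.alphaMixing P ξ n ≤ c₁ * Real.exp (-c₂ * (n : ℝ) ^ η)) →
        Measurable (Function.uncurry φ) →
        ∫ z, φ (z.1 0) z.2 ∂(RandomSkew.skewMeasure (RandomSkew.pathLaw P ξ) m h) = 0 →
        RandomSkew.scaledNorm (RandomSkew.pathLaw P ξ) m v K φ ≤ ENNReal.ofReal M →
        (∀ p : ℕ, 1 ≤ p →
          (∀ n : ℕ,
            Integrable (fun z => RandomSkew.birkhoff T φ n z ^ p)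
              (RandomSkew.skewMeasure (RandomSkew.pathLaw P ξ) m h) ∧
            |∫ z, RandomSkew.birkhoff T φ n z ^ p
                  ∂(RandomSkew.skewMeasure (RandomSkew.pathLaw P ξ) m h)
                - (variance (RandomSkew.birkhoff T φ n)
                    (RandomSkew.skewMeasure (RandomSkew.pathLaw P ξ) m h)) ^ ((p : ℝ) / 2)
                  * ∫ x, x ^ p ∂(gaussianReal 0 1)|
              ≤ RandomSkew.rosenthalBound c₀ (1 / η) p n) ∧
          (fun n : ℕ => RandomSkew.rosenthalBound c₀ (1 / η) p n)
            =O[atTop] (fun n : ℕ => (n : ℝ) ^ ((p - 1) / 2))) ∧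
        (∀ q : ℝ, 0 < q →
          (∀ n : ℕ, MemLp (RandomSkew.birkhoff T φ n) (ENNReal.ofReal q)
            (RandomSkew.skewMeasure (RandomSkew.pathLaw P ξ) m h)) ∧
          (fun n : ℕ => (eLpNorm (RandomSkew.birkhoff T φ n) (ENNReal.ofReal q)
              (RandomSkew.skewMeasure (RandomSkew.pathLaw P ξ) m h)).toReal)
            =O[atTop] (fun n : ℕ => Real.sqrt n)) := by
  -- Normalizing to constants at least `1`. Everything entering `c₀` is fixed from here on, before
  -- any system is introduced, which gives the required uniformity.
  set C := max C₀ 1 with hC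
  set M' := max M 1 with hM'
  have hC1 : 1 ≤ C := le_max_right _ _
  have hM1 : 1 ≤ M' := le_max_right _ _
  have hCM : 1 ≤ C * M' := one_le_mul_of_one_le_of_one_le hC1 hM1
  obtain ⟨R, hR, B, hρ⟩ := RandomSkew.exists_gapRate_bound hC1 hlam hc₁ hc₂ hη
  obtain ⟨D₀, hD₀⟩ : ∃ D₀, D₀ = 4 * R * (7 * (C * M')) := ⟨_, rfl⟩
  obtain ⟨C₂, hC₂⟩ : ∃ C₂, C₂ = (D₀ * (2 : ℝ) ^ (B + 3)) ^ 2 := ⟨_, rfl⟩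
  obtain ⟨A, hA⟩ : ∃ A, A = 4 * D₀ ^ 6 := ⟨_, rfl⟩
  obtain ⟨E, hE⟩ : ∃ E, E = 6 * (B + 3) + 3 := ⟨_, rfl⟩
  have hD₀1 : 1 ≤ D₀ := by
    rw [hD₀]; exact one_le_mul_of_one_le_of_one_le (by linarith) (by linarith)
  have hA1 : 1 ≤ A := by
    rw [hA]; exact one_le_mul_of_one_le_of_one_le (by norm_num) (one_le_pow₀ hD₀1)
  have hC₂0 : 0 ≤ C₂ := by rw [hC₂]; positivity
  obtain ⟨D, hD, hblock⟩ := RandomSkew.exists_even_moment_const (b := 2 * (C * M'))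
    (U := 2 * (C * M') / (1 - Real.exp (-lam))) (by linarith) hlam hc₁ hc₂ hη hA1
    (show 1 ≤ E by omega)
  have hk₁ : 0 < 8 * D₀ ^ 6 * (E.factorial : ℝ) * Real.exp 3 * Real.exp (1 + 3 * C₂) := by
    positivity
  have hk₂ : 0 ≤ 4 * A ^ 2 * ((2 * E).factorial : ℝ) *
      ((D + C₂) * Real.exp (3 + 2 * (1 / η))) := by positivity
  -- The sum of the lower bounds required by the regimes of large and of small `n`.
  refine ⟨8 * D₀ ^ 6 * (E.factorial : ℝ) * Real.exp 3 * Real.exp (1 + 3 * C₂) +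
    4 * A ^ 2 * ((2 * E).factorial : ℝ) * ((D + C₂) * Real.exp (3 + 2 * (1 / η))),
    add_pos_of_pos_of_nonneg hk₁ hk₂, ?_⟩
  intro Ω₀ 𝒴 X _ _ _ P _ ξ m _ v T L h K φ hξ hv hT hL H hα hφ h0 hM
  have S := H.mixingSystem hc₁ hc₂ hη hlam hξ hv hT hL hα hφ h0 hM
  have hest := fun p n hp => S.abs_moment_sub_le hR hρ hD₀ hC₂ hA hE hD (fun n p hn hp hnA => by
    obtain ⟨N, hN, h1, h2⟩ := hblock n p hn hp hnA
    exact S.integral_birkhoff_pow_le_of_block hn hp hN h1 h2)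
    (le_add_of_nonneg_right hk₂) (le_add_of_nonneg_left hk₁.le)
    (add_pos_of_pos_of_nonneg hk₁ hk₂) p n hp
  refine ⟨fun p hp => ⟨fun n => ⟨S.integrable_pow_birkhoff n p, hest p n hp⟩,
    RandomSkew.rosenthalBound_isBigO _ _ p⟩, fun q hq => ⟨fun n => S.memLp_birkhoff n _,
    S.eLpNorm_birkhoff_isBigO (C₂ := C₂) (fun n => ?_) hest hq⟩⟩
  rw [S.variance_birkhoff]
  have h3 := S.second_moment_le hR hρ n
  rwa [← hD₀, ← hC₂] at h3
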